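/- Let $(M,g,k)$ be a smooth three-dimensional initial data set, i.e. $M$ is a smooth 3-manifold (without boundary), $g$ a smooth Riemannian metric and $k$ a smooth symmetric 2-tensor field on $M$. Put $$\mu=\tfrac12\big(R+(\operatorname{tr}_g k)^2-|k|^2\big),\qquad J=\operatorname{div}\big(k-\operatorname{tr}_g(k)\,g\big),$$ where $R$ is the scalar curvature of $g$. Let $E$ be a $C^1$ vector field on $M$ with $\operatorname{div}E=0$, and let $u,v\in C^3(M)$ satisfy $|\nabla u|\neq0$, $|\nabla v|\ne 0$ everywhere. Write $\nu_u=\frac{\nabla u}{|\nabla u|}$, $\nu_v=\frac{\nabla v}{|\nabla v|}$, $\xi=\sqrt{|\nabla u||\nabla v|}$, let $\eta=\frac{\nu_u+\nu_v}{|\nu_u+\nu_v|}$ at points where $\nu_u\neq-\nu_v$ and $\eta=0$ at points where $\nu_u=-\nu_v$, and write $E_\eta=\langle E,\eta\rangle$, $\nabla_\eta f=\langle\nabla f,\eta\rangle$. Suppose that on $M$ $$\Delta u=\xi E_\eta-\operatorname{tr}_g(k)|\nabla u|,\qquad \Delta v=\xi E_\eta+\operatorname{tr}_g(k)|\nabla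 v|.$$ Define $$\begin{aligned}(\mathcal E^2_+)_{ij}u&=\nabla^2_{ij}u+\xi\eta_iE_j+\xi\eta_jE_i-\xi E_\eta g_{ij}+k_{ij}|\nabla u|,\\ (\mathcal E^2_-)_{ij}v&=\nabla^2_{ij}v+\xi\eta_iE_j+\xi\eta_jE_i-\xi E_\eta g_{ij}-k_{ij}|\nabla v|,\end{aligned}$$ $$\begin{aligned}Z=\;&\nabla|\nabla u|-\Delta u\frac{\nabla u}{|\nabla u|}+\nabla|\nabla v|-\Delta v\frac{\nabla v}{|\nabla v|}+2\xi^{-1}\big(|\nabla u|\nabla_\eta v+|\nabla v|\nabla_\eta u\big)E\\&-\operatorname{tr}_g(k)\nabla u+\operatorname{tr}_g(k)\nabla v+k(\nabla u,\cdot)-k(\nabla v,\cdot),\end{aligned}$$ and let $K_u(p),K_v(p)$ denote the Gaussian curvatures at $p$ (with respect to the induced metric) of the level sets of $u$ and of $v$ through $p$. These are well defined, i.e. these level sets have $C^3$ local parametrizations near $p$ and the curvature at $p$ does not depend on the parametrization. (a) At every point where $\nu_u\neq-\nu_v$, the vector field $Z$ is differentiable and $$\begin{aligned}\operatorname{div}Z=\;&\frac1{2|\nabla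 u|}\Big(|\mathcal E^2_+u|^2+|\nabla u|^2(2\mu-2K_u-2|E|^2)+2|\nabla u|\langle J,\nabla u\rangle\Big)\\&+\frac1{2|\nabla v|}\Big(|\mathcal E^2_-v|^2+|\nabla v|^2(2\mu-2K_v-2|E|^2)-2|\nabla v|\langle J,\nabla v\rangle\Big).\end{aligned}$$ (b) At every point where $\nu_u=-\nu_v$ and $Z$ is differentiable (in particular at every interior point of the set $\{\nu_u=-\nu_v\}$, where $Z$ is always differentiable), the same identity holds without the two terms $-2|E|^2$. -/

import Mathlib

open scoped Manifold ContDiff Topology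
open Bundle

/-- Coordinate space of dimension `n`. -/
abbrev Coord (n : ℕ) : Type := EuclideanSpace ℝ (Fin n)

/-! ### Riemannian geometry in coordinates

A metric in coordinates is given by its coefficient matrix `G x = (g_ij(x))`.
Vector fields are given by their components `X^i`, covariant tensors by `T_ij`. -/

namespace CoordGeom

variable {n : ℕ}

/-- The partial derivative `∂_i f`. -/
noncomputable def pd (i : Fin n) (f : Coord n → ℝ) (x : Coord n) : ℝ :=
  fderiv ℝ f x (EuclideanSpace.single i 1)

/-- Christoffel symbols `Γ^l_{ij} = ½ g^{lm} (∂_i g_{mj} + ∂_j g_{mi} - ∂_m g_{ij})`. -/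
noncomputable def christoffel (G : Coord n → Matrix (Fin n) (Fin n) ℝ)
    (l i j : Fin n) (x : Coord n) : ℝ :=
  (1 / 2) * ∑ m, (G x)⁻¹ l m *
    (pd i (fun y => G y m j) x + pd j (fun y => G y m i) x - pd m (fun y => G y i j) x)

/-- The curvature tensor `R^l_{kij}`, with the convention `R(∂_i, ∂_j) ∂_k = R^l_{kij} ∂_l` and
`R(X, Y) = ∇_X ∇_Y - ∇_Y ∇_X - ∇_[X,Y]`. -/
noncomputable def riemann (G : Coord n → Matrix (Fin n) (Fin n) ℝ)
    (l k i j : Fin n) (x : Coord n) : ℝ :=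
  pd i (christoffel G l j k) x - pd j (christoffel G l i k) x
    + ∑ m, (christoffel G l i m x * christoffel G m j k x
      - christoffel G l j m x * christoffel G m i k x)

/-- The scalar curvature `g^{jk} R^i_{kij}` (positive on round spheres). -/
noncomputable def scalarCurv (G : Coord n → Matrix (Fin n) (Fin n) ℝ) (x : Coord n) : ℝ :=
  ∑ j, ∑ k, (G x)⁻¹ j k * ∑ i, riemann G i k i j x

/-- The Gaussian curvature `⟨R(∂_0, ∂_1) ∂_1, ∂_0⟩ / det g` of a two-dimensional metric. -/
noncomputable def gaussCurv (G : Coord 2 → Matrix (Fin 2) (Fin 2) ℝ) (x : Coord 2) : ℝ :=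
  (∑ l, G x 0 l * riemann G l 1 0 1 x) / (G x).det

/-- The inner product `g_ij X^i Y^j` at the point `x`. -/
noncomputable def ip (G : Coord n → Matrix (Fin n) (Fin n) ℝ) (x : Coord n)
    (X Y : Fin n → ℝ) : ℝ :=
  ∑ i, ∑ j, G x i j * X i * Y j

/-- The length `|X|` at the point `x`. -/
noncomputable def len (G : Coord n → Matrix (Fin n) (Fin n) ℝ) (x : Coord n)
    (X : Fin n → ℝ) : ℝ :=
  √(ip G x X X)

/-- Lowering an index: `X_i = g_ij X^j`. -/
noncomputable def lower (G : Coord n → Matrix (Fin n) (Fin n) ℝ) (x : Coord n)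
    (X : Fin n → ℝ) : Fin n → ℝ :=
  fun i => ∑ j, G x i j * X j

/-- Raising an index: `α^i = g^ij α_j`. -/
noncomputable def raise (G : Coord n → Matrix (Fin n) (Fin n) ℝ) (x : Coord n)
    (α : Fin n → ℝ) : Fin n → ℝ :=
  fun i => ∑ j, (G x)⁻¹ i j * α j

/-- The gradient `∇f`, as a vector field. -/
noncomputable def grad (G : Coord n → Matrix (Fin n) (Fin n) ℝ) (f : Coord n → ℝ)
    (x : Coord n) : Fin n → ℝ :=
  raise G x (fun j => pd j f x)

/-- The covariant Hessian `∇²_{ij} f = ∂_i ∂_j f - Γ^m_{ij} ∂_m f`. -/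
noncomputable def hess (G : Coord n → Matrix (Fin n) (Fin n) ℝ) (f : Coord n → ℝ)
    (x : Coord n) : Matrix (Fin n) (Fin n) ℝ :=
  fun i j => pd i (pd j f) x - ∑ m, christoffel G m i j x * pd m f x

/-- The trace `g^{ij} T_ij` of a covariant 2-tensor. -/
noncomputable def trace (G : Coord n → Matrix (Fin n) (Fin n) ℝ) (x : Coord n)
    (T : Matrix (Fin n) (Fin n) ℝ) : ℝ :=
  ∑ i, ∑ j, (G x)⁻¹ i j * T i j

/-- The squared length `|T|² = g^{ia} g^{jb} T_ij T_ab` of a covariant 2-tensor. -/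
noncomputable def normSq (G : Coord n → Matrix (Fin n) (Fin n) ℝ) (x : Coord n)
    (T : Matrix (Fin n) (Fin n) ℝ) : ℝ :=
  ∑ i, ∑ j, ∑ a, ∑ b, (G x)⁻¹ i a * (G x)⁻¹ j b * T i j * T a b

/-- The Laplacian `Δf = tr_g ∇²f`. -/
noncomputable def laplacian (G : Coord n → Matrix (Fin n) (Fin n) ℝ) (f : Coord n → ℝ)
    (x : Coord n) : ℝ :=
  trace G x (hess G f x)

/-- The divergence `∇_i X^i = ∂_i X^i + Γ^i_{ij} X^j` of a vector field. -/
noncomputable def div (G : Coord n → Matrix (Fin n) (Fin n) ℝ) (X : Coord n → Fin n → ℝ)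
    (x : Coord n) : ℝ :=
  ∑ i, pd i (fun y => X y i) x + ∑ i, ∑ j, christoffel G i i j x * X x j

/-- The divergence `(div T)_j = g^{il} ∇_i T_{lj}` of a covariant 2-tensor field. -/
noncomputable def divTensor (G : Coord n → Matrix (Fin n) (Fin n) ℝ)
    (T : Coord n → Matrix (Fin n) (Fin n) ℝ) (x : Coord n) : Fin n → ℝ :=
  fun j => ∑ i, ∑ l, (G x)⁻¹ i l *
    (pd i (fun y => T y l j) x
      - ∑ m, (christoffel G m i l x * T x m j + christoffel G m i j x * T x l m))

end CoordGeom

/-! ### Initial data sets -/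

/-- A three-dimensional smooth initial data set `(M, g, k)`: a smooth Riemannian metric `g` and
a smooth symmetric 2-tensor field `k`. -/
structure InitialDataSet (M : Type*) [TopologicalSpace M] [ChartedSpace (Coord 3) M]
    [IsManifold (𝓡 3) ∞ M] where
  /-- the Riemannian metric -/
  g : ContMDiffRiemannianMetric (𝓡 3) ∞ (Coord 3) (fun x : M => TangentSpace (𝓡 3) x)
  /-- the symmetric 2-tensor -/
  k : ∀ x : M, TangentSpace (𝓡 3) x →L[ℝ] TangentSpace (𝓡 3) x →L[ℝ] ℝ
  k_symm : ∀ (x : M) (X Y : TangentSpace (𝓡 3) x), k x X Y = k x Y X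
  k_smooth : ContMDiff (𝓡 3) ((𝓡 3).prod 𝓘(ℝ, Coord 3 →L[ℝ] Coord 3 →L[ℝ] ℝ)) ∞
    (fun x : M => TotalSpace.mk' (Coord 3 →L[ℝ] Coord 3 →L[ℝ] ℝ)
      (E := fun x : M => TangentSpace (𝓡 3) x →L[ℝ] TangentSpace (𝓡 3) x →L[ℝ] ℝ) x (k x))

/-- The coordinate expressions of a metric `g`, a symmetric 2-tensor `k`, a vector field `E` and
two functions `u`, `v` in a chart. -/
structure CoordData where
  /-- `g_ij` -/
  g : Coord 3 → Matrix (Fin 3) (Fin 3) ℝ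
  /-- `k_ij` -/
  k : Coord 3 → Matrix (Fin 3) (Fin 3) ℝ
  /-- `E^i` -/
  E : Coord 3 → Fin 3 → ℝ
  /-- the first function -/
  u : Coord 3 → ℝ
  /-- the second function -/
  v : Coord 3 → ℝ

namespace InitialDataSet

variable {M : Type*} [TopologicalSpace M] [ChartedSpace (Coord 3) M] [IsManifold (𝓡 3) ∞ M]

/-- The coordinate vector field `∂_i` of the chart `φ`, at the point with coordinates `y`. -/
noncomputable def coordVec (φ : OpenPartialHomeomorph M (Coord 3)) (i : Fin 3) (y : Coord 3) :
    TangentSpace (𝓡 3) (φ.symm y) :=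
  mfderiv (𝓡 3) (𝓡 3) φ.symm y (EuclideanSpace.single i (1 : ℝ) : Coord 3)

/-- The components `X^i` in the chart `φ` of a tangent vector `X` at `x`. -/
noncomputable def components (φ : OpenPartialHomeomorph M (Coord 3)) (x : M)
    (X : TangentSpace (𝓡 3) x) : Coord 3 :=
  mfderiv (𝓡 3) (𝓡 3) φ x X

/-- Coordinate expressions, in the chart `φ`, of an initial data set together with a vector field
and two functions. They are meaningful on `φ.target`. -/
noncomputable def inChart (S : InitialDataSet M) (E : ∀ x : M, TangentSpace (𝓡 3) x)
    (u v : M → ℝ) (φ : OpenPartialHomeomorph M (Coord 3)) : CoordData where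
  g y := fun i j => S.g.inner (φ.symm y) (coordVec φ i y) (coordVec φ j y)
  k y := fun i j => S.k (φ.symm y) (coordVec φ i y) (coordVec φ j y)
  E y := fun i => components φ (φ.symm y) (E (φ.symm y)) i
  u := u ∘ φ.symm
  v := v ∘ φ.symm

/-- `F` is a local parametrization, of class `C³`, of the level set of `f` through `p`, with
`F 0 = p`. -/
structure IsLevelSetParam (f : M → ℝ) (p : M) (F : Coord 2 → M) : Prop where
  map_zero : F 0 = p
  contMDiffAt : ContMDiffAt (𝓡 2) (𝓡 3) 3 F 0
  level : ∀ᶠ s in 𝓝 (0 : Coord 2), f (F s) = f p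
  immersion : Function.Injective (mfderiv (𝓡 2) (𝓡 3) F 0)

/-- The metric induced by `g` through a parametrized surface `F`:
`h_ab(s) = g(∂_a F(s), ∂_b F(s))`. -/
noncomputable def inducedMetric (S : InitialDataSet M) (F : Coord 2 → M) (s : Coord 2) :
    Matrix (Fin 2) (Fin 2) ℝ :=
  fun a b => S.g.inner (F s)
    (mfderiv (𝓡 2) (𝓡 3) F s (EuclideanSpace.single a (1 : ℝ) : Coord 2))
    (mfderiv (𝓡 2) (𝓡 3) F s (EuclideanSpace.single b (1 : ℝ) : Coord 2))

/-- `K p` is, for every point `p`, the Gaussian curvature at `p` of the level set of `f` through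
`p` with its induced metric: the level set can be parametrized near `p`, and every
parametrization gives the curvature `K p`. -/
def IsLevelSetGaussCurv (S : InitialDataSet M) (f : M → ℝ) (K : M → ℝ) : Prop :=
  ∀ p : M, (∃ F : Coord 2 → M, IsLevelSetParam f p F) ∧
    ∀ F : Coord 2 → M, IsLevelSetParam f p F →
      CoordGeom.gaussCurv (S.inducedMetric F) 0 = K p

end InitialDataSet

/-! ### The quantities of the charged system -/

namespace CoordData

open CoordGeom

variable (D : CoordData)

/-- `∇u` -/
noncomputable def gradU (y : Coord 3) : Fin 3 → ℝ := grad D.g D.u y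

/-- `∇v` -/
noncomputable def gradV (y : Coord 3) : Fin 3 → ℝ := grad D.g D.v y

/-- `|∇u|` -/
noncomputable def lenU (y : Coord 3) : ℝ := len D.g y (D.gradU y)

/-- `|∇v|` -/
noncomputable def lenV (y : Coord 3) : ℝ := len D.g y (D.gradV y)

/-- The unit normal `ν_u = ∇u / |∇u|`. -/
noncomputable def nuU (y : Coord 3) : Fin 3 → ℝ := (D.lenU y)⁻¹ • D.gradU y

/-- The unit normal `ν_v = ∇v / |∇v|`. -/
noncomputable def nuV (y : Coord 3) : Fin 3 → ℝ := (D.lenV y)⁻¹ • D.gradV y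

open Classical in
/-- `η = (ν_u + ν_v) / |ν_u + ν_v|` if `ν_u ≠ -ν_v`, and `η = 0` otherwise. -/
noncomputable def eta (y : Coord 3) : Fin 3 → ℝ :=
  if D.nuU y ≠ -D.nuV y then
    (len D.g y (D.nuU y + D.nuV y))⁻¹ • (D.nuU y + D.nuV y)
  else 0

/-- `ξ = √(|∇u| |∇v|)` -/
noncomputable def xi (y : Coord 3) : ℝ := √(D.lenU y * D.lenV y)

/-- `E_η = ⟨E, η⟩` -/
noncomputable def Eeta (y : Coord 3) : ℝ := ip D.g y (D.E y) (D.eta y)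

/-- `tr_g(k)` -/
noncomputable def trk (y : Coord 3) : ℝ := trace D.g y (D.k y)

/-- The energy density `μ = ½ (R + (tr_g k)² - |k|²)`. -/
noncomputable def mu (y : Coord 3) : ℝ :=
  (1 / 2) * (scalarCurv D.g y + D.trk y ^ 2 - normSq D.g y (D.k y))

/-- The momentum density `J = div (k - tr_g(k) g)`, as a 1-form. -/
noncomputable def J (y : Coord 3) : Fin 3 → ℝ :=
  divTensor D.g (fun z => D.k z - D.trk z • D.g z) y

/-- `⟨J, X⟩` for a vector `X` -/
noncomputable def pairJ (y : Coord 3) (X : Fin 3 → ℝ) : ℝ := ∑ i, D.J y i * X i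

/-- `|E|²` -/
noncomputable def normSqE (y : Coord 3) : ℝ := ip D.g y (D.E y) (D.E y)

/-- The vector `k(X, ·)`, with index raised. -/
noncomputable def kVec (y : Coord 3) (X : Fin 3 → ℝ) : Fin 3 → ℝ :=
  raise D.g y (fun j => ∑ i, D.k y i j * X i)

/-- The tensor `ξ η_i E_j + ξ η_j E_i - ξ E_η g_ij`. -/
noncomputable def chargeTensor (y : Coord 3) : Matrix (Fin 3) (Fin 3) ℝ :=
  fun i j =>
    D.xi y * lower D.g y (D.eta y) i * lower D.g y (D.E y) j
      + D.xi y * lower D.g y (D.eta y) j * lower D.g y (D.E y) i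
      - D.xi y * D.Eeta y * D.g y i j

/-- `(𝓔²₊)_ij u = ∇²_ij u + ξ η_i E_j + ξ η_j E_i - ξ E_η g_ij + k_ij |∇u|` -/
noncomputable def hessPlus (y : Coord 3) : Matrix (Fin 3) (Fin 3) ℝ :=
  hess D.g D.u y + D.chargeTensor y + D.lenU y • D.k y

/-- `(𝓔²₋)_ij v = ∇²_ij v + ξ η_i E_j + ξ η_j E_i - ξ E_η g_ij - k_ij |∇v|` -/
noncomputable def hessMinus (y : Coord 3) : Matrix (Fin 3) (Fin 3) ℝ :=
  hess D.g D.v y + D.chargeTensor y - D.lenV y • D.k y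

/-- The vector field
`Z = ∇|∇u| - Δu ∇u/|∇u| + ∇|∇v| - Δv ∇v/|∇v| + 2 ξ⁻¹ (|∇u| ∇_η v + |∇v| ∇_η u) E`
`  - tr_g(k) ∇u + tr_g(k) ∇v + k(∇u, ·) - k(∇v, ·)`. -/
noncomputable def Z (y : Coord 3) : Fin 3 → ℝ :=
  grad D.g D.lenU y - laplacian D.g D.u y • D.nuU y
    + grad D.g D.lenV y - laplacian D.g D.v y • D.nuV y
    + (2 * (D.xi y)⁻¹ * (D.lenU y * ip D.g y (D.gradV y) (D.eta y)
        + D.lenV y * ip D.g y (D.gradU y) (D.eta y))) • D.E y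
    - D.trk y • D.gradU y + D.trk y • D.gradV y
    + D.kVec y (D.gradU y) - D.kVec y (D.gradV y)

/-- The hypotheses at a point: `div E = 0`, both gradients are nonzero, and
`Δu = ξ E_η - tr_g(k) |∇u|`, `Δv = ξ E_η + tr_g(k) |∇v|`. -/
structure SolvesAt (y : Coord 3) : Prop where
  div_E : div D.g D.E y = 0
  lenU_ne_zero : D.lenU y ≠ 0
  lenV_ne_zero : D.lenV y ≠ 0
  eq_u : laplacian D.g D.u y = D.xi y * D.Eeta y - D.trk y * D.lenU y
  eq_v : laplacian D.g D.v y = D.xi y * D.Eeta y + D.trk y * D.lenV y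

end CoordData

/-! Two computations carry the theorem.

For a function f with unit normal ν = ∇f/|∇f|, the field ∇|∇f| - Δf ν equals (∇²f - Δf g)(ν, ·), and
the Ricci identity gives div(∇²f - Δf g) = Ric(∇f, ·) (`divTensor_hess_sub`). Its divergence is
therefore Ric(∇f, ν) + ⟨∇²f - Δf g, ∇ν⟩. The Gauss equation trades Ric(ν, ν) for R and the curvature
K of the level set, leaving (|∇²f|² + |∇f|²(R - 2K) - (Δf)²)/(2|∇f|) (`div_grad_len_sub`).
Similarly, (k - tr(k) g)(∇f, ·) has divergence ⟨J, ∇f⟩ + ⟨k, ∇²f⟩ - tr(k) Δf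
(`div_contract_momentum`).

The charge enters Z as 2φE with φ = ξ|ν_u + ν_v|, and φ² = 2(|∇u||∇v| + ⟨∇u, ∇v⟩). Hence φ is
differentiable wherever ν_u ≠ -ν_v, with dφ = ξ⁻¹(|∇v| ∇²u(η, ·) + |∇u| ∇²v(η, ·)). Since div E = 0,
div(2φE) consists of exactly the cross terms ∇²u(E, η) and ∇²v(E, η) of the two squared charged
Hessians (`div_charge`). The rest is algebra: the equations for Δu and Δv complete the squares, the
k(E, η) terms of u and v cancel, and ξ² = |∇u||∇v| lets the 2ξ²|E|² in the square of one function
absorb the -2|E|² in the bracket of the other.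

Where ν_u = -ν_v, η and the charge tensor vanish, so no |E|² has to be compensated. There φ attains
its minimum 0 and the components of φE have zero derivative (`pd_eq_zero_of_nonneg_mul`), so div Z
is that of the uncharged part.

The Gauss equation `gaussCurv_eq_levelSetCurv` is proved for every C³ parametrization:
differentiating f ∘ F = const twice gives the second fundamental form, and a three-dimensional
identity (`sectional_eq_contractions`) turns sectional into scalar and Ricci curvature. The inverse
function theorem supplies a parametrization. -/

namespace CoordGeom

variable {n : ℕ}

/-! ### Partial derivatives -/

lemma pd_congr {f h : Coord n → ℝ} {x : Coord n} (i : Fin n) (H : f =ᶠ[𝓝 x] h) :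
    pd i f x = pd i h x := by
  simp only [pd, H.fderiv_eq]

lemma pd_add (i : Fin n) {f h : Coord n → ℝ} {x : Coord n} (hf : DifferentiableAt ℝ f x)
    (hh : DifferentiableAt ℝ h x) : pd i (fun y => f y + h y) x = pd i f x + pd i h x := by
  simp only [pd, fderiv_fun_add hf hh, _root_.add_apply]

lemma pd_sub (i : Fin n) {f h : Coord n → ℝ} {x : Coord n} (hf : DifferentiableAt ℝ f x)
    (hh : DifferentiableAt ℝ h x) : pd i (fun y => f y - h y) x = pd i f x - pd i h x := by
  simp only [pd, fderiv_fun_sub hf hh, _root_.sub_apply]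

lemma pd_mul (i : Fin n) {f h : Coord n → ℝ} {x : Coord n} (hf : DifferentiableAt ℝ f x)
    (hh : DifferentiableAt ℝ h x) :
    pd i (fun y => f y * h y) x = pd i f x * h x + f x * pd i h x := by
  simp only [pd, fderiv_fun_mul hf hh, _root_.add_apply,
    _root_.smul_apply, smul_eq_mul]
  ring

lemma pd_const (i : Fin n) (c : ℝ) (x : Coord n) : pd i (fun _ => c) x = 0 := by
  simp [pd]

lemma pd_const_mul (i : Fin n) (c : ℝ) {f : Coord n → ℝ} {x : Coord n}
    (hf : DifferentiableAt ℝ f x) : pd i (fun y => c * f y) x = c * pd i f x := by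
  rw [pd_mul i (differentiableAt_const c) hf, pd_const]; ring

lemma pd_sum (i : Fin n) {ι : Type*} (s : Finset ι) {f : ι → Coord n → ℝ} {x : Coord n}
    (hf : ∀ a ∈ s, DifferentiableAt ℝ (f a) x) :
    pd i (fun y => ∑ a ∈ s, f a y) x = ∑ a ∈ s, pd i (f a) x := by
  simp only [pd, fderiv_fun_sum hf, _root_.sum_apply]

lemma pd_sq (i : Fin n) {f : Coord n → ℝ} {x : Coord n} (hf : DifferentiableAt ℝ f x) :
    pd i (fun y => f y ^ 2) x = 2 * f x * pd i f x := by
  simp only [pow_two]; rw [pd_mul i hf hf]; ring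

lemma pd_inv (i : Fin n) {f : Coord n → ℝ} {x : Coord n} (hf : DifferentiableAt ℝ f x)
    (h0 : f x ≠ 0) : pd i (fun y => (f y)⁻¹) x = -(f x ^ 2)⁻¹ * pd i f x := by
  have h := (hasFDerivAt_inv h0).comp x hf.hasFDerivAt
  have h' : fderiv ℝ (fun y => (f y)⁻¹) x = _ := h.fderiv
  simp only [pd, h']
  simp [mul_comm]

lemma contDiffAt_pd {m k : ℕ∞ω} {f : Coord n → ℝ} {x : Coord n} (i : Fin n)
    (hf : ContDiffAt ℝ k f x) (hk : m + 1 ≤ k) : ContDiffAt ℝ m (pd i f) x :=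
  (hf.fderiv_right hk).clm_apply contDiffAt_const

lemma differentiableAt_pd {f : Coord n → ℝ} {x : Coord n} (i : Fin n)
    (hf : ContDiffAt ℝ 2 f x) : DifferentiableAt ℝ (pd i f) x :=
  (contDiffAt_pd (m := 1) i hf (by norm_num)).differentiableAt (by norm_num)

lemma pd_pd {f : Coord n → ℝ} {x : Coord n} (hf : ContDiffAt ℝ 2 f x) (i j : Fin n) :
    pd i (pd j f) x = fderiv ℝ (fderiv ℝ f) x (EuclideanSpace.single i 1)
      (EuclideanSpace.single j 1) := by
  have hd : DifferentiableAt ℝ (fderiv ℝ f) x :=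
    (hf.fderiv_right (m := 1) (by norm_num)).differentiableAt (by norm_num)
  have h : fderiv ℝ (fun y => fderiv ℝ f y (EuclideanSpace.single j 1)) x = _ :=
    (hd.hasFDerivAt.clm_apply (hasFDerivAt_const _ _)).fderiv
  rw [pd]
  change fderiv ℝ (fun y => fderiv ℝ f y (EuclideanSpace.single j 1)) x _ = _
  rw [h]
  simp

lemma pd_comm {f : Coord n → ℝ} {x : Coord n} (hf : ContDiffAt ℝ 2 f x) (i j : Fin n) :
    pd i (pd j f) x = pd j (pd i f) x := by
  rw [pd_pd hf, pd_pd hf]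
  exact (hf.isSymmSndFDerivAt (by simp)) _ _

/-- No differentiability is needed: `fderiv` is linear in `v`, whatever its value. -/
lemma fderiv_eq_sum_pd (f : Coord n → ℝ) (x v : Coord n) :
    fderiv ℝ f x v = ∑ i, v i * pd i f x := by
  have : v = ∑ i, v i • EuclideanSpace.single i (1 : ℝ) := by
    ext j
    simp [Finset.sum_apply, Pi.single_apply]
  conv_lhs => rw [this]
  simp [map_sum, pd]

/-! ### Metrics in coordinates -/

/-- `G` is near `x` a Riemannian metric, with coefficients of class `C²` at `x`. -/
structure MetricAt (G : Coord n → Matrix (Fin n) (Fin n) ℝ) (x : Coord n) : Prop where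
  contDiffAt : ∀ i j, ContDiffAt ℝ 2 (fun y => G y i j) x
  posDef : ∀ᶠ y in 𝓝 x, (G y).PosDef

variable {G : Coord n → Matrix (Fin n) (Fin n) ℝ} {x : Coord n}

lemma contDiffAt_matrix_det {m : ℕ∞ω} {A : Coord n → Matrix (Fin n) (Fin n) ℝ}
    (hA : ∀ i j, ContDiffAt ℝ m (fun y => A y i j) x) :
    ContDiffAt ℝ m (fun y => (A y).det) x := by
  simp only [Matrix.det_apply]
  refine ContDiffAt.sum fun σ _ => ContDiffAt.const_smul _ (contDiffAt_prod fun i _ => hA _ _)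

lemma contDiffAt_matrix_inv {m : ℕ∞ω} {A : Coord n → Matrix (Fin n) (Fin n) ℝ}
    (hA : ∀ i j, ContDiffAt ℝ m (fun y => A y i j) x) (h0 : (A x).det ≠ 0) (i j : Fin n) :
    ContDiffAt ℝ m (fun y => (A y)⁻¹ i j) x := by
  simp only [Matrix.inv_def, Matrix.smul_apply, Ring.inverse_eq_inv', smul_eq_mul,
    Matrix.adjugate_apply]
  refine ((contDiffAt_matrix_det hA).inv h0).mul (contDiffAt_matrix_det fun a b => ?_)
  by_cases h : a = j
  · subst h
    simpa using contDiffAt_const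
  · simpa [Matrix.updateRow_ne h] using hA a b

namespace MetricAt

lemma eventually (h : MetricAt G x) : ∀ᶠ y in 𝓝 x, MetricAt G y := by
  have h1 : ∀ᶠ y in 𝓝 x, ∀ i j, ContDiffAt ℝ 2 (fun y => G y i j) y := by
    simp only [Filter.eventually_all]
    exact fun i j => (h.contDiffAt i j).eventually (by simp)
  filter_upwards [h1, h.posDef.eventually_nhds] with y h2 h3 using ⟨h2, h3⟩

lemma pos (h : MetricAt G x) : (G x).PosDef := h.posDef.self_of_nhds

lemma det_ne_zero (h : MetricAt G x) : (G x).det ≠ 0 := h.pos.det_pos.ne'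

lemma isUnit_det (h : MetricAt G x) : IsUnit (G x).det := h.det_ne_zero.isUnit

lemma symm (h : MetricAt G x) (i j : Fin n) : G x i j = G x j i := by
  have := h.pos.1.apply j i
  simpa using this

lemma inv_symm (h : MetricAt G x) (i j : Fin n) : (G x)⁻¹ i j = (G x)⁻¹ j i := by
  have := h.pos.1.inv.apply j i
  simpa using this

lemma symm_eventuallyEq (h : MetricAt G x) (i j : Fin n) :
    (fun y => G y i j) =ᶠ[𝓝 x] fun y => G y j i := by
  filter_upwards [h.eventually] with y hy using hy.symm i j

lemma pd_symm (h : MetricAt G x) (l i j : Fin n) :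
    pd l (fun y => G y i j) x = pd l (fun y => G y j i) x :=
  pd_congr l (h.symm_eventuallyEq i j)

lemma sum_mul_inv (h : MetricAt G x) (i j : Fin n) :
    ∑ m, G x i m * (G x)⁻¹ m j = if i = j then 1 else 0 := by
  rw [← Matrix.mul_apply, Matrix.mul_nonsing_inv _ h.isUnit_det, Matrix.one_apply]

lemma sum_inv_mul (h : MetricAt G x) (i j : Fin n) :
    ∑ m, (G x)⁻¹ i m * G x m j = if i = j then 1 else 0 := by
  rw [← Matrix.mul_apply, Matrix.nonsing_inv_mul _ h.isUnit_det, Matrix.one_apply]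

lemma contDiffAt_inv (h : MetricAt G x) (i j : Fin n) :
    ContDiffAt ℝ 2 (fun y => (G y)⁻¹ i j) x :=
  contDiffAt_matrix_inv h.contDiffAt h.det_ne_zero i j

lemma differentiableAt (h : MetricAt G x) (i j : Fin n) :
    DifferentiableAt ℝ (fun y => G y i j) x :=
  (h.contDiffAt i j).differentiableAt (by norm_num)

lemma differentiableAt_inv (h : MetricAt G x) (i j : Fin n) :
    DifferentiableAt ℝ (fun y => (G y)⁻¹ i j) x :=
  (h.contDiffAt_inv i j).differentiableAt (by norm_num)

lemma contDiffAt_christoffel (h : MetricAt G x) (l i j : Fin n) :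
    ContDiffAt ℝ 1 (christoffel G l i j) x := by
  unfold christoffel
  refine contDiffAt_const.mul (ContDiffAt.sum fun m _ => ?_)
  have hp := fun a b c => contDiffAt_pd (m := 1) a (h.contDiffAt b c) (by norm_num)
  exact ((h.contDiffAt_inv l m).of_le (by norm_num)).mul
    (((hp i m j).add (hp j m i)).sub (hp m i j))

lemma differentiableAt_christoffel (h : MetricAt G x) (l i j : Fin n) :
    DifferentiableAt ℝ (christoffel G l i j) x :=
  (h.contDiffAt_christoffel l i j).differentiableAt (by norm_num)

lemma christoffel_symm (h : MetricAt G x) (l i j : Fin n) :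
    christoffel G l i j x = christoffel G l j i x := by
  unfold christoffel
  congr 1
  refine Finset.sum_congr rfl fun m _ => ?_
  rw [h.pd_symm m i j]; ring

end MetricAt

/-- Christoffel symbols of the first kind `Γ_{l,ij} = ½ (∂_i g_lj + ∂_j g_li - ∂_l g_ij)`. -/
noncomputable def christoffelLow (G : Coord n → Matrix (Fin n) (Fin n) ℝ)
    (l i j : Fin n) (x : Coord n) : ℝ :=
  (1 / 2) * (pd i (fun y => G y l j) x + pd j (fun y => G y l i) x - pd l (fun y => G y i j) x)

lemma christoffel_eq_sum (l i j : Fin n) (x : Coord n) :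
    christoffel G l i j x = ∑ m, (G x)⁻¹ l m * christoffelLow G m i j x := by
  simp only [christoffel, christoffelLow, Finset.mul_sum]
  exact Finset.sum_congr rfl fun m _ => by ring

namespace MetricAt

lemma sum_mul_christoffel (h : MetricAt G x) (l i j : Fin n) :
    ∑ m, G x l m * christoffel G m i j x = christoffelLow G l i j x := by
  simp only [christoffel_eq_sum, Finset.mul_sum, ← mul_assoc]
  rw [Finset.sum_comm]
  simp [← Finset.sum_mul, h.sum_mul_inv]

lemma christoffelLow_symm (h : MetricAt G x) (l i j : Fin n) :
    christoffelLow G l i j x = christoffelLow G l j i x := by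
  simp only [christoffelLow, h.pd_symm l i j]; ring

lemma pd_metric_low (h : MetricAt G x) (i j k : Fin n) :
    pd i (fun y => G y j k) x = christoffelLow G j i k x + christoffelLow G k i j x := by
  simp only [christoffelLow, h.pd_symm _ k j, h.pd_symm _ k i, h.pd_symm _ j i]; ring

/-- This is ∇g = 0 written out. Used as a rewrite rule, it removes the derivatives of the metric, so
that later identities close by `ring`. -/
lemma pd_metric (h : MetricAt G x) (i j k : Fin n) :
    pd i (fun y => G y j k) x =
      ∑ m, (G x j m * christoffel G m i k x + G x k m * christoffel G m i j x) := by
  rw [h.pd_metric_low, Finset.sum_add_distrib, h.sum_mul_christoffel, h.sum_mul_christoffel]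

/-- The inverse metric is parallel. -/
lemma pd_inv_metric (h : MetricAt G x) (i a b : Fin n) :
    pd i (fun y => (G y)⁻¹ a b) x =
      -∑ c, (christoffel G a i c x * (G x)⁻¹ c b + christoffel G b i c x * (G x)⁻¹ c a) := by
  let dN : Matrix (Fin n) (Fin n) ℝ := Matrix.of fun a b => pd i (fun y => (G y)⁻¹ a b) x
  let Γ : Matrix (Fin n) (Fin n) ℝ := Matrix.of fun a c => christoffel G a i c x
  let dG : Matrix (Fin n) (Fin n) ℝ := Matrix.of fun a b => pd i (fun y => G y a b) x
  have hdG : dG = G x * Γ + (G x * Γ).transpose := by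
    ext a b
    simp only [dG, Matrix.of_apply, h.pd_metric, Finset.sum_add_distrib]
    simp [Matrix.mul_apply, Γ, mul_comm]
  -- Differentiate `G⁻¹ G = 1`, which holds on a neighbourhood of `x`.
  have h1 : dN * G x + (G x)⁻¹ * dG = 0 := by
    ext a b
    have e : (fun y => ∑ m, (G y)⁻¹ a m * G y m b) =ᶠ[𝓝 x] fun _ => if a = b then 1 else 0 := by
      filter_upwards [h.eventually] with y hy using hy.sum_inv_mul a b
    have := pd_congr i e
    rw [pd_const, pd_sum i _ fun m _ => (h.differentiableAt_inv a m).fun_mul (h.differentiableAt m b)]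
      at this
    simp only [fun m => pd_mul i (h.differentiableAt_inv a m) (h.differentiableAt m b),
      Finset.sum_add_distrib] at this
    simpa [Matrix.mul_apply, dN, dG] using this
  have hGT : (G x).transpose = G x := by ext a b; exact h.symm b a
  have h2 : dN = -(Γ * (G x)⁻¹ + (G x)⁻¹ * Γ.transpose) := by
    have e1 := congrArg (· * (G x)⁻¹) h1
    simp only [add_mul, zero_mul, Matrix.mul_assoc, Matrix.mul_nonsing_inv _ h.isUnit_det,
      Matrix.mul_one] at e1
    rw [hdG, Matrix.transpose_mul, hGT] at e1
    rw [eq_neg_iff_add_eq_zero, ← e1]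
    simp only [add_mul, mul_add, Matrix.mul_assoc, Matrix.mul_nonsing_inv _ h.isUnit_det,
      Matrix.mul_one]
    simp only [← Matrix.mul_assoc, Matrix.nonsing_inv_mul _ h.isUnit_det, Matrix.one_mul]
  have h3 := congrFun (congrFun h2 a) b
  change pd i (fun y => (G y)⁻¹ a b) x = _ at h3
  rw [h3]
  simp only [Matrix.neg_apply, Matrix.add_apply, Matrix.mul_apply, Matrix.transpose_apply,
    ← Finset.sum_add_distrib, Matrix.of_apply, Γ]
  congr 1
  exact Finset.sum_congr rfl fun c _ => by rw [h.inv_symm a c]; ring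

end MetricAt

end CoordGeom

/-! ### Covariant derivatives and divergences of vector fields and 2-tensors. -/

namespace CoordGeom

variable {n : ℕ}

/-- The covariant derivative `∇_i X^m` of a vector field. -/
noncomputable def covDeriv (G : Coord n → Matrix (Fin n) (Fin n) ℝ) (X : Coord n → Fin n → ℝ)
    (i m : Fin n) (x : Coord n) : ℝ :=
  pd i (fun y => X y m) x + ∑ l, christoffel G m i l x * X x l

/-- The vector `N^{ij} T_{jm} V^m`. -/
noncomputable def contract (G : Coord n → Matrix (Fin n) (Fin n) ℝ) (x : Coord n)
    (T : Matrix (Fin n) (Fin n) ℝ) (V : Fin n → ℝ) : Fin n → ℝ :=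
  fun i => ∑ j, ∑ m, (G x)⁻¹ i j * T j m * V m

lemma differentiableAt_contract {G : Coord n → Matrix (Fin n) (Fin n) ℝ} {x : Coord n}
    (h : MetricAt G x)
    {T : Coord n → Matrix (Fin n) (Fin n) ℝ} {V : Coord n → Fin n → ℝ}
    (hT : ∀ i j, DifferentiableAt ℝ (fun y => T y i j) x)
    (hV : ∀ i, DifferentiableAt ℝ (fun y => V y i) x) (i : Fin n) :
    DifferentiableAt ℝ (fun y => contract G y (T y) (V y) i) x := by
  unfold contract
  exact DifferentiableAt.fun_sum fun j _ => DifferentiableAt.fun_sum fun m _ =>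
    ((h.differentiableAt_inv i j).fun_mul (hT j m)).fun_mul (hV m)

/-- The product rule for the divergence of the contraction of a 2-tensor with a vector field. -/
lemma div_contract {G : Coord 3 → Matrix (Fin 3) (Fin 3) ℝ} {x : Coord 3} (h : MetricAt G x)
    {T : Coord 3 → Matrix (Fin 3) (Fin 3) ℝ} {V : Coord 3 → Fin 3 → ℝ}
    (hT : ∀ i j, DifferentiableAt ℝ (fun y => T y i j) x)
    (hV : ∀ i, DifferentiableAt ℝ (fun y => V y i) x) :
    div G (fun y => contract G y (T y) (V y)) x =
      ∑ m, divTensor G T x m * V x m +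
        ∑ i, ∑ j, ∑ m, (G x)⁻¹ i j * T x j m * covDeriv G V i m x := by
  have e : ∀ i, pd i (fun y => contract G y (T y) (V y) i) x =
      ∑ j, ∑ m, ((pd i (fun y => (G y)⁻¹ i j) x * T x j m +
        (G x)⁻¹ i j * pd i (fun y => T y j m) x) * V x m +
        (G x)⁻¹ i j * T x j m * pd i (fun y => V y m) x) := by
    intro i
    unfold contract
    rw [pd_sum i _ fun j _ => DifferentiableAt.fun_sum fun m _ =>
      ((h.differentiableAt_inv i j).fun_mul (hT j m)).fun_mul (hV m)]
    refine Finset.sum_congr rfl fun j _ => ?_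
    rw [pd_sum i _ fun m _ => ((h.differentiableAt_inv i j).fun_mul (hT j m)).fun_mul (hV m)]
    refine Finset.sum_congr rfl fun m _ => ?_
    rw [pd_mul i ((h.differentiableAt_inv i j).fun_mul (hT j m)) (hV m),
      pd_mul i (h.differentiableAt_inv i j) (hT j m)]
  simp only [div, e, h.pd_inv_metric]
  simp only [divTensor, covDeriv, contract, Fin.sum_univ_three,
    h.inv_symm 1 0, h.inv_symm 2 0, h.inv_symm 2 1]
  ring

lemma divTensor_sub {G : Coord n → Matrix (Fin n) (Fin n) ℝ} {x : Coord n}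
    {S T : Coord n → Matrix (Fin n) (Fin n) ℝ}
    (hS : ∀ i j, DifferentiableAt ℝ (fun y => S y i j) x)
    (hT : ∀ i j, DifferentiableAt ℝ (fun y => T y i j) x) (m : Fin n) :
    divTensor G (fun y => S y - T y) x m = divTensor G S x m - divTensor G T x m := by
  simp only [divTensor, Matrix.sub_apply, ← Finset.sum_sub_distrib]
  refine Finset.sum_congr rfl fun i _ => Finset.sum_congr rfl fun l _ => ?_
  rw [pd_sub i (hS l m) (hT l m), ← mul_sub]
  congr 1
  rw [sub_sub_sub_comm, ← Finset.sum_sub_distrib]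
  congr 1
  exact Finset.sum_congr rfl fun p _ => by ring

/-- The metric is parallel, so only the differential of the factor survives. -/
lemma divTensor_smul_metric {G : Coord n → Matrix (Fin n) (Fin n) ℝ} {x : Coord n}
    (h : MetricAt G x) {φ : Coord n → ℝ} (hφ : DifferentiableAt ℝ φ x) (m : Fin n) :
    divTensor G (fun y => φ y • G y) x m = pd m φ x := by
  have e : ∀ i l, pd i (fun y => φ y * G y l m) x
      - ∑ p, (christoffel G p i l x * (φ x * G x p m) + christoffel G p i m x * (φ x * G x l p))
      = pd i φ x * G x l m := by
    intro i l
    rw [pd_mul i hφ (h.differentiableAt l m), h.pd_metric, Finset.mul_sum, add_sub_assoc,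
      ← Finset.sum_sub_distrib, Finset.sum_eq_zero, add_zero]
    intro p _
    rw [h.symm m p]; ring
  simp only [divTensor, Matrix.smul_apply, smul_eq_mul, e]
  calc _ = ∑ i, pd i φ x * ∑ l, (G x)⁻¹ i l * G x l m := by
        refine Finset.sum_congr rfl fun i _ => ?_
        rw [Finset.mul_sum]
        exact Finset.sum_congr rfl fun l _ => by ring
    _ = _ := by simp [h.sum_inv_mul]

lemma differentiableAt_trace {G : Coord n → Matrix (Fin n) (Fin n) ℝ} {x : Coord n}
    (h : MetricAt G x) {T : Coord n → Matrix (Fin n) (Fin n) ℝ}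
    (hT : ∀ i j, DifferentiableAt ℝ (fun y => T y i j) x) :
    DifferentiableAt ℝ (fun y => trace G y (T y)) x :=
  DifferentiableAt.fun_sum fun i _ => DifferentiableAt.fun_sum fun j _ =>
    (h.differentiableAt_inv i j).fun_mul (hT i j)

/-- The trace commutes with covariant differentiation. -/
lemma pd_trace {G : Coord 3 → Matrix (Fin 3) (Fin 3) ℝ} {x : Coord 3}
    (h : MetricAt G x) {T : Coord 3 → Matrix (Fin 3) (Fin 3) ℝ}
    (hT : ∀ i j, DifferentiableAt ℝ (fun y => T y i j) x) (m : Fin 3) :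
    pd m (fun y => trace G y (T y)) x = ∑ i, ∑ j, (G x)⁻¹ i j *
      (pd m (fun y => T y i j) x
        - ∑ p, (christoffel G p m i x * T x p j + christoffel G p m j x * T x i p)) := by
  have e : pd m (fun y => trace G y (T y)) x =
      ∑ i, ∑ j, (pd m (fun y => (G y)⁻¹ i j) x * T x i j +
        (G x)⁻¹ i j * pd m (fun y => T y i j) x) := by
    unfold trace
    rw [pd_sum m _ fun i _ => DifferentiableAt.fun_sum fun j _ =>
      (h.differentiableAt_inv i j).fun_mul (hT i j)]
    refine Finset.sum_congr rfl fun i _ => ?_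
    rw [pd_sum m _ fun j _ => (h.differentiableAt_inv i j).fun_mul (hT i j)]
    exact Finset.sum_congr rfl fun j _ => pd_mul m (h.differentiableAt_inv i j) (hT i j)
  simp only [e, h.pd_inv_metric]
  simp only [Fin.sum_univ_three, h.inv_symm 1 0, h.inv_symm 2 0, h.inv_symm 2 1]
  ring

/-! ### The Hessian -/

section Hessian

variable {G : Coord n → Matrix (Fin n) (Fin n) ℝ} {x : Coord n} {f : Coord n → ℝ}

lemma hess_symm (h : MetricAt G x) (hf : ContDiffAt ℝ 2 f x) (i j : Fin n) :
    hess G f x i j = hess G f x j i := by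
  simp only [hess, pd_comm hf i j, h.christoffel_symm _ i j]

lemma differentiableAt_hess (h : MetricAt G x) (hf : ContDiffAt ℝ 3 f x) (i j : Fin n) :
    DifferentiableAt ℝ (fun y => hess G f y i j) x := by
  have h1 : ∀ i, ContDiffAt ℝ 2 (pd i f) x := fun i => contDiffAt_pd i hf (by norm_num)
  exact (differentiableAt_pd i (h1 j)).fun_sub (DifferentiableAt.fun_sum fun m _ =>
    (h.differentiableAt_christoffel m i j).fun_mul ((h1 m).differentiableAt (by norm_num)))

lemma differentiableAt_laplacian (h : MetricAt G x) (hf : ContDiffAt ℝ 3 f x) :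
    DifferentiableAt ℝ (laplacian G f) x :=
  differentiableAt_trace h fun i j => differentiableAt_hess h hf i j

lemma differentiableAt_grad (h : MetricAt G x) (hf : ContDiffAt ℝ 2 f x) (i : Fin n) :
    DifferentiableAt ℝ (fun y => grad G f y i) x := by
  unfold grad raise
  exact DifferentiableAt.fun_sum fun j _ => (h.differentiableAt_inv i j).fun_mul
    (differentiableAt_pd j hf)

lemma pd_hess (h : MetricAt G x) (hf : ContDiffAt ℝ 3 f x) (i j m : Fin n) :
    pd i (fun y => hess G f y j m) x = pd i (pd j (pd m f)) x -
      ∑ l, (pd i (christoffel G l j m) x * pd l f x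
        + christoffel G l j m x * pd i (pd l f) x) := by
  have h1 : ∀ i, ContDiffAt ℝ 2 (pd i f) x := fun i => contDiffAt_pd i hf (by norm_num)
  have h2 : ∀ i, DifferentiableAt ℝ (pd i f) x := fun i => (h1 i).differentiableAt (by norm_num)
  unfold hess
  rw [pd_sub i (differentiableAt_pd j (h1 m)) (DifferentiableAt.fun_sum fun l _ =>
    (h.differentiableAt_christoffel l j m).fun_mul (h2 l)),
    pd_sum i _ fun l _ => (h.differentiableAt_christoffel l j m).fun_mul (h2 l)]
  congr 1
  exact Finset.sum_congr rfl fun l _ => pd_mul i (h.differentiableAt_christoffel l j m) (h2 l)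

end Hessian

section ThreeDimensional

variable {G : Coord 3 → Matrix (Fin 3) (Fin 3) ℝ} {x : Coord 3} {f : Coord 3 → ℝ}

lemma covDeriv_grad (h : MetricAt G x) (hf : ContDiffAt ℝ 2 f x) (i m : Fin 3) :
    covDeriv G (grad G f) i m x = ∑ j, (G x)⁻¹ m j * hess G f x i j := by
  have e : pd i (fun y => grad G f y m) x =
      ∑ j, (pd i (fun y => (G y)⁻¹ m j) x * pd j f x + (G x)⁻¹ m j * pd i (pd j f) x) := by
    unfold grad raise
    rw [pd_sum i _ fun j _ => (h.differentiableAt_inv m j).fun_mul (differentiableAt_pd j hf)]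
    exact Finset.sum_congr rfl fun j _ =>
      pd_mul i (h.differentiableAt_inv m j) (differentiableAt_pd j hf)
  simp only [covDeriv, e, h.pd_inv_metric]
  simp only [grad, raise, hess, Fin.sum_univ_three, h.inv_symm 0 m, h.inv_symm 1 m, h.inv_symm 2 m,
    h.inv_symm 1 0, h.inv_symm 2 0, h.inv_symm 2 1]
  ring

/-- The Ricci identity for the covariant derivative of the Hessian. -/
lemma ricci_identity (h : MetricAt G x) (hf : ContDiffAt ℝ 3 f x) (i j m : Fin 3) :
    (pd i (fun y => hess G f y m j) x - ∑ p, (christoffel G p i m x * hess G f x p j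
        + christoffel G p i j x * hess G f x m p))
      - (pd m (fun y => hess G f y i j) x - ∑ p, (christoffel G p m i x * hess G f x p j
        + christoffel G p m j x * hess G f x i p))
      = ∑ l, riemann G l j m i x * pd l f x := by
  have h1 : ∀ i, ContDiffAt ℝ 2 (pd i f) x := fun i => contDiffAt_pd i hf (by norm_num)
  -- The third-order terms differ by the order of the two outer derivatives of `pd j f`, which is C²
  -- because `f` is C³. What is left is curvature.
  simp only [pd_hess h hf, pd_comm (h1 j) m i, h.christoffel_symm _ m i]
  simp only [hess, riemann, Fin.sum_univ_three]
  ring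

/-- The contracted Ricci identity: `div (∇²f - Δf g) = Ric(∇f, ·)`. -/
lemma divTensor_hess_sub (h : MetricAt G x) (hf : ContDiffAt ℝ 3 f x) (m : Fin 3) :
    divTensor G (fun y => hess G f y - laplacian G f y • G y) x m =
      ∑ i, ∑ j, ∑ l, (G x)⁻¹ i j * riemann G l j m i x * pd l f x := by
  have hf2 : ContDiffAt ℝ 2 f x := hf.of_le (by norm_num)
  have hd := differentiableAt_hess h hf
  -- The symmetry of the Hessian is needed as an identity of germs, because it is used under a
  -- derivative.
  have hs : ∀ i j, (fun y => hess G f y i j) =ᶠ[𝓝 x] fun y => hess G f y j i := fun i j => by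
    filter_upwards [h.eventually, hf2.eventually (by simp)] with y h1 h2 using hess_symm h1 h2 i j
  rw [divTensor_sub (T := fun y => laplacian G f y • G y) hd fun i j => (differentiableAt_laplacian h hf).fun_mul (h.differentiableAt i j),
    divTensor_smul_metric h (differentiableAt_laplacian h hf)]
  change _ - pd m (fun y => trace G y (hess G f y)) x = _
  rw [pd_trace h hd]
  simp only [divTensor, ← Finset.sum_sub_distrib, ← mul_sub]
  refine Finset.sum_congr rfl fun i _ => Finset.sum_congr rfl fun j _ => ?_
  simp only [mul_assoc, ← Finset.mul_sum]
  rw [← ricci_identity h hf i j m, pd_congr i (hs j m)]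
  simp only [Fin.sum_univ_three, hess_symm h hf2 j, hess_symm h hf2 m 0, hess_symm h hf2 m 1,
    hess_symm h hf2 m 2]
  congr 1
  ring

end ThreeDimensional

end CoordGeom

/-! ### Inner products, the length of a gradient and the unit normal of level sets. -/

namespace CoordGeom

variable {n : ℕ} {G : Coord n → Matrix (Fin n) (Fin n) ℝ} {x : Coord n} {f : Coord n → ℝ}

lemma ip_symm (h : MetricAt G x) (X Y : Fin n → ℝ) : ip G x X Y = ip G x Y X := by
  unfold ip
  rw [Finset.sum_comm]
  exact Finset.sum_congr rfl fun i _ => Finset.sum_congr rfl fun j _ => by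
    rw [h.symm j i]; ring

lemma ip_eq_dotProduct (X Y : Fin n → ℝ) : ip G x X Y = X ⬝ᵥ (G x).mulVec Y := by
  simp only [ip, dotProduct, Matrix.mulVec, Finset.mul_sum]
  exact Finset.sum_congr rfl fun i _ => Finset.sum_congr rfl fun j _ => by ring

lemma ip_self_pos (h : MetricAt G x) {X : Fin n → ℝ} (hX : X ≠ 0) : 0 < ip G x X X := by
  rw [ip_eq_dotProduct]
  simpa using h.pos.dotProduct_mulVec_pos hX

lemma ip_self_nonneg (h : MetricAt G x) (X : Fin n → ℝ) : 0 ≤ ip G x X X := by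
  by_cases hX : X = 0
  · simp [hX, ip]
  · exact (ip_self_pos h hX).le

lemma len_sq (h : MetricAt G x) (X : Fin n → ℝ) : len G x X ^ 2 = ip G x X X :=
  Real.sq_sqrt (ip_self_nonneg h X)

lemma len_nonneg (X : Fin n → ℝ) : 0 ≤ len G x X := Real.sqrt_nonneg _

lemma ip_add_left (X Y W : Fin n → ℝ) : ip G x (X + Y) W = ip G x X W + ip G x Y W := by
  simp only [ip, Pi.add_apply, ← Finset.sum_add_distrib]
  exact Finset.sum_congr rfl fun i _ => Finset.sum_congr rfl fun j _ => by ring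

lemma ip_add_right (X Y W : Fin n → ℝ) : ip G x W (X + Y) = ip G x W X + ip G x W Y := by
  simp only [ip, Pi.add_apply, ← Finset.sum_add_distrib]
  exact Finset.sum_congr rfl fun i _ => Finset.sum_congr rfl fun j _ => by ring

lemma ip_smul_left (c : ℝ) (X W : Fin n → ℝ) : ip G x (c • X) W = c * ip G x X W := by
  simp only [ip, Pi.smul_apply, smul_eq_mul, Finset.mul_sum]
  exact Finset.sum_congr rfl fun i _ => Finset.sum_congr rfl fun j _ => by ring

lemma ip_smul_right (c : ℝ) (X W : Fin n → ℝ) : ip G x W (c • X) = c * ip G x W X := by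
  simp only [ip, Pi.smul_apply, smul_eq_mul, Finset.mul_sum]
  exact Finset.sum_congr rfl fun i _ => Finset.sum_congr rfl fun j _ => by ring

lemma ip_grad_right (h : MetricAt G x) (X : Fin n → ℝ) :
    ip G x X (grad G f x) = ∑ i, X i * pd i f x := by
  simp only [ip, grad, raise]
  refine Finset.sum_congr rfl fun i _ => ?_
  calc _ = X i * ∑ j, ∑ m, G x i j * (G x)⁻¹ j m * pd m f x := by
        simp only [Finset.mul_sum]
        exact Finset.sum_congr rfl fun j _ => Finset.sum_congr rfl fun m _ => by ring
    _ = _ := by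
        rw [Finset.sum_comm]
        simp only [← Finset.sum_mul, h.sum_mul_inv]
        simp

lemma lower_grad (h : MetricAt G x) (i : Fin n) : lower G x (grad G f x) i = pd i f x := by
  simp only [lower, grad, raise, Finset.mul_sum, ← mul_assoc]
  rw [Finset.sum_comm]
  simp [← Finset.sum_mul, h.sum_mul_inv]

lemma grad_ne_zero_iff (h : MetricAt G x) :
    len G x (grad G f x) ≠ 0 ↔ ∃ i, pd i f x ≠ 0 := by
  constructor
  · intro h0
    by_contra! hc
    apply h0
    have : grad G f x = 0 := by
      ext i; simp [grad, raise, hc]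
    simp [len, this, ip]
  · rintro ⟨i, hi⟩ h0
    have h1 : grad G f x ≠ 0 := by
      intro h2
      apply hi
      rw [← lower_grad h, h2]
      simp [lower]
    have h2 := ip_self_pos h h1
    rw [← len_sq h, h0] at h2
    simp at h2

lemma ip_add_add (h : MetricAt G x) (X Y : Fin n → ℝ) :
    ip G x (X + Y) (X + Y) = ip G x X X + 2 * ip G x X Y + ip G x Y Y := by
  rw [ip_add_left, ip_add_right, ip_add_right, ip_symm h Y X]; ring

lemma differentiableAt_ip (h : MetricAt G x) {X Y : Coord n → Fin n → ℝ}
    (hX : ∀ i, DifferentiableAt ℝ (fun y => X y i) x)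
    (hY : ∀ i, DifferentiableAt ℝ (fun y => Y y i) x) :
    DifferentiableAt ℝ (fun y => ip G y (X y) (Y y)) x :=
  DifferentiableAt.fun_sum fun i _ => DifferentiableAt.fun_sum fun j _ =>
    ((h.differentiableAt i j).fun_mul (hX i)).fun_mul (hY j)

/-- The metric is compatible with the covariant derivative. -/
lemma pd_ip {G : Coord 3 → Matrix (Fin 3) (Fin 3) ℝ} {x : Coord 3} (h : MetricAt G x)
    {X Y : Coord 3 → Fin 3 → ℝ}
    (hX : ∀ i, DifferentiableAt ℝ (fun y => X y i) x)
    (hY : ∀ i, DifferentiableAt ℝ (fun y => Y y i) x) (i : Fin 3) :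
    pd i (fun y => ip G y (X y) (Y y)) x =
      ip G x (fun m => covDeriv G X i m x) (Y x) + ip G x (X x) (fun m => covDeriv G Y i m x) := by
  have e : pd i (fun y => ip G y (X y) (Y y)) x =
      ∑ a, ∑ b, ((pd i (fun y => G y a b) x * X x a + G x a b * pd i (fun y => X y a) x) * Y x b
        + G x a b * X x a * pd i (fun y => Y y b) x) := by
    unfold ip
    rw [pd_sum i _ fun a _ => DifferentiableAt.fun_sum fun b _ =>
      ((h.differentiableAt a b).fun_mul (hX a)).fun_mul (hY b)]
    refine Finset.sum_congr rfl fun a _ => ?_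
    rw [pd_sum i _ fun b _ => ((h.differentiableAt a b).fun_mul (hX a)).fun_mul (hY b)]
    refine Finset.sum_congr rfl fun b _ => ?_
    rw [pd_mul i ((h.differentiableAt a b).fun_mul (hX a)) (hY b),
      pd_mul i (h.differentiableAt a b) (hX a)]
  simp only [e, h.pd_metric]
  simp only [ip, covDeriv, Fin.sum_univ_three, h.symm 1 0, h.symm 2 0, h.symm 2 1]
  ring

lemma differentiableAt_len_grad (h : MetricAt G x) (hf : ContDiffAt ℝ 2 f x)
    (h0 : len G x (grad G f x) ≠ 0) :
    DifferentiableAt ℝ (fun y => len G y (grad G f y)) x := by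
  have hd := differentiableAt_grad h hf
  refine (differentiableAt_ip h hd hd).sqrt ?_
  rw [← len_sq h]
  exact pow_ne_zero 2 h0

section ThreeDimensional

variable {G : Coord 3 → Matrix (Fin 3) (Fin 3) ℝ} {x : Coord 3} {f : Coord 3 → ℝ}

/-- The index of the Hessian raised in `covDeriv_grad` is lowered again by the inner product. -/
lemma ip_covDeriv_grad (h : MetricAt G x) (hf : ContDiffAt ℝ 2 f x) (i : Fin 3) (Y : Fin 3 → ℝ) :
    ip G x (fun m => covDeriv G (grad G f) i m x) Y = ∑ j, hess G f x i j * Y j := by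
  simp only [covDeriv_grad h hf, ip]
  calc _ = ∑ b, (∑ j, hess G f x i j * ∑ a, G x b a * (G x)⁻¹ a j) * Y b := by
        rw [Finset.sum_comm]
        refine Finset.sum_congr rfl fun b _ => ?_
        simp only [h.symm _ b, Fin.sum_univ_three]
        ring
    _ = _ := by simp [h.sum_mul_inv]

/-- `|∇f| ∂_i |∇f| = ∇²f(∂_i, ∇f)`. -/
lemma pd_len_grad (h : MetricAt G x) (hf : ContDiffAt ℝ 2 f x)
    (h0 : len G x (grad G f x) ≠ 0) (i : Fin 3) :
    pd i (fun y => len G y (grad G f y)) x =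
      (len G x (grad G f x))⁻¹ * ∑ j, hess G f x i j * grad G f x j := by
  have hd := differentiableAt_grad h hf
  -- Differentiating the square and dividing by 2|∇f| avoids the derivative of the square root.
  have e : (fun y => len G y (grad G f y) ^ 2) =ᶠ[𝓝 x]
      fun y => ip G y (grad G f y) (grad G f y) := by
    filter_upwards [h.eventually] with y hy using len_sq hy _
  have h1 := pd_congr i e
  rw [pd_sq i (differentiableAt_len_grad h hf h0), pd_ip h hd hd, ip_symm h (grad G f x),
    ip_covDeriv_grad h hf] at h1
  field_simp
  linarith

/-- The Gaussian curvature of the level set of `f` through `x`, as given by the Gauss equation in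
terms of the ambient geometry and the derivatives of `f`. -/
noncomputable def levelSetCurv (G : Coord 3 → Matrix (Fin 3) (Fin 3) ℝ) (f : Coord 3 → ℝ)
    (x : Coord 3) : ℝ :=
  (1 / 2) * scalarCurv G x
    - (len G x (grad G f x) ^ 2)⁻¹ * ∑ m, (∑ i, ∑ j, ∑ l, (G x)⁻¹ i j * riemann G l j m i x
        * pd l f x) * grad G f x m
    + (1 / 2) * (len G x (grad G f x) ^ 2)⁻¹ * (laplacian G f x ^ 2 - normSq G x (hess G f x))
    - (len G x (grad G f x) ^ 4)⁻¹ *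
        (laplacian G f x * ∑ i, ∑ j, hess G f x i j * grad G f x i * grad G f x j
          - ∑ i, ∑ j, (G x)⁻¹ i j * (∑ a, hess G f x i a * grad G f x a)
            * ∑ a, hess G f x j a * grad G f x a)

/-- The unit normal field of the level sets of `f`. -/
noncomputable def normal (G : Coord n → Matrix (Fin n) (Fin n) ℝ) (f : Coord n → ℝ)
    (y : Coord n) : Fin n → ℝ :=
  (len G y (grad G f y))⁻¹ • grad G f y

lemma differentiableAt_normal (h : MetricAt G x) (hf : ContDiffAt ℝ 2 f x)
    (h0 : len G x (grad G f x) ≠ 0) (i : Fin 3) :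
    DifferentiableAt ℝ (fun y => normal G f y i) x :=
  ((differentiableAt_len_grad h hf h0).fun_inv h0).fun_mul (differentiableAt_grad h hf i)

lemma covDeriv_normal (h : MetricAt G x) (hf : ContDiffAt ℝ 2 f x)
    (h0 : len G x (grad G f x) ≠ 0) (i m : Fin 3) :
    covDeriv G (normal G f) i m x = (len G x (grad G f x))⁻¹ * ∑ j, (G x)⁻¹ m j * hess G f x i j
      - (len G x (grad G f x))⁻¹ ^ 3 * (∑ j, hess G f x i j * grad G f x j) * grad G f x m := by
  have hl := differentiableAt_len_grad h hf h0
  rw [← covDeriv_grad h hf]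
  simp only [covDeriv, normal, Pi.smul_apply, smul_eq_mul]
  rw [pd_mul i (hl.fun_inv h0) (differentiableAt_grad h hf m), pd_inv i hl h0,
    pd_len_grad h hf h0]
  simp only [Fin.sum_univ_three]
  ring

/-- The vector field `∇|∇f| - Δf ∇f / |∇f|`, in divergence-free form. -/
lemma grad_len_sub_eq_contract (h : MetricAt G x) (hf : ContDiffAt ℝ 2 f x)
    (h0 : len G x (grad G f x) ≠ 0) :
    grad G (fun y => len G y (grad G f y)) x - laplacian G f x • normal G f x =
      contract G x (hess G f x - laplacian G f x • G x) (normal G f x) := by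
  have e : ∀ i, ∑ j, ∑ m, (G x)⁻¹ i j * G x j m * normal G f x m = normal G f x i := by
    intro i
    rw [Finset.sum_comm]
    simp [← Finset.sum_mul, h.sum_inv_mul]
  ext i
  rw [Pi.sub_apply, Pi.smul_apply, smul_eq_mul, ← e i]
  have e' : grad G (fun y => len G y (grad G f y)) x i =
      ∑ j, (G x)⁻¹ i j * pd j (fun y => len G y (grad G f y)) x := rfl
  rw [e']
  simp only [contract, pd_len_grad h hf h0, normal, Fin.sum_univ_three, Pi.smul_apply, Matrix.sub_apply, Matrix.smul_apply, smul_eq_mul]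
  ring

/-- Serves both tensors of the form T - tr(T) g that occur, ∇²f - Δf g and k - tr(k) g: contraction
with the metric produces a plain trace of `W`. -/
lemma sum_contract_sub_smul_metric (h : MetricAt G x) (T W : Matrix (Fin 3) (Fin 3) ℝ) (c : ℝ) :
    ∑ i, ∑ j, ∑ m, (G x)⁻¹ i j * (T - c • G x) j m * W i m =
      ∑ i, ∑ j, ∑ m, (G x)⁻¹ i j * T j m * W i m - c * ∑ i, W i i := by
  have e : ∀ i, ∑ j, ∑ m, (G x)⁻¹ i j * G x j m * W i m = W i i := by
    intro i
    rw [Finset.sum_comm]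
    simp [← Finset.sum_mul, h.sum_inv_mul]
  simp only [← e, Finset.mul_sum, ← Finset.sum_sub_distrib, Matrix.sub_apply, Matrix.smul_apply,
    smul_eq_mul]
  exact Finset.sum_congr rfl fun i _ => Finset.sum_congr rfl fun j _ =>
    Finset.sum_congr rfl fun m _ => by ring

/-- The Bochner identity combined with the Gauss equation. -/
lemma div_grad_len_sub (h : MetricAt G x) (hf : ContDiffAt ℝ 3 f x)
    (h0 : len G x (grad G f x) ≠ 0) :
    div G (fun y => contract G y (hess G f y - laplacian G f y • G y) (normal G f y)) x =
      1 / (2 * len G x (grad G f x)) * (normSq G x (hess G f x)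
        + len G x (grad G f x) ^ 2 * (scalarCurv G x - 2 * levelSetCurv G f x)
        - laplacian G f x ^ 2) := by
  have hf2 : ContDiffAt ℝ 2 f x := hf.of_le (by norm_num)
  rw [div_contract h (T := fun y => hess G f y - laplacian G f y • G y)
    (fun i j => (differentiableAt_hess h hf i j).fun_sub
      ((differentiableAt_laplacian h hf).fun_mul (h.differentiableAt i j)))
    (differentiableAt_normal h hf2 h0)]
  simp only [divTensor_hess_sub h hf, covDeriv_normal h hf2 h0, levelSetCurv]
  set R : Fin 3 → ℝ := fun m => ∑ i, ∑ j, ∑ l, (G x)⁻¹ i j * riemann G l j m i x * pd l f x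
  set L := len G x (grad G f x) with hL
  have e1 : ∑ m, R m * normal G f x m = L⁻¹ * ∑ m, R m * grad G f x m := by
    simp only [normal, Pi.smul_apply, smul_eq_mul, Finset.mul_sum]
    exact Finset.sum_congr rfl fun m _ => by rw [← hL]; ring
  have e2 : ∑ i, ∑ j, ∑ m, (G x)⁻¹ i j * (hess G f x - laplacian G f x • G x) j m *
      (L⁻¹ * ∑ a, (G x)⁻¹ m a * hess G f x i a
        - L⁻¹ ^ 3 * (∑ a, hess G f x i a * grad G f x a) * grad G f x m) =
      L⁻¹ * (normSq G x (hess G f x) - laplacian G f x ^ 2)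
        - L⁻¹ ^ 3 * (∑ i, ∑ j, (G x)⁻¹ i j * (∑ a, hess G f x i a * grad G f x a)
            * (∑ a, hess G f x j a * grad G f x a)
          - laplacian G f x * ∑ i, ∑ j, hess G f x i j * grad G f x i * grad G f x j) := by
    have e3 := sum_contract_sub_smul_metric h (hess G f x) (Matrix.of fun i m =>
      L⁻¹ * ∑ a, (G x)⁻¹ m a * hess G f x i a
        - L⁻¹ ^ 3 * (∑ a, hess G f x i a * grad G f x a) * grad G f x m) (laplacian G f x)
    simp only [Matrix.of_apply] at e3
    rw [e3]
    have e4 : laplacian G f x = ∑ i, ∑ j, (G x)⁻¹ i j * hess G f x i j := rfl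
    have e5 : ∑ i, (L⁻¹ * ∑ a, (G x)⁻¹ i a * hess G f x i a
        - L⁻¹ ^ 3 * (∑ a, hess G f x i a * grad G f x a) * grad G f x i) =
        L⁻¹ * laplacian G f x
          - L⁻¹ ^ 3 * ∑ i, ∑ j, hess G f x i j * grad G f x i * grad G f x j := by
      rw [e4]
      simp only [Fin.sum_univ_three]
      ring
    rw [e5]
    simp only [normSq, Fin.sum_univ_three, h.inv_symm 1 0, h.inv_symm 2 0, h.inv_symm 2 1,
      hess_symm h hf2 1 0, hess_symm h hf2 2 0, hess_symm h hf2 2 1]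
    ring
  -- The Ricci term and the terms containing ∇²f(∇f, ·) cancel against their counterparts in
  -- `levelSetCurv`. The remaining |∇²f|² - (Δf)² is halved by its third term.
  rw [e1, e2]
  field_simp
  ring

end ThreeDimensional

end CoordGeom

/-! ### The curvature tensor with lowered index and its antisymmetries. -/

namespace CoordGeom

section Riemann

variable {n : ℕ} {G : Coord n → Matrix (Fin n) (Fin n) ℝ} {x : Coord n}

/-- The curvature tensor with lowered index, `R_{pkij} = ⟨R(∂_i, ∂_j) ∂_k, ∂_p⟩`. -/
noncomputable def riemannLow (G : Coord n → Matrix (Fin n) (Fin n) ℝ) (p k i j : Fin n)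
    (x : Coord n) : ℝ :=
  ∑ l, G x p l * riemann G l k i j x

lemma contDiffAt_christoffelLow (h : MetricAt G x) (l i j : Fin n) :
    ContDiffAt ℝ 1 (christoffelLow G l i j) x := by
  have hp := fun a b c => contDiffAt_pd (m := 1) a (h.contDiffAt b c) (by norm_num)
  exact contDiffAt_const.mul (((hp i l j).add (hp j l i)).sub (hp l i j))

lemma differentiableAt_christoffelLow (h : MetricAt G x) (l i j : Fin n) :
    DifferentiableAt ℝ (christoffelLow G l i j) x :=
  (contDiffAt_christoffelLow h l i j).differentiableAt (by norm_num)

/-- Moving the metric inside the derivative costs (∂g)Γ. Since ∂g is a sum of two Christoffel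
symbols of the first kind, one half cancels the quadratic term of the curvature and the other half
replaces it. -/
lemma riemannLow_eq (h : MetricAt G x) (p k i j : Fin n) :
    riemannLow G p k i j x = pd i (christoffelLow G p j k) x - pd j (christoffelLow G p i k) x
      - ∑ m, (christoffelLow G m i p x * christoffel G m j k x
        - christoffelLow G m j p x * christoffel G m i k x) := by
  have key : ∀ i j, ∑ l, G x p l * pd i (christoffel G l j k) x =
      pd i (christoffelLow G p j k) x - ∑ l, (christoffelLow G p i l x + christoffelLow G l i p x)
        * christoffel G l j k x := by
    intro i j
    have e : christoffelLow G p j k =ᶠ[𝓝 x] fun y => ∑ l, G y p l * christoffel G l j k y := by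
      filter_upwards [h.eventually] with y hy using (hy.sum_mul_christoffel p j k).symm
    rw [pd_congr i e, pd_sum i _ fun l _ =>
      (h.differentiableAt p l).fun_mul (h.differentiableAt_christoffel l j k)]
    simp only [pd_mul i (h.differentiableAt p _) (h.differentiableAt_christoffel _ j k),
      h.pd_metric_low, ← Finset.sum_sub_distrib]
    exact Finset.sum_congr rfl fun l _ => by ring
  have key2 : ∀ i j, ∑ l, G x p l * ∑ m, christoffel G l i m x * christoffel G m j k x =
      ∑ m, christoffelLow G p i m x * christoffel G m j k x := by
    intro i j
    simp only [Finset.mul_sum, ← mul_assoc]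
    rw [Finset.sum_comm]
    simp only [← Finset.sum_mul, h.sum_mul_christoffel]
  simp only [riemannLow, riemann, mul_add, mul_sub, Finset.sum_add_distrib,
    Finset.sum_sub_distrib, key, key2, add_mul]
  ring

lemma riemannLow_antisymm_right (p k i j : Fin n) :
    riemannLow G p k i j x = -riemannLow G p k j i x := by
  simp only [riemannLow, riemann, ← Finset.sum_neg_distrib]
  refine Finset.sum_congr rfl fun l _ => ?_
  rw [← mul_neg]
  congr 1
  simp only [Finset.sum_sub_distrib]
  ring

lemma pd_christoffelLow (h : MetricAt G x) (m l i j : Fin n) :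
    pd m (christoffelLow G l i j) x = (1 / 2) * (pd m (pd i (fun y => G y l j)) x
      + pd m (pd j (fun y => G y l i)) x - pd m (pd l (fun y => G y i j)) x) := by
  have hp := fun a b c => differentiableAt_pd a (h.contDiffAt b c)
  unfold christoffelLow
  rw [pd_const_mul m _ (((hp i l j).fun_add (hp j l i)).fun_sub (hp l i j)),
    pd_sub m ((hp i l j).fun_add (hp j l i)) (hp l i j), pd_add m (hp i l j) (hp j l i)]

/-- In `riemannLow_eq` the second derivatives of the metric commute, which leaves a combination
antisymmetric in `p` and `k`. The two quadratic terms are exchanged because `G⁻¹` is symmetric. -/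
lemma riemannLow_antisymm_left (h : MetricAt G x) (p k i j : Fin n) :
    riemannLow G p k i j x = -riemannLow G k p i j x := by
  have hs : ∀ a b c d, pd a (pd b (fun y => G y c d)) x = pd a (pd b (fun y => G y d c)) x := by
    intro a b c d
    refine pd_congr a ?_
    filter_upwards [h.eventually] with y hy using hy.pd_symm b c d
  have hΓ : ∀ i j p k, ∑ m, christoffelLow G m i p x * christoffel G m j k x =
      ∑ m, christoffelLow G m j k x * christoffel G m i p x := by
    intro i j p k
    simp only [christoffel_eq_sum, Finset.mul_sum]
    rw [Finset.sum_comm]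
    exact Finset.sum_congr rfl fun a _ => Finset.sum_congr rfl fun b _ => by
      rw [h.inv_symm a b]; ring
  simp only [riemannLow_eq h, Finset.sum_sub_distrib, pd_christoffelLow h]
  rw [hΓ i j p k, hΓ j i p k, hs i k p j, hs i p j k, hs j k p i, hs j p i k,
    pd_comm (h.contDiffAt p k) i j, hs j i p k, pd_comm (h.contDiffAt k p) i j, hs i p k j,
    hs j p k i]
  ring

end Riemann

/-! ### Tensors with the antisymmetries of a curvature tensor in dimension three -/

section Algebra

variable {R : Fin 3 → Fin 3 → Fin 3 → Fin 3 → ℝ}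

/-- In dimension three, the sectional value of an algebraic curvature tensor on the plane
annihilated by a covector `d`, in terms of its contractions. -/
lemma sectional_eq_contractions (hl : ∀ p k i j, R p k i j = -R k p i j)
    (hr : ∀ p k i j, R p k i j = -R p k j i) {A : Matrix (Fin 3) (Fin 3) ℝ}
    (hA : ∀ i j, A i j = A j i) (hdet : A.det ≠ 0) {d a b : Fin 3 → ℝ} (hd : d ≠ 0)
    (ha : ∑ i, d i * a i = 0) (hb : ∑ i, d i * b i = 0) (V : Fin 3 → ℝ)
    (hV : ∀ i, V i = ∑ j, A⁻¹ i j * d j) :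
    2 * (∑ i, V i * d i) * (∑ p, ∑ k, ∑ i, ∑ j, R p k i j * a p * b k * a i * b j) =
      ((∑ i, ∑ j, A i j * a i * a j) * (∑ i, ∑ j, A i j * b i * b j)
        - (∑ i, ∑ j, A i j * a i * b j) ^ 2) *
      ((∑ i, V i * d i) * (∑ j, ∑ k, A⁻¹ j k * ∑ i, ∑ l, A⁻¹ i l * R l k i j)
        - 2 * ∑ m, (∑ i, ∑ j, ∑ p, A⁻¹ i j * R p j m i * V p) * V m) := by
  have hll : ∀ p i j, R p p i j = 0 := fun p i j => by linarith [hl p p i j]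
  have hrr : ∀ p k i, R p k i i = 0 := fun p k i => by linarith [hr p k i i]
  have hadj : ∀ i j, A.adjugate i j = A.det * A⁻¹ i j := by
    intro i j
    rw [Matrix.inv_def, Matrix.smul_apply, Ring.inverse_eq_inv', smul_eq_mul,
      mul_inv_cancel_left₀ hdet]
  set N := A⁻¹ with hN
  have hNs : ∀ i j, N i j = N j i := by
    have : A.IsSymm := by ext i j; exact hA j i
    intro i j
    exact this.inv.apply j i
  have hNdet : A.det * N.det = 1 := by
    rw [hN, Matrix.det_nonsing_inv, Ring.inverse_eq_inv', mul_inv_cancel₀ hdet]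
  -- the vector product of `a` and `b` is proportional to `d`
  set w : Fin 3 → ℝ := ![a 1 * b 2 - a 2 * b 1, a 2 * b 0 - a 0 * b 2, a 0 * b 1 - a 1 * b 0]
  obtain ⟨c, hc⟩ : ∃ c : ℝ, ∀ i, w i = c * d i := by
    have hpos : d 0 ^ 2 + d 1 ^ 2 + d 2 ^ 2 ≠ 0 := by
      intro h0
      apply hd
      ext i
      fin_cases i <;> simp <;> nlinarith [sq_nonneg (d 0), sq_nonneg (d 1), sq_nonneg (d 2)]
    refine ⟨(w 0 * d 0 + w 1 * d 1 + w 2 * d 2) / (d 0 ^ 2 + d 1 ^ 2 + d 2 ^ 2), fun i => ?_⟩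
    rw [div_mul_eq_mul_div, eq_div_iff hpos]
    simp only [Fin.sum_univ_three] at ha hb
    fin_cases i <;> simp [w]
    · linear_combination (d 2 * a 1 - d 1 * a 2) * hb + (d 1 * b 2 - d 2 * b 1) * ha
    · linear_combination (d 0 * a 2 - d 2 * a 0) * hb + (d 2 * b 0 - d 0 * b 2) * ha
    · linear_combination (d 1 * a 0 - d 0 * a 1) * hb + (d 0 * b 1 - d 1 * b 0) * ha
  -- The mixed coefficients are symmetrized, so neither the pair symmetry of `R` nor the Bianchi
  -- identity is required.
  set Q : ℝ → ℝ → ℝ → ℝ := fun x y z =>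
    R 1 2 1 2 * x * x + R 2 0 2 0 * y * y + R 0 1 0 1 * z * z + (R 1 2 2 0 + R 2 0 1 2) * x * y
      + (R 1 2 0 1 + R 0 1 1 2) * x * z + (R 2 0 0 1 + R 0 1 2 0) * y * z with hQ
  have e1 : ∑ p, ∑ k, ∑ i, ∑ j, R p k i j * a p * b k * a i * b j = Q (w 0) (w 1) (w 2) := by
    simp only [Fin.sum_univ_three, hll, hrr, hl 1 0, hl 2 1, hl 0 2, hr _ _ 1 0, hr _ _ 2 1,
      hr _ _ 0 2, hQ, w, Matrix.cons_val]
    ring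
  -- The Gram determinant of two vectors is the adjugate form evaluated on their vector product.
  have e2 : (∑ i, ∑ j, A i j * a i * a j) * (∑ i, ∑ j, A i j * b i * b j)
        - (∑ i, ∑ j, A i j * a i * b j) ^ 2 = ∑ i, ∑ j, A.adjugate i j * w i * w j := by
    simp only [Fin.sum_univ_three, Matrix.adjugate_fin_three, hA 1 0, hA 2 0, hA 2 1, w,
      Matrix.cons_val, Matrix.of_apply]
    ring
  -- Up to factors, this says that the Einstein tensor in the direction of `V` is minus the
  -- sectional value on the orthogonal plane.
  have e3 : (∑ i, V i * d i) * (∑ j, ∑ k, N j k * ∑ i, ∑ l, N i l * R l k i j)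
        - 2 * ∑ m, (∑ i, ∑ j, ∑ p, N i j * R p j m i * V p) * V m =
      2 * N.det * Q (d 0) (d 1) (d 2) := by
    simp only [hV, Fin.sum_univ_three, hll, hrr, hl 1 0, hl 2 1, hl 0 2, hr _ _ 1 0, hr _ _ 2 1,
      hr _ _ 0 2, hQ, Matrix.det_fin_three, hNs 1 0, hNs 2 0, hNs 2 1]
    ring
  have e4 : ∑ i, ∑ j, A.adjugate i j * w i * w j = c ^ 2 * A.det * ∑ i, V i * d i := by
    simp only [hadj, hc, hV, Fin.sum_univ_three]
    ring
  have e5 : Q (w 0) (w 1) (w 2) = c ^ 2 * Q (d 0) (d 1) (d 2) := by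
    simp only [hc, hQ]; ring
  rw [e1, e2, e3, e4, e5]
  linear_combination -2 * c ^ 2 * (∑ i, V i * d i) * Q (d 0) (d 1) (d 2) * hNdet

end Algebra

end CoordGeom

namespace CoordGeom

/-! ### Parametrized surfaces in a three-dimensional coordinate space -/

/-- The tangent vector `∂_a F`. -/
noncomputable def tangentVec (F : Coord 2 → Coord 3) (a : Fin 2) (s : Coord 2) : Fin 3 → ℝ :=
  fun i => pd a (fun t => F t i) s

section

variable {F : Coord 2 → Coord 3} {s : Coord 2}

lemma contDiffAt_coord {m : ℕ∞ω} (hF : ContDiffAt ℝ m F s) (i : Fin 3) :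
    ContDiffAt ℝ m (fun t => F t i) s :=
  ((EuclideanSpace.proj i : Coord 3 →L[ℝ] ℝ).contDiff.contDiffAt).comp s hF

lemma tangentVec_apply (hF : DifferentiableAt ℝ F s) (a : Fin 2) (i : Fin 3) :
    tangentVec F a s i = fderiv ℝ F s (EuclideanSpace.single a 1) i := by
  have h := ((EuclideanSpace.proj i : Coord 3 →L[ℝ] ℝ).hasFDerivAt (x := F s)).comp s
    hF.hasFDerivAt
  have h' : fderiv ℝ (fun t => F t i) s = _ := h.fderiv
  simp [tangentVec, pd, h']

lemma pd_comp {φ : Coord 3 → ℝ} (hφ : DifferentiableAt ℝ φ (F s)) (hF : DifferentiableAt ℝ F s)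
    (a : Fin 2) :
    pd a (fun t => φ (F t)) s = ∑ i, pd i φ (F s) * tangentVec F a s i := by
  have h : fderiv ℝ (fun t => φ (F t)) s = _ := (hφ.hasFDerivAt.comp s hF.hasFDerivAt).fderiv
  rw [pd, h, ContinuousLinearMap.comp_apply, fderiv_eq_sum_pd φ]
  exact Finset.sum_congr rfl fun i _ => by rw [tangentVec_apply hF, mul_comm]

variable {G : Coord 3 → Matrix (Fin 3) (Fin 3) ℝ}

/-- The first fundamental form of a parametrized surface. -/
noncomputable def firstForm (G : Coord 3 → Matrix (Fin 3) (Fin 3) ℝ) (F : Coord 2 → Coord 3)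
    (s : Coord 2) : Matrix (Fin 2) (Fin 2) ℝ :=
  fun a b => ip G (F s) (tangentVec F a s) (tangentVec F b s)

lemma contDiffAt_tangentVec (hF : ContDiffAt ℝ 3 F s) (a : Fin 2) (i : Fin 3) :
    ContDiffAt ℝ 2 (fun t => tangentVec F a t i) s :=
  contDiffAt_pd a (contDiffAt_coord hF i) (by norm_num)

lemma contDiffAt_firstForm (h : MetricAt G (F s)) (hF : ContDiffAt ℝ 3 F s) (a b : Fin 2) :
    ContDiffAt ℝ 2 (fun t => firstForm G F t a b) s := by
  have hT := contDiffAt_tangentVec hF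
  unfold firstForm ip
  exact ContDiffAt.sum fun i _ => ContDiffAt.sum fun j _ =>
    (((h.contDiffAt i j).comp s (hF.of_le (by norm_num))).mul (hT a i)).mul (hT b j)

lemma linearIndependent_tangentVec_iff (hF : DifferentiableAt ℝ F s) :
    LinearIndependent ℝ (fun a => tangentVec F a s) ↔ Function.Injective (fderiv ℝ F s) := by
  have e : ∀ a, tangentVec F a s = fderiv ℝ F s (EuclideanSpace.single a 1) :=
    fun a => funext fun i => tangentVec_apply hF a i
  rw [Fintype.linearIndependent_iff, injective_iff_map_eq_zero]
  have key : ∀ v : Coord 2, (∑ a, v a • tangentVec F a s = 0 ↔ fderiv ℝ F s v = 0) := by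
    intro v
    have hv : v = ∑ a, v a • EuclideanSpace.single a (1 : ℝ) := by
      ext j; fin_cases j <;> simp
    conv_rhs => rw [hv]
    simp only [map_sum, map_smul, e]
    constructor
    · intro h0
      ext i
      have := congrFun h0 i
      simpa using this
    · intro h0
      ext i
      have := congrArg (fun z : Coord 3 => z i) h0
      simpa using this
  constructor
  · intro H v hv
    ext a
    exact H v ((key v).2 hv) a
  · intro H g hg a
    have := H (WithLp.toLp 2 g) ((key _).1 hg)
    exact congrArg (fun z : Coord 2 => z a) this

/-- The quadratic form of the induced metric at `v` is the squared length of `∑ v a ∂_a F`, nonzero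
by independence. -/
lemma posDef_firstForm (h : MetricAt G (F s))
    (hli : LinearIndependent ℝ (fun a => tangentVec F a s)) : (firstForm G F s).PosDef := by
  refine Matrix.PosDef.of_dotProduct_mulVec_pos ?_ fun v hv => ?_
  · ext a b
    exact ip_symm h _ _
  · have hne : ∑ a, v a • tangentVec F a s ≠ 0 := fun h0 =>
      hv (funext (Fintype.linearIndependent_iff.1 hli v h0))
    have := ip_self_pos h hne
    simp only [Fin.sum_univ_two, ip_add_left, ip_add_right, ip_smul_left, ip_smul_right] at this
    simp only [dotProduct, Matrix.mulVec, Fin.sum_univ_two, firstForm, star_trivial]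
    linarith

lemma metricAt_firstForm (h : MetricAt G (F s)) (hF : ContDiffAt ℝ 3 F s)
    (hinj : Function.Injective (fderiv ℝ F s)) : MetricAt (firstForm G F) s := by
  refine ⟨contDiffAt_firstForm h hF, ?_⟩
  have hli := (linearIndependent_tangentVec_iff (hF.differentiableAt (by norm_num))).2 hinj
  have hc : ContinuousAt (fun t => fun a => tangentVec F a t) s :=
    continuousAt_pi.2 fun a => continuousAt_pi.2 fun i => (contDiffAt_tangentVec hF a i).continuousAt
  -- The immersion condition is assumed only at `s`. Linear independence is open, so it persists
  -- nearby, as `MetricAt` requires.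
  have h1 := hc.eventually (isOpen_setOfPred_linearIndependent.mem_nhds hli)
  have h2 := hF.continuousAt.eventually h.eventually
  filter_upwards [h1, h2] with t ht1 ht2 using posDef_firstForm ht2 ht1

/-- Christoffel symbols of the first kind of the induced metric. -/
lemma christoffelLow_firstForm (h : MetricAt G (F s)) (hF : ContDiffAt ℝ 3 F s) (c a b : Fin 2) :
    christoffelLow (firstForm G F) c a b s =
      ∑ i, ∑ j, G (F s) i j * pd a (fun t => tangentVec F b t i) s * tangentVec F c s j
      + ∑ j, ∑ k, ∑ l, christoffelLow G j k l (F s) * tangentVec F c s j * tangentVec F a s k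
        * tangentVec F b s l := by
  have hd : DifferentiableAt ℝ F s := hF.differentiableAt (by norm_num)
  have hT : ∀ a i, DifferentiableAt ℝ (fun t => tangentVec F a t i) s :=
    fun a i => (contDiffAt_tangentVec hF a i).differentiableAt (by norm_num)
  have hg : ∀ i j, DifferentiableAt ℝ (fun t => G (F t) i j) s :=
    fun i j => (h.differentiableAt i j).comp s hd
  have hcomm : ∀ a b i, pd a (fun t => tangentVec F b t i) s =
      pd b (fun t => tangentVec F a t i) s :=
    fun a b i => pd_comm ((contDiffAt_coord hF i).of_le (by norm_num)) a b
  have e : ∀ a b c, pd a (fun t => firstForm G F t b c) s =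
      ∑ i, ∑ j, (((∑ k, pd k (fun y => G y i j) (F s) * tangentVec F a s k) * tangentVec F b s i
        + G (F s) i j * pd a (fun t => tangentVec F b t i) s) * tangentVec F c s j
        + G (F s) i j * tangentVec F b s i * pd a (fun t => tangentVec F c t j) s) := by
    intro a b c
    simp only [firstForm, ip]
    rw [pd_sum a _ fun i _ => DifferentiableAt.fun_sum fun j _ =>
      ((hg i j).fun_mul (hT b i)).fun_mul (hT c j)]
    refine Finset.sum_congr rfl fun i _ => ?_
    rw [pd_sum a _ fun j _ => ((hg i j).fun_mul (hT b i)).fun_mul (hT c j)]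
    refine Finset.sum_congr rfl fun j _ => ?_
    rw [pd_mul a ((hg i j).fun_mul (hT b i)) (hT c j), pd_mul a (hg i j) (hT b i),
      pd_comp (φ := fun y => G y i j) (h.differentiableAt i j) hd]
  rw [christoffelLow]
  simp only [e, h.pd_metric_low, hcomm b a, hcomm c a, hcomm c b]
  simp only [Fin.sum_univ_three, h.symm 1 0, h.symm 2 0, h.symm 2 1]
  simp only [h.christoffelLow_symm _ 1 0, h.christoffelLow_symm _ 2 0, h.christoffelLow_symm _ 2 1]
  ring

end

end CoordGeom

/-! ### Second derivatives of a parametrization and the Gauss equation in unsplit form. -/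

namespace CoordGeom

variable {F : Coord 2 → Coord 3} {s : Coord 2} {G : Coord 3 → Matrix (Fin 3) (Fin 3) ℝ}

/-- The second partial derivatives `∂_a ∂_b F`. -/
noncomputable def secondVec (F : Coord 2 → Coord 3) (a b : Fin 2) (s : Coord 2) : Fin 3 → ℝ :=
  fun i => pd a (fun t => tangentVec F b t i) s

lemma secondVec_comm (hF : ContDiffAt ℝ 3 F s) (a b : Fin 2) (i : Fin 3) :
    secondVec F a b s i = secondVec F b a s i :=
  pd_comm ((contDiffAt_coord hF i).of_le (by norm_num)) a b

/-- The third derivatives of `F` are isolated in the single term with `pd e` of `secondVec`, ready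
to cancel in the curvature. -/
lemma pd_christoffelLow_firstForm (h : MetricAt G (F s)) (hF : ContDiffAt ℝ 3 F s)
    (e c a b : Fin 2) :
    pd e (christoffelLow (firstForm G F) c a b) s =
      ∑ i, ∑ j, (((∑ k, pd k (fun y => G y i j) (F s) * tangentVec F e s k) * secondVec F a b s i
        + G (F s) i j * pd e (fun t => secondVec F a b t i) s) * tangentVec F c s j
        + G (F s) i j * secondVec F a b s i * secondVec F e c s j)
      + ∑ j, ∑ k, ∑ l, (((((∑ m, pd m (christoffelLow G j k l) (F s) * tangentVec F e s m)
          * tangentVec F c s j + christoffelLow G j k l (F s) * secondVec F e c s j)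
          * tangentVec F a s k
        + christoffelLow G j k l (F s) * tangentVec F c s j * secondVec F e a s k)
          * tangentVec F b s l)
        + christoffelLow G j k l (F s) * tangentVec F c s j * tangentVec F a s k
          * secondVec F e b s l) := by
  have hd : DifferentiableAt ℝ F s := hF.differentiableAt (by norm_num)
  have hT : ∀ a i, DifferentiableAt ℝ (fun t => tangentVec F a t i) s :=
    fun a i => (contDiffAt_tangentVec hF a i).differentiableAt (by norm_num)
  have hA : ∀ i, DifferentiableAt ℝ (fun t => secondVec F a b t i) s :=
    fun i => differentiableAt_pd a (contDiffAt_tangentVec hF b i)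
  have hg : ∀ i j, DifferentiableAt ℝ (fun t => G (F t) i j) s :=
    fun i j => (h.differentiableAt i j).comp s hd
  have hc : ∀ i j k, DifferentiableAt ℝ (fun t => christoffelLow G i j k (F t)) s :=
    fun i j k => (differentiableAt_christoffelLow h i j k).comp s hd
  have E : christoffelLow (firstForm G F) c a b =ᶠ[𝓝 s] fun t =>
      ∑ i, ∑ j, G (F t) i j * secondVec F a b t i * tangentVec F c t j
      + ∑ j, ∑ k, ∑ l, christoffelLow G j k l (F t) * tangentVec F c t j * tangentVec F a t k
        * tangentVec F b t l := by
    filter_upwards [hF.eventually (by simp), hF.continuousAt.eventually h.eventually] with t h1 h2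
      using christoffelLow_firstForm h2 h1 c a b
  have d1 : ∀ i j, DifferentiableAt ℝ
      (fun t => G (F t) i j * secondVec F a b t i * tangentVec F c t j) s :=
    fun i j => ((hg i j).fun_mul (hA i)).fun_mul (hT c j)
  have d2 : ∀ j k l, DifferentiableAt ℝ (fun t => christoffelLow G j k l (F t)
      * tangentVec F c t j * tangentVec F a t k * tangentVec F b t l) s :=
    fun j k l => (((hc j k l).fun_mul (hT c j)).fun_mul (hT a k)).fun_mul (hT b l)
  rw [pd_congr e E, pd_add e
    (DifferentiableAt.fun_sum fun i _ => DifferentiableAt.fun_sum fun j _ => d1 i j)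
    (DifferentiableAt.fun_sum fun i _ => DifferentiableAt.fun_sum fun j _ =>
      DifferentiableAt.fun_sum fun k _ => d2 i j k)]
  congr 1
  · rw [pd_sum e _ fun i _ => DifferentiableAt.fun_sum fun j _ => d1 i j]
    refine Finset.sum_congr rfl fun i _ => ?_
    rw [pd_sum e _ fun j _ => d1 i j]
    refine Finset.sum_congr rfl fun j _ => ?_
    rw [pd_mul e ((hg i j).fun_mul (hA i)) (hT c j), pd_mul e (hg i j) (hA i),
      pd_comp (φ := fun y => G y i j) (h.differentiableAt i j) hd]
    rfl
  · rw [pd_sum e _ fun i _ => DifferentiableAt.fun_sum fun j _ =>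
      DifferentiableAt.fun_sum fun k _ => d2 i j k]
    refine Finset.sum_congr rfl fun i _ => ?_
    rw [pd_sum e _ fun j _ => DifferentiableAt.fun_sum fun k _ => d2 i j k]
    refine Finset.sum_congr rfl fun j _ => ?_
    rw [pd_sum e _ fun k _ => d2 i j k]
    refine Finset.sum_congr rfl fun k _ => ?_
    rw [pd_mul e (((hc i j k).fun_mul (hT c i)).fun_mul (hT a j)) (hT b k),
      pd_mul e ((hc i j k).fun_mul (hT c i)) (hT a j), pd_mul e (hc i j k) (hT c i),
      pd_comp (differentiableAt_christoffelLow h i j k) hd]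
    rfl

/-- The covariant second derivatives `∂_a ∂_b F + Γ(∂_a F, ∂_b F)`. -/
noncomputable def covSecondVec (G : Coord 3 → Matrix (Fin 3) (Fin 3) ℝ) (F : Coord 2 → Coord 3)
    (a b : Fin 2) (s : Coord 2) : Fin 3 → ℝ :=
  fun i => secondVec F a b s i
    + ∑ k, ∑ l, christoffel G i k l (F s) * tangentVec F a s k * tangentVec F b s l

lemma ip_christoffel (h : MetricAt G (F s)) (X Y W : Fin 3 → ℝ) :
    ip G (F s) (fun i => ∑ k, ∑ l, christoffel G i k l (F s) * X k * Y l) W =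
      ∑ j, ∑ k, ∑ l, christoffelLow G j k l (F s) * W j * X k * Y l := by
  simp only [← h.sum_mul_christoffel, ip]
  simp only [Fin.sum_univ_three, h.symm 1 0, h.symm 2 0, h.symm 2 1]
  ring

lemma ip_covSecondVec (h : MetricAt G (F s)) (a b : Fin 2) (X : Fin 3 → ℝ) :
    ip G (F s) (covSecondVec G F a b s) X = ip G (F s) (secondVec F a b s) X
      + ∑ j, ∑ k, ∑ l, christoffelLow G j k l (F s) * X j * tangentVec F a s k
        * tangentVec F b s l := by
  rw [← ip_christoffel h, ← ip_add_left]
  rfl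

/-- The Levi-Civita connection of the induced metric is the tangential part of the ambient one. -/
lemma christoffelLow_firstForm_eq_ip (h : MetricAt G (F s)) (hF : ContDiffAt ℝ 3 F s)
    (c a b : Fin 2) :
    christoffelLow (firstForm G F) c a b s =
      ip G (F s) (covSecondVec G F a b s) (tangentVec F c s) := by
  rw [christoffelLow_firstForm h hF, ip_covSecondVec h]
  rfl

/-- The curvature of the ambient space in the direction of the plane tangent to the surface. -/
noncomputable def tangentRiemann (G : Coord 3 → Matrix (Fin 3) (Fin 3) ℝ) (F : Coord 2 → Coord 3)
    (s : Coord 2) : ℝ :=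
  ∑ p, ∑ k, ∑ i, ∑ j, riemannLow G p k i j (F s) * tangentVec F 0 s p * tangentVec F 1 s k
    * tangentVec F 0 s i * tangentVec F 1 s j

/-- The Gauss equation, before splitting the covariant second derivatives into tangential and
normal parts. -/
lemma pd_sub_pd_christoffelLow_firstForm (h : MetricAt G (F s)) (hF : ContDiffAt ℝ 3 F s) :
    pd 0 (christoffelLow (firstForm G F) 0 1 1) s - pd 1 (christoffelLow (firstForm G F) 0 0 1) s =
      tangentRiemann G F s + ip G (F s) (covSecondVec G F 0 0 s) (covSecondVec G F 1 1 s)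
        - ip G (F s) (covSecondVec G F 0 1 s) (covSecondVec G F 0 1 s) := by
  -- The third derivatives of `F` drop out of the difference.
  have e3 : ∀ i, pd 0 (fun t => secondVec F 1 1 t i) s = pd 1 (fun t => secondVec F 0 1 t i) s :=
    fun i => pd_comm (contDiffAt_tangentVec hF 1 i) 0 1
  have hΓ : ∀ a b c d : Fin 2, ip G (F s) (covSecondVec G F a b s) (covSecondVec G F c d s) =
      ip G (F s) (secondVec F a b s) (secondVec F c d s)
      + (∑ j, ∑ k, ∑ l, christoffelLow G j k l (F s) * secondVec F a b s j * tangentVec F c s k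
        * tangentVec F d s l)
      + (∑ j, ∑ k, ∑ l, christoffelLow G j k l (F s) * secondVec F c d s j * tangentVec F a s k
        * tangentVec F b s l)
      + ∑ j, ∑ k, ∑ l, christoffelLow G j k l (F s)
        * (∑ k, ∑ l, christoffel G j k l (F s) * tangentVec F c s k * tangentVec F d s l)
        * tangentVec F a s k * tangentVec F b s l := by
    intro a b c d
    have e : covSecondVec G F c d s = secondVec F c d s +
      fun i => ∑ k, ∑ l, christoffel G i k l (F s) * tangentVec F c s k * tangentVec F d s l := rfl
    rw [e, ip_add_right, ip_covSecondVec h, ip_covSecondVec h,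
      ip_symm h (secondVec F a b s) (fun i => ∑ k, ∑ l, christoffel G i k l (F s)
        * tangentVec F c s k * tangentVec F d s l), ip_christoffel h]
    ring
  have hR : tangentRiemann G F s =
      (∑ p, ∑ k, ∑ i, ∑ j, (pd i (christoffelLow G p j k) (F s)
        - pd j (christoffelLow G p i k) (F s)) * tangentVec F 0 s p * tangentVec F 1 s k
        * tangentVec F 0 s i * tangentVec F 1 s j)
      - (∑ j, ∑ k, ∑ l, christoffelLow G j k l (F s)
        * (∑ k, ∑ l, christoffel G j k l (F s) * tangentVec F 1 s k * tangentVec F 1 s l)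
        * tangentVec F 0 s k * tangentVec F 0 s l)
      + ∑ j, ∑ k, ∑ l, christoffelLow G j k l (F s)
        * (∑ k, ∑ l, christoffel G j k l (F s) * tangentVec F 0 s k * tangentVec F 1 s l)
        * tangentVec F 0 s k * tangentVec F 1 s l := by
    simp only [tangentRiemann, riemannLow_eq h]
    simp only [Fin.sum_univ_three]
    simp only [h.christoffelLow_symm _ 1 0, h.christoffelLow_symm _ 2 0,
      h.christoffelLow_symm _ 2 1]
    ring
  rw [hR, hΓ, hΓ, pd_christoffelLow_firstForm h hF, pd_christoffelLow_firstForm h hF]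
  simp only [e3, secondVec_comm hF 1 0, h.pd_metric_low, ip]
  simp only [Fin.sum_univ_three, h.symm 1 0, h.symm 2 0, h.symm 2 1]
  simp only [h.christoffelLow_symm _ 1 0, h.christoffelLow_symm _ 2 0,
    h.christoffelLow_symm _ 2 1]
  ring

end CoordGeom

/-! ### The Gauss equation for level sets. -/

namespace CoordGeom

variable {F : Coord 2 → Coord 3} {s : Coord 2} {G : Coord 3 → Matrix (Fin 3) (Fin 3) ℝ}
  {f : Coord 3 → ℝ}

/-- Decomposition of the inner product into parts tangential and normal to a plane. -/
lemma ip_eq_tangential_add_normal {x : Coord 3} (h : MetricAt G x) {T : Fin 2 → Fin 3 → ℝ}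
    {K : Matrix (Fin 2) (Fin 2) ℝ} (hK : ∀ a c, ∑ b, ip G x (T a) (T b) * K b c =
      if a = c then 1 else 0) {V : Fin 3 → ℝ}
    (hV : ∀ a, ip G x (T a) V = 0) (hVV : ip G x V V ≠ 0) (X Y : Fin 3 → ℝ) :
    ip G x X Y = ∑ a, ∑ b, K a b * ip G x X (T a) * ip G x Y (T b)
      + (ip G x V V)⁻¹ * ip G x X V * ip G x Y V := by
  set B : Matrix (Fin 3) (Fin 3) ℝ := Matrix.of ![T 0, T 1, V]
  have hBG : ∀ (i : Fin 3) (W : Fin 3 → ℝ), (B * G x).mulVec W i = ip G x (B i) W := by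
    intro i W
    simp only [Matrix.mulVec, dotProduct, Matrix.mul_apply, ip, Fin.sum_univ_three]
    ring
  have hM : B * G x * B.transpose = Matrix.of fun i j => ip G x (B i) (B j) := by
    ext i j
    rw [Matrix.of_apply, ← hBG]
    rfl
  have hKdet : (ip G x (T 0) (T 0) * ip G x (T 1) (T 1) - ip G x (T 0) (T 1) ^ 2) ≠ 0 := by
    have h1 : (Matrix.of fun a b => ip G x (T a) (T b)) * K = 1 := by
      ext a c
      rw [Matrix.mul_apply, Matrix.one_apply, ← hK a c]
      rfl
    have h2 := congrArg Matrix.det h1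
    rw [Matrix.det_mul, Matrix.det_one, Matrix.det_fin_two] at h2
    intro h0
    simp only [Matrix.of_apply, ip_symm h (T 1) (T 0)] at h2
    rw [← pow_two, h0, zero_mul] at h2
    exact zero_ne_one h2
  -- The determinant of `B G Bᵀ` is the Gram determinant of `T 0`, `T 1`, `V`. It splits into a
  -- nonzero tangential block and ⟨V, V⟩, so these vectors span.
  have hdet : (B * G x).det ≠ 0 := by
    intro h0
    have h1 := congrArg Matrix.det hM
    rw [Matrix.det_mul, h0, zero_mul, Matrix.det_fin_three] at h1
    simp only [Matrix.of_apply, show B 0 = T 0 from rfl, show B 1 = T 1 from rfl,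
      show B 2 = V from rfl, hV, ip_symm h V (T _), ip_symm h (T 1) (T 0)] at h1
    refine mul_ne_zero hKdet hVV ?_
    linear_combination -h1
  -- `Z` is `Y` minus its expected expansion. It is orthogonal to `T 0`, `T 1` and `V`, hence zero.
  set Z : Fin 3 → ℝ := Y + (-1 : ℝ) • (∑ a, (∑ b, K a b * ip G x Y (T b)) • T a
    + ((ip G x V V)⁻¹ * ip G x Y V) • V) with hZ
  have hZip : ∀ W, ip G x W Z = ip G x W Y - (∑ a, (∑ b, K a b * ip G x Y (T b)) * ip G x W (T a)
      + (ip G x V V)⁻¹ * ip G x Y V * ip G x W V) := by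
    intro W
    simp only [hZ, ip_add_right, ip_smul_right, Fin.sum_univ_two]
    ring
  have hTZ : ∀ c, ip G x (T c) Z = 0 := by
    intro c
    have h1 := hK c 0
    have h2 := hK c 1
    rw [hZip, hV, ip_symm h (T c) Y]
    simp only [Fin.sum_univ_two] at h1 h2 ⊢
    have h3 : ip G x Y (T c) = (if c = 0 then 1 else 0) * ip G x Y (T 0)
        + (if c = 1 then 1 else 0) * ip G x Y (T 1) := by
      fin_cases c <;> simp
    rw [← h1, ← h2] at h3
    linear_combination h3
  have hVZ : ip G x V Z = 0 := by
    rw [hZip]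
    simp only [ip_symm h V (T _), hV, mul_zero, Finset.sum_const_zero, ip_symm h V Y]
    field_simp
    ring
  have hZ0 : Z = 0 := by
    refine Matrix.eq_zero_of_mulVec_eq_zero hdet ?_
    ext i
    rw [hBG]
    fin_cases i
    · exact hTZ 0
    · exact hTZ 1
    · exact hVZ
  have h1 := hZip X
  rw [hZ0, show ip G x X 0 = 0 by simp [ip]] at h1
  simp only [Fin.sum_univ_two] at h1 ⊢
  linear_combination -h1

/-- Differentiate `f ∘ F`, which is constant near `s`. -/
lemma ip_tangentVec_grad (h : MetricAt G (F s)) (hF : ContDiffAt ℝ 3 F s)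
    (hf : ContDiffAt ℝ 3 f (F s)) (hlev : ∀ᶠ t in 𝓝 s, f (F t) = f (F s)) (a : Fin 2) :
    ip G (F s) (tangentVec F a s) (grad G f (F s)) = 0 := by
  have h1 : (fun t => f (F t)) =ᶠ[𝓝 s] fun _ => f (F s) := hlev
  rw [ip_grad_right h, ← pd_const a (f (F s)) s, ← pd_congr a h1,
    pd_comp (hf.differentiableAt (by norm_num)) (hF.differentiableAt (by norm_num))]
  exact Finset.sum_congr rfl fun i _ => mul_comm _ _

/-- The normal part of the covariant second derivatives of a parametrized level set. -/
lemma ip_covSecondVec_grad (h : MetricAt G (F s)) (hF : ContDiffAt ℝ 3 F s)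
    (hf : ContDiffAt ℝ 3 f (F s)) (hlev : ∀ᶠ t in 𝓝 s, f (F t) = f (F s)) (a b : Fin 2) :
    ip G (F s) (covSecondVec G F a b s) (grad G f (F s)) =
      -∑ i, ∑ j, hess G f (F s) i j * tangentVec F a s i * tangentVec F b s j := by
  have hd : DifferentiableAt ℝ F s := hF.differentiableAt (by norm_num)
  have hf2 : ContDiffAt ℝ 2 f (F s) := hf.of_le (by norm_num)
  -- The relation df(∂_b F) = 0 holds at all nearby parameters and can be differentiated once more.
  -- This yields the second fundamental form up to the factor |∇f|.
  have h1 : (fun t => ∑ i, pd i f (F t) * tangentVec F b t i) =ᶠ[𝓝 s] fun _ => 0 := by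
    have hlev' : ∀ᶠ t in 𝓝 s, ∀ᶠ r in 𝓝 t, f (F r) = f (F t) := by
      filter_upwards [hlev.eventually_nhds, hlev] with t ht ht'
      simpa only [ht'] using ht
    filter_upwards [hF.continuousAt.eventually h.eventually, hF.eventually (by simp), hlev',
      hF.continuousAt.eventually (hf.eventually (by simp))] with t t1 t2 t3 t4
    have := ip_tangentVec_grad t1 t2 t4 t3 b
    rw [ip_grad_right t1] at this
    rw [← this]
    exact Finset.sum_congr rfl fun i _ => mul_comm _ _
  have hp : ∀ i, DifferentiableAt ℝ (fun t => pd i f (F t)) s :=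
    fun i => (differentiableAt_pd i hf2).comp s hd
  have hT : ∀ i, DifferentiableAt ℝ (fun t => tangentVec F b t i) s :=
    fun i => (contDiffAt_tangentVec hF b i).differentiableAt (by norm_num)
  have h2 := pd_congr a h1
  rw [pd_const, pd_sum a _ fun i _ => (hp i).fun_mul (hT i)] at h2
  simp only [fun i => pd_mul a (hp i) (hT i), fun i => pd_comp (differentiableAt_pd i hf2) hd a]
    at h2
  rw [ip_grad_right h]
  simp only [covSecondVec, hess, secondVec, Fin.sum_univ_three] at h2 ⊢
  linear_combination h2

/-- The Gauss equation for a parametrized level set. -/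
theorem gaussCurv_eq_levelSetCurv (h : MetricAt G (F s)) (hF : ContDiffAt ℝ 3 F s)
    (hinj : Function.Injective (fderiv ℝ F s)) (hf : ContDiffAt ℝ 3 f (F s))
    (hlev : ∀ᶠ t in 𝓝 s, f (F t) = f (F s)) (h0 : len G (F s) (grad G f (F s)) ≠ 0) :
    (∑ l, firstForm G F s 0 l * riemann (firstForm G F) l 1 0 1 s) / (firstForm G F s).det =
      levelSetCurv G f (F s) := by
  have hf2 : ContDiffAt ℝ 2 f (F s) := hf.of_le (by norm_num)
  have hm := metricAt_firstForm h hF hinj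
  set x := F s
  set V := grad G f x with hVdef
  set T := fun a => tangentVec F a s with hTdef
  set H := hess G f x with hH
  have hlen : ip G x V V = len G x V ^ 2 := (len_sq h V).symm
  have hVV : ip G x V V ≠ 0 := by rw [hlen]; exact pow_ne_zero 2 h0
  have hTV : ∀ a, ip G x (T a) V = 0 := ip_tangentVec_grad h hF hf hlev
  have hdec := ip_eq_tangential_add_normal h (T := T) (K := (firstForm G F s)⁻¹)
    (fun a c => hm.sum_mul_inv a c) hTV hVV
  -- the numerator
  have hnum : ∑ l, firstForm G F s 0 l * riemann (firstForm G F) l 1 0 1 s =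
      ∑ p, ∑ k, ∑ i, ∑ j, (riemannLow G p k i j x
        + (ip G x V V)⁻¹ * (H p i * H k j - H p j * H k i)) * T 0 p * T 1 k * T 0 i * T 1 j := by
    change riemannLow (firstForm G F) 0 1 0 1 s = _
    -- The tangential parts of the inner products cancel the quadratic Christoffel terms of the
    -- induced metric. The normal parts give the products of Hessians.
    rw [riemannLow_eq hm, pd_sub_pd_christoffelLow_firstForm h hF, hdec (covSecondVec G F 0 0 s),
      hdec (covSecondVec G F 0 1 s)]
    simp only [christoffel_eq_sum, christoffelLow_firstForm_eq_ip h hF]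
    have hc : covSecondVec G F 1 0 s = covSecondVec G F 0 1 s := by
      ext i
      simp only [covSecondVec, secondVec_comm hF 1 0]
      rw [Finset.sum_comm]
      congr 1
      exact Finset.sum_congr rfl fun k _ => Finset.sum_congr rfl fun l _ => by
        rw [h.christoffel_symm i l k]; ring
    simp only [hVdef, x, hc, ip_covSecondVec_grad h hF hf hlev, tangentRiemann]
    simp only [← hVdef, ← hH, x, add_mul, Finset.sum_add_distrib, hTdef]
    have e1 : ∑ p, ∑ k, ∑ i, ∑ j, (ip G (F s) V V)⁻¹ * (H p i * H k j - H p j * H k i)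
        * tangentVec F 0 s p * tangentVec F 1 s k * tangentVec F 0 s i * tangentVec F 1 s j =
        (ip G (F s) V V)⁻¹ *
          ((∑ i, ∑ j, H i j * tangentVec F 0 s i * tangentVec F 0 s j)
            * (∑ i, ∑ j, H i j * tangentVec F 1 s i * tangentVec F 1 s j)
          - (∑ i, ∑ j, H i j * tangentVec F 0 s i * tangentVec F 1 s j) ^ 2) := by
      simp only [Fin.sum_univ_three, hH, hess_symm h hf2 1 0, hess_symm h hf2 2 0,
        hess_symm h hf2 2 1]
      ring
    rw [e1]
    simp only [Fin.sum_univ_two]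
    ring
  have hdet : (firstForm G F s).det = (∑ i, ∑ j, G x i j * T 0 i * T 0 j)
      * (∑ i, ∑ j, G x i j * T 1 i * T 1 j) - (∑ i, ∑ j, G x i j * T 0 i * T 1 j) ^ 2 := by
    rw [Matrix.det_fin_two, hm.symm 1 0, pow_two]
    rfl
  have hd0 : (fun i => pd i f x) ≠ 0 := by
    intro hc
    obtain ⟨i, hi⟩ := (grad_ne_zero_iff h).1 h0
    exact hi (congrFun hc i)
  have hTd : ∀ a, ∑ i, pd i f x * T a i = 0 := by
    intro a
    rw [← hTV a, ip_grad_right h]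
    exact Finset.sum_congr rfl fun i _ => mul_comm _ _
  -- The algebraic identity is applied to the ambient curvature plus the extrinsic term at once,
  -- since their sum has the same antisymmetries. Its contractions are the terms of `levelSetCurv`.
  have key := sectional_eq_contractions
    (R := fun p k i j => riemannLow G p k i j x
      + (ip G x V V)⁻¹ * (H p i * H k j - H p j * H k i))
    (fun p k i j => by simp only [riemannLow_antisymm_left h p k i j]; ring)
    (fun p k i j => by simp only [riemannLow_antisymm_right p k i j]; ring)
    h.symm h.det_ne_zero hd0 (hTd 0) (hTd 1) V (fun i => rfl)
  rw [← hnum, ← hdet, ← ip_grad_right h, ← hVdef] at key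
  have hN : ∀ i k j, ∑ l, (G x)⁻¹ i l * riemannLow G l k i j x = riemann G i k i j x := by
    intro i k j
    simp only [riemannLow, Finset.mul_sum, ← mul_assoc]
    rw [Finset.sum_comm]
    simp [← Finset.sum_mul, h.sum_inv_mul]
  have hscal : ∑ j, ∑ k, (G x)⁻¹ j k * ∑ i, ∑ l, (G x)⁻¹ i l * (riemannLow G l k i j x
        + (ip G x V V)⁻¹ * (H l i * H k j - H l j * H k i)) =
      scalarCurv G x + (ip G x V V)⁻¹ * (laplacian G f x ^ 2 - normSq G x H) := by
    simp only [mul_add, Finset.sum_add_distrib, hN, scalarCurv]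
    congr 1
    simp only [laplacian, trace, normSq, ← hH, Fin.sum_univ_three]
    simp only [hH, hess_symm h hf2 1 0, hess_symm h hf2 2 0, hess_symm h hf2 2 1,
      h.inv_symm 1 0, h.inv_symm 2 0, h.inv_symm 2 1]
    ring
  have hVG : ∀ i j m, ∑ p, riemannLow G p j m i x * V p = ∑ l, riemann G l j m i x * pd l f x := by
    intro i j m
    simp only [riemannLow, Finset.sum_mul]
    rw [Finset.sum_comm]
    refine Finset.sum_congr rfl fun l _ => ?_
    rw [← lower_grad h, ← hVdef, lower, Finset.mul_sum]
    exact Finset.sum_congr rfl fun p _ => by rw [h.symm l p]; ring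
  have hric : ∑ m, (∑ i, ∑ j, ∑ p, (G x)⁻¹ i j * (riemannLow G p j m i x
        + (ip G x V V)⁻¹ * (H p m * H j i - H p i * H j m)) * V p) * V m =
      ∑ m, (∑ i, ∑ j, ∑ l, (G x)⁻¹ i j * riemann G l j m i x * pd l f x) * V m
      + (ip G x V V)⁻¹ * (laplacian G f x * ∑ i, ∑ j, H i j * V i * V j
        - ∑ i, ∑ j, (G x)⁻¹ i j * (∑ a, H i a * V a) * ∑ a, H j a * V a) := by
    have e1 : ∀ m, ∑ i, ∑ j, ∑ p, (G x)⁻¹ i j * (riemannLow G p j m i x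
        + (ip G x V V)⁻¹ * (H p m * H j i - H p i * H j m)) * V p =
        ∑ i, ∑ j, ∑ l, (G x)⁻¹ i j * riemann G l j m i x * pd l f x
        + (ip G x V V)⁻¹ * ∑ i, ∑ j, ∑ p, (G x)⁻¹ i j * (H p m * H j i - H p i * H j m) * V p := by
      intro m
      simp only [mul_assoc, ← Finset.mul_sum, ← hVG]
      simp only [Fin.sum_univ_three]
      ring
    have e2 : ∑ m, (∑ i, ∑ j, ∑ p, (G x)⁻¹ i j * (H p m * H j i - H p i * H j m) * V p) * V m =
        laplacian G f x * ∑ i, ∑ j, H i j * V i * V j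
        - ∑ i, ∑ j, (G x)⁻¹ i j * (∑ a, H i a * V a) * ∑ a, H j a * V a := by
      simp only [laplacian, trace, ← hH, Fin.sum_univ_three]
      simp only [hH, hess_symm h hf2 1 0, hess_symm h hf2 2 0, hess_symm h hf2 2 1,
        h.inv_symm 1 0, h.inv_symm 2 0, h.inv_symm 2 1]
      ring
    rw [← e2, Finset.mul_sum, ← Finset.sum_add_distrib]
    exact Finset.sum_congr rfl fun m _ => by rw [e1]; ring
  rw [hscal, hric] at key
  rw [div_eq_iff hm.det_ne_zero, levelSetCurv, ← hVdef, ← hH,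
    show len G x V ^ 4 = ip G x V V ^ 2 by rw [hlen]; ring, ← hlen]
  have h2 : (2 * ip G x V V) ≠ 0 := mul_ne_zero two_ne_zero hVV
  apply mul_left_cancel₀ h2
  rw [key]
  field_simp
  ring

end CoordGeom

/-! ### Rules for the divergence, and inner products and traces of 2-tensors. -/

namespace CoordGeom

variable {n : ℕ} {G : Coord n → Matrix (Fin n) (Fin n) ℝ} {x : Coord n}

lemma div_congr {X Y : Coord n → Fin n → ℝ} (hXY : X =ᶠ[𝓝 x] Y) : div G X x = div G Y x := by
  have e : ∀ i, pd i (fun y => X y i) x = pd i (fun y => Y y i) x := fun i =>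
    pd_congr i (hXY.mono fun y hy => congrFun hy i)
  simp only [div, e, hXY.self_of_nhds]

lemma div_add {X Y : Coord n → Fin n → ℝ} (hX : ∀ i, DifferentiableAt ℝ (fun y => X y i) x)
    (hY : ∀ i, DifferentiableAt ℝ (fun y => Y y i) x) :
    div G (fun y => X y + Y y) x = div G X x + div G Y x := by
  simp only [div, Pi.add_apply, pd_add _ (hX _) (hY _), mul_add, Finset.sum_add_distrib]
  ring

lemma div_sub {X Y : Coord n → Fin n → ℝ} (hX : ∀ i, DifferentiableAt ℝ (fun y => X y i) x)
    (hY : ∀ i, DifferentiableAt ℝ (fun y => Y y i) x) :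
    div G (fun y => X y - Y y) x = div G X x - div G Y x := by
  simp only [div, Pi.sub_apply, pd_sub _ (hX _) (hY _), mul_sub, Finset.sum_sub_distrib]
  ring

lemma div_smul {φ : Coord n → ℝ} {X : Coord n → Fin n → ℝ} (hφ : DifferentiableAt ℝ φ x)
    (hX : ∀ i, DifferentiableAt ℝ (fun y => X y i) x) :
    div G (fun y => φ y • X y) x = ∑ i, pd i φ x * X x i + φ x * div G X x := by
  simp only [div, Pi.smul_apply, smul_eq_mul, pd_mul _ hφ (hX _), Finset.sum_add_distrib, mul_add,
    Finset.mul_sum]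
  rw [add_assoc]
  congr 2
  exact Finset.sum_congr rfl fun i _ => Finset.sum_congr rfl fun j _ => by ring

/-- The inner product `g^{ia} g^{jb} A_ij B_ab` of covariant 2-tensors. -/
noncomputable def tensorInner (G : Coord n → Matrix (Fin n) (Fin n) ℝ) (x : Coord n)
    (A B : Matrix (Fin n) (Fin n) ℝ) : ℝ :=
  ∑ i, ∑ j, ∑ a, ∑ b, (G x)⁻¹ i a * (G x)⁻¹ j b * A i j * B a b

lemma normSq_eq_tensorInner (A : Matrix (Fin n) (Fin n) ℝ) : normSq G x A = tensorInner G x A A :=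
  rfl

lemma tensorInner_add_left (A B C : Matrix (Fin n) (Fin n) ℝ) :
    tensorInner G x (A + B) C = tensorInner G x A C + tensorInner G x B C := by
  simp only [tensorInner, Matrix.add_apply, mul_add, add_mul, Finset.sum_add_distrib]

lemma tensorInner_smul_left (c : ℝ) (A C : Matrix (Fin n) (Fin n) ℝ) :
    tensorInner G x (c • A) C = c * tensorInner G x A C := by
  simp only [tensorInner, Matrix.smul_apply, smul_eq_mul, Finset.mul_sum]
  exact Finset.sum_congr rfl fun i _ => Finset.sum_congr rfl fun j _ =>
    Finset.sum_congr rfl fun k _ => Finset.sum_congr rfl fun l _ => by ring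

lemma tensorInner_symm (h : MetricAt G x) (A B : Matrix (Fin n) (Fin n) ℝ) :
    tensorInner G x A B = tensorInner G x B A := by
  have e : ∀ A B, tensorInner G x A B =
      ∑ p : Fin n × Fin n, ∑ q : Fin n × Fin n,
        (G x)⁻¹ p.1 q.1 * (G x)⁻¹ p.2 q.2 * A p.1 p.2 * B q.1 q.2 := by
    intro A B
    simp only [tensorInner, Fintype.sum_prod_type]
  rw [e, e, Finset.sum_comm]
  exact Finset.sum_congr rfl fun p _ => Finset.sum_congr rfl fun q _ => by
    rw [h.inv_symm q.1, h.inv_symm q.2]; ring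

lemma tensorInner_add_right (h : MetricAt G x) (A B C : Matrix (Fin n) (Fin n) ℝ) :
    tensorInner G x C (A + B) = tensorInner G x C A + tensorInner G x C B := by
  rw [tensorInner_symm h, tensorInner_add_left, tensorInner_symm h A, tensorInner_symm h B]

lemma tensorInner_smul_right (h : MetricAt G x) (c : ℝ) (A C : Matrix (Fin n) (Fin n) ℝ) :
    tensorInner G x C (c • A) = c * tensorInner G x C A := by
  rw [tensorInner_symm h, tensorInner_smul_left, tensorInner_symm h A]

lemma raise_lower (h : MetricAt G x) (X : Fin n → ℝ) (i : Fin n) :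
    ∑ a, (G x)⁻¹ i a * lower G x X a = X i := by
  simp only [lower, Finset.mul_sum, ← mul_assoc]
  rw [Finset.sum_comm]
  simp [← Finset.sum_mul, h.sum_inv_mul]

/-- With `tensorInner_metric`, this reduces every product with the charge tensor to a value or a
trace of `A`. -/
lemma tensorInner_lower (h : MetricAt G x) (A : Matrix (Fin n) (Fin n) ℝ) (X Y : Fin n → ℝ) :
    tensorInner G x A (Matrix.of fun a b => lower G x X a * lower G x Y b) =
      ∑ i, ∑ j, A i j * X i * Y j := by
  refine Finset.sum_congr rfl fun i _ => Finset.sum_congr rfl fun j _ => ?_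
  rw [← raise_lower h X i, ← raise_lower h Y j, mul_assoc, Finset.sum_mul_sum, Finset.mul_sum]
  refine Finset.sum_congr rfl fun a _ => ?_
  rw [Finset.mul_sum]
  exact Finset.sum_congr rfl fun b _ => by rw [Matrix.of_apply]; ring

lemma tensorInner_metric (h : MetricAt G x) (A : Matrix (Fin n) (Fin n) ℝ) :
    tensorInner G x A (G x) = trace G x A := by
  refine Finset.sum_congr rfl fun i _ => Finset.sum_congr rfl fun j _ => ?_
  calc _ = A i j * ∑ b, (G x)⁻¹ j b * ∑ a, (G x)⁻¹ i a * G x a b := by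
        rw [Finset.sum_comm]
        simp only [Finset.mul_sum]
        exact Finset.sum_congr rfl fun b _ => Finset.sum_congr rfl fun a _ => by ring
    _ = _ := by
        simp only [h.sum_inv_mul]
        simp [h.inv_symm j i, mul_comm]

lemma trace_add (A B : Matrix (Fin n) (Fin n) ℝ) :
    trace G x (A + B) = trace G x A + trace G x B := by
  simp only [trace, Matrix.add_apply, mul_add, Finset.sum_add_distrib]

lemma trace_smul (c : ℝ) (A : Matrix (Fin n) (Fin n) ℝ) :
    trace G x (c • A) = c * trace G x A := by
  simp only [trace, Matrix.smul_apply, smul_eq_mul, Finset.mul_sum]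
  exact Finset.sum_congr rfl fun i _ => Finset.sum_congr rfl fun j _ => by ring

lemma trace_lower (h : MetricAt G x) (X Y : Fin n → ℝ) :
    trace G x (Matrix.of fun a b => lower G x X a * lower G x Y b) = ip G x X Y := by
  simp only [trace, Matrix.of_apply]
  calc _ = ∑ j, (∑ i, (G x)⁻¹ j i * lower G x X i) * lower G x Y j := by
        rw [Finset.sum_comm]
        simp only [Finset.sum_mul]
        exact Finset.sum_congr rfl fun i _ => Finset.sum_congr rfl fun j _ => by
          rw [h.inv_symm i j]; ring
    _ = _ := by
        simp only [raise_lower h]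
        simp only [ip, lower, Finset.mul_sum]
        exact Finset.sum_congr rfl fun i _ => Finset.sum_congr rfl fun j _ => by ring

lemma trace_metric {G : Coord 3 → Matrix (Fin 3) (Fin 3) ℝ} {x : Coord 3} (h : MetricAt G x) :
    trace G x (G x) = 3 := by
  have : ∀ i, ∑ j, (G x)⁻¹ i j * G x i j = 1 := fun i => by
    have := h.sum_inv_mul i i
    simpa [h.symm _ i] using this
  simp [trace, this]

end CoordGeom

/-! ### Regularity of the coordinate data and the algebra of the charge tensor. -/

namespace CoordData

open CoordGeom

variable {D : CoordData} {y : Coord 3}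

/-- The regularity and symmetry of the coordinate expressions of an initial data set, a `C¹`
vector field and two `C³` functions. -/
structure RegularAt (D : CoordData) (y : Coord 3) : Prop where
  metric : MetricAt D.g y
  k_contDiffAt : ∀ i j, ContDiffAt ℝ 1 (fun z => D.k z i j) y
  k_symm : ∀ᶠ z in 𝓝 y, ∀ i j, D.k z i j = D.k z j i
  E_contDiffAt : ∀ i, ContDiffAt ℝ 1 (fun z => D.E z i) y
  u_contDiffAt : ContDiffAt ℝ 3 D.u y
  v_contDiffAt : ContDiffAt ℝ 3 D.v y

lemma chargeTensor_eq (D : CoordData) (y : Coord 3) :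
    D.chargeTensor y =
      D.xi y • (Matrix.of fun a b => lower D.g y (D.eta y) a * lower D.g y (D.E y) b)
      + D.xi y • (Matrix.of fun a b => lower D.g y (D.E y) a * lower D.g y (D.eta y) b)
      + (-(D.xi y * D.Eeta y)) • D.g y := by
  ext i j
  simp only [chargeTensor, Matrix.add_apply, Matrix.smul_apply, Matrix.of_apply, smul_eq_mul]
  ring

lemma tensorInner_chargeTensor (h : MetricAt D.g y) {A : Matrix (Fin 3) (Fin 3) ℝ}
    (hA : ∀ i j, A i j = A j i) :
    tensorInner D.g y A (D.chargeTensor y) =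
      2 * D.xi y * (∑ i, ∑ j, A i j * D.E y i * D.eta y j)
        - D.xi y * D.Eeta y * trace D.g y A := by
  have e : ∑ i, ∑ j, A i j * D.eta y i * D.E y j = ∑ i, ∑ j, A i j * D.E y i * D.eta y j := by
    rw [Finset.sum_comm]
    exact Finset.sum_congr rfl fun i _ => Finset.sum_congr rfl fun j _ => by rw [hA j i]; ring
  rw [chargeTensor_eq, tensorInner_add_right h, tensorInner_add_right h, tensorInner_smul_right h,
    tensorInner_smul_right h, tensorInner_smul_right h, tensorInner_lower h, tensorInner_lower h,
    tensorInner_metric h, e]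
  ring

lemma chargeTensor_symm (h : MetricAt D.g y) (i j : Fin 3) :
    D.chargeTensor y i j = D.chargeTensor y j i := by
  simp only [chargeTensor, h.symm j i]; ring

lemma trace_chargeTensor (h : MetricAt D.g y) :
    trace D.g y (D.chargeTensor y) = -(D.xi y * D.Eeta y) := by
  rw [chargeTensor_eq, trace_add, trace_add, trace_smul, trace_smul, trace_smul, trace_lower h,
    trace_lower h, trace_metric h, ip_symm h (D.eta y), ← Eeta]
  ring

/-- Pair the charge tensor C with itself by `tensorInner_chargeTensor`: the unit length of η gives
C(E, η) = ξ|E|², and tr C = -ξE_η. -/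
lemma normSq_chargeTensor (h : MetricAt D.g y) (hη : ip D.g y (D.eta y) (D.eta y) = 1) :
    normSq D.g y (D.chargeTensor y) =
      D.xi y ^ 2 * (2 * D.normSqE y + D.Eeta y ^ 2) := by
  have e : ∑ i, ∑ j, D.chargeTensor y i j * D.E y i * D.eta y j =
      D.xi y * D.normSqE y := by
    have e1 : ∀ X : Fin 3 → ℝ, ∑ i, lower D.g y X i * D.E y i = ip D.g y (D.E y) X := by
      intro X
      simp only [lower, ip, Finset.sum_mul]
      exact Finset.sum_congr rfl fun i _ => Finset.sum_congr rfl fun j _ => by ring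
    have e2 : ∀ X : Fin 3 → ℝ, ∑ i, lower D.g y X i * D.eta y i = ip D.g y (D.eta y) X := by
      intro X
      simp only [lower, ip, Finset.sum_mul]
      exact Finset.sum_congr rfl fun i _ => Finset.sum_congr rfl fun j _ => by ring
    calc _ = D.xi y * ((∑ i, lower D.g y (D.eta y) i * D.E y i)
            * (∑ i, lower D.g y (D.E y) i * D.eta y i)
          + (∑ i, lower D.g y (D.E y) i * D.E y i) * (∑ i, lower D.g y (D.eta y) i * D.eta y i)
          - D.Eeta y * ip D.g y (D.E y) (D.eta y)) := by
          simp only [chargeTensor, ip, Fin.sum_univ_three]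
          ring
      _ = _ := by
          rw [e1, e1, e2, e2, hη, ip_symm h (D.eta y) (D.E y), ← Eeta, ← normSqE]
          ring
  rw [normSq_eq_tensorInner, tensorInner_chargeTensor h (chargeTensor_symm h),
    trace_chargeTensor h, e]
  ring

end CoordData

/-! ### Unit normals, the coefficient of E, and the divergence of the uncharged part of Z. -/

namespace CoordData

open CoordGeom

variable {D : CoordData} {y : Coord 3}

lemma RegularAt.eventually (h : D.RegularAt y) : ∀ᶠ z in 𝓝 y, D.RegularAt z := by
  have h1 : ∀ᶠ z in 𝓝 y, ∀ i j, ContDiffAt ℝ 1 (fun z => D.k z i j) z := by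
    simp only [Filter.eventually_all]
    exact fun i j => (h.k_contDiffAt i j).eventually (by simp)
  have h2 : ∀ᶠ z in 𝓝 y, ∀ i, ContDiffAt ℝ 1 (fun z => D.E z i) z := by
    simp only [Filter.eventually_all]
    exact fun i => (h.E_contDiffAt i).eventually (by simp)
  filter_upwards [h1, h2, h.metric.eventually, h.k_symm.eventually_nhds,
    h.u_contDiffAt.eventually (by simp), h.v_contDiffAt.eventually (by simp)]
    with z z1 z2 z3 z4 z5 z6 using ⟨z3, z1, z4, z2, z5, z6⟩

section Algebra

lemma gradU_eq (h0 : D.lenU y ≠ 0) : D.gradU y = D.lenU y • D.nuU y := by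
  rw [nuU, smul_inv_smul₀ h0]

lemma gradV_eq (h0 : D.lenV y ≠ 0) : D.gradV y = D.lenV y • D.nuV y := by
  rw [nuV, smul_inv_smul₀ h0]

lemma ip_nuU (h : MetricAt D.g y) (h0 : D.lenU y ≠ 0) : ip D.g y (D.nuU y) (D.nuU y) = 1 := by
  have h1 : D.lenU y ^ 2 = ip D.g y (D.gradU y) (D.gradU y) := len_sq h _
  rw [nuU, ip_smul_left, ip_smul_right, ← h1]
  field_simp

lemma ip_nuV (h : MetricAt D.g y) (h0 : D.lenV y ≠ 0) : ip D.g y (D.nuV y) (D.nuV y) = 1 := by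
  have h1 : D.lenV y ^ 2 = ip D.g y (D.gradV y) (D.gradV y) := len_sq h _
  rw [nuV, ip_smul_left, ip_smul_right, ← h1]
  field_simp

/-- The length `|ν_u + ν_v|`. -/
noncomputable def lenNu (D : CoordData) (y : Coord 3) : ℝ := len D.g y (D.nuU y + D.nuV y)

lemma lenNu_sq (h : MetricAt D.g y) (hu : D.lenU y ≠ 0) (hv : D.lenV y ≠ 0) :
    D.lenNu y ^ 2 = 2 + 2 * ip D.g y (D.nuU y) (D.nuV y) := by
  rw [lenNu, len_sq h, ip_add_add h, ip_nuU h hu, ip_nuV h hv]; ring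

lemma lenNu_ne_zero_iff (h : MetricAt D.g y) : D.lenNu y ≠ 0 ↔ D.nuU y ≠ -D.nuV y := by
  rw [not_iff_not, ← add_eq_zero_iff_eq_neg]
  constructor
  · intro h0
    by_contra hc
    have := ip_self_pos h hc
    rw [← len_sq h, ← lenNu, h0] at this
    simp at this
  · intro h0
    rw [lenNu, h0]
    simp [len, ip]

/-- Both sides vanish where ν_u = -ν_v, so formulas in |ν_u + ν_v| η need no case distinction. -/
lemma lenNu_smul_eta (h : MetricAt D.g y) : D.lenNu y • D.eta y = D.nuU y + D.nuV y := by
  by_cases hn : D.nuU y ≠ -D.nuV y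
  · rw [eta, if_pos hn, ← lenNu, smul_inv_smul₀ ((lenNu_ne_zero_iff h).2 hn)]
  · rw [eta, if_neg hn, smul_zero, eq_comm, add_eq_zero_iff_eq_neg]
    exact not_not.1 hn

lemma ip_eta_eta (h : MetricAt D.g y) (hn : D.nuU y ≠ -D.nuV y) :
    ip D.g y (D.eta y) (D.eta y) = 1 := by
  have h0 := (lenNu_ne_zero_iff h).2 hn
  have h1 : ip D.g y (D.lenNu y • D.eta y) (D.lenNu y • D.eta y) = D.lenNu y ^ 2 := by
    rw [lenNu_smul_eta h, lenNu, len_sq h]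
  rw [ip_smul_left, ip_smul_right] at h1
  have h2 : D.lenNu y ^ 2 ≠ 0 := pow_ne_zero 2 h0
  apply mul_left_cancel₀ h2
  linear_combination h1

lemma lenU_pos (h0 : D.lenU y ≠ 0) : 0 < D.lenU y := (len_nonneg _).lt_of_ne' h0

lemma lenV_pos (h0 : D.lenV y ≠ 0) : 0 < D.lenV y := (len_nonneg _).lt_of_ne' h0

lemma xi_sq (D : CoordData) (y : Coord 3) : D.xi y ^ 2 = D.lenU y * D.lenV y :=
  Real.sq_sqrt (mul_nonneg (len_nonneg _) (len_nonneg _))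

lemma xi_pos (hu : D.lenU y ≠ 0) (hv : D.lenV y ≠ 0) : 0 < D.xi y :=
  Real.sqrt_pos.2 (mul_pos (lenU_pos hu) (lenV_pos hv))

/-- The coefficient `ξ⁻¹ (|∇u| ∇_η v + |∇v| ∇_η u)` is `ξ |ν_u + ν_v|`. -/
lemma chargeCoeff_eq (h : MetricAt D.g y) (hu : D.lenU y ≠ 0) (hv : D.lenV y ≠ 0) :
    (D.xi y)⁻¹ * (D.lenU y * ip D.g y (D.gradV y) (D.eta y)
      + D.lenV y * ip D.g y (D.gradU y) (D.eta y)) = D.xi y * D.lenNu y := by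
  have hx := (xi_pos hu hv).ne'
  -- By bilinearity this is ⟨ν_u + ν_v, η⟩. At antipodal normals both sides are 0, thanks to the
  -- convention η = 0.
  have e : ip D.g y (D.nuU y) (D.eta y) + ip D.g y (D.nuV y) (D.eta y) = D.lenNu y := by
    rw [← ip_add_left, ← lenNu_smul_eta h, ip_smul_left]
    by_cases hn : D.nuU y ≠ -D.nuV y
    · rw [ip_eta_eta h hn, mul_one]
    · have : D.lenNu y = 0 := by
        by_contra h0
        exact hn ((lenNu_ne_zero_iff h).1 h0)
      rw [this, zero_mul]
  rw [gradU_eq hu, gradV_eq hv, ip_smul_left, ip_smul_left, inv_mul_eq_iff_eq_mul₀ hx,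
    ← mul_assoc (D.xi y), ← pow_two, xi_sq, ← e]
  ring

/-- `(ξ |ν_u + ν_v|)² = 2 (|∇u| |∇v| + ⟨∇u, ∇v⟩)`. -/
lemma xi_mul_lenNu_sq (h : MetricAt D.g y) (hu : D.lenU y ≠ 0) (hv : D.lenV y ≠ 0) :
    (D.xi y * D.lenNu y) ^ 2 =
      2 * (D.lenU y * D.lenV y + ip D.g y (D.gradU y) (D.gradV y)) := by
  rw [mul_pow, xi_sq, lenNu_sq h hu hv, gradU_eq hu, gradV_eq hv, ip_smul_left, ip_smul_right]
  ring

end Algebra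

section Calculus

lemma RegularAt.u2 (h : D.RegularAt y) : ContDiffAt ℝ 2 D.u y := h.u_contDiffAt.of_le (by norm_num)

lemma RegularAt.v2 (h : D.RegularAt y) : ContDiffAt ℝ 2 D.v y := h.v_contDiffAt.of_le (by norm_num)

lemma differentiableAt_lenU (h : D.RegularAt y) (hu : D.lenU y ≠ 0) :
    DifferentiableAt ℝ D.lenU y :=
  differentiableAt_len_grad h.metric h.u2 hu

lemma differentiableAt_lenV (h : D.RegularAt y) (hv : D.lenV y ≠ 0) :
    DifferentiableAt ℝ D.lenV y :=
  differentiableAt_len_grad h.metric h.v2 hv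

lemma eventually_nonzero (h : D.RegularAt y) (hu : D.lenU y ≠ 0) (hv : D.lenV y ≠ 0) :
    ∀ᶠ z in 𝓝 y, D.RegularAt z ∧ D.lenU z ≠ 0 ∧ D.lenV z ≠ 0 :=
  h.eventually.and
    (((differentiableAt_lenU h hu).continuousAt.eventually_ne hu).and
      ((differentiableAt_lenV h hv).continuousAt.eventually_ne hv))

lemma differentiableAt_trk (h : D.RegularAt y) : DifferentiableAt ℝ D.trk y :=
  differentiableAt_trace h.metric fun i j => (h.k_contDiffAt i j).differentiableAt (by norm_num)

/-- The tensor `k - tr_g(k) g`. -/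
noncomputable def momentum (D : CoordData) (y : Coord 3) : Matrix (Fin 3) (Fin 3) ℝ :=
  D.k y - D.trk y • D.g y

lemma differentiableAt_momentum (h : D.RegularAt y) (i j : Fin 3) :
    DifferentiableAt ℝ (fun z => D.momentum z i j) y :=
  ((h.k_contDiffAt i j).differentiableAt (by norm_num)).fun_sub
    ((differentiableAt_trk h).fun_mul (h.metric.differentiableAt i j))

lemma contract_momentum (h : D.RegularAt y) (X : Fin 3 → ℝ) :
    contract D.g y (D.momentum y) X = D.kVec y X - D.trk y • X := by
  have e : ∀ i, ∑ j, ∑ m, (D.g y)⁻¹ i j * D.g y j m * X m = X i := by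
    intro i
    rw [Finset.sum_comm]
    simp [← Finset.sum_mul, h.metric.sum_inv_mul]
  ext i
  rw [Pi.sub_apply, Pi.smul_apply, smul_eq_mul, ← e i]
  simp only [contract, kVec, raise, momentum, Matrix.sub_apply, Matrix.smul_apply, smul_eq_mul,
    Finset.mul_sum, ← Finset.sum_sub_distrib]
  refine Finset.sum_congr rfl fun j _ => Finset.sum_congr rfl fun m _ => ?_
  rw [h.k_symm.self_of_nhds m j]
  ring

/-- The product rule: the divergence of the momentum tensor is `J` by definition, and the other term
pairs k - tr(k) g with ∇²f. -/
lemma div_contract_momentum (h : D.RegularAt y) {f : Coord 3 → ℝ} (hf : ContDiffAt ℝ 2 f y) :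
    div D.g (fun z => contract D.g z (D.momentum z) (grad D.g f z)) y =
      D.pairJ y (grad D.g f y) + tensorInner D.g y (hess D.g f y) (D.k y)
        - D.trk y * laplacian D.g f y := by
  rw [div_contract h.metric (differentiableAt_momentum h) (differentiableAt_grad h.metric hf),
    add_sub_assoc]
  simp only [covDeriv_grad h.metric hf]
  have e1 := sum_contract_sub_smul_metric h.metric (D.k y) (Matrix.of fun i m =>
    ∑ j, (D.g y)⁻¹ m j * hess D.g f y i j) (D.trk y)
  simp only [Matrix.of_apply] at e1
  rw [momentum, e1, tensorInner_symm h.metric]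
  congr 1
  congr 1
  simp only [tensorInner, Fin.sum_univ_three]
  rw [h.metric.inv_symm 1 0, h.metric.inv_symm 2 0, h.metric.inv_symm 2 1,
    hess_symm h.metric hf 1 0, hess_symm h.metric hf 2 0, hess_symm h.metric hf 2 1]
  ring

/-- The vector field `∇|∇f| - Δf ∇f/|∇f|` in divergence-free form. -/
noncomputable def levelField (G : Coord 3 → Matrix (Fin 3) (Fin 3) ℝ) (f : Coord 3 → ℝ)
    (y : Coord 3) : Fin 3 → ℝ :=
  contract G y (hess G f y - laplacian G f y • G y) (normal G f y)

lemma differentiableAt_levelField {G : Coord 3 → Matrix (Fin 3) (Fin 3) ℝ} {f : Coord 3 → ℝ}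
    (h : MetricAt G y) (hf : ContDiffAt ℝ 3 f y) (h0 : len G y (grad G f y) ≠ 0) (i : Fin 3) :
    DifferentiableAt ℝ (fun z => levelField G f z i) y :=
  differentiableAt_contract h (T := fun z => hess G f z - laplacian G f z • G z)
    (fun i j => (differentiableAt_hess h hf i j).fun_sub
      ((differentiableAt_laplacian h hf).fun_mul (h.differentiableAt i j)))
    (differentiableAt_normal h (hf.of_le (by norm_num)) h0) i

/-- The part of `Z` not containing `E`. -/
noncomputable def neutralZ (D : CoordData) (y : Coord 3) : Fin 3 → ℝ :=
  levelField D.g D.u y + levelField D.g D.v y + contract D.g y (D.momentum y) (D.gradU y)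
    - contract D.g y (D.momentum y) (D.gradV y)

/-- Isolates the only part of Z that may fail to be differentiable, the multiple of `E`. -/
lemma Z_eq (h : D.RegularAt y) (hu : D.lenU y ≠ 0) (hv : D.lenV y ≠ 0) :
    D.Z y = D.neutralZ y + (2 * (D.xi y * D.lenNu y)) • D.E y := by
  have e1 : levelField D.g D.u y = _ := (grad_len_sub_eq_contract h.metric h.u2 hu).symm
  have e2 : levelField D.g D.v y = _ := (grad_len_sub_eq_contract h.metric h.v2 hv).symm
  rw [neutralZ, e1, e2, contract_momentum h, contract_momentum h, ← chargeCoeff_eq h.metric hu hv, Z,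
    mul_assoc 2]
  change _ = grad D.g D.lenU y - laplacian D.g D.u y • D.nuU y
    + (grad D.g D.lenV y - laplacian D.g D.v y • D.nuV y) + _ - _ + _
  abel

lemma Z_eventuallyEq (h : D.RegularAt y) (hu : D.lenU y ≠ 0) (hv : D.lenV y ≠ 0) :
    D.Z =ᶠ[𝓝 y] fun z => D.neutralZ z + (2 * (D.xi z * D.lenNu z)) • D.E z := by
  filter_upwards [eventually_nonzero h hu hv] with z hz using Z_eq hz.1 hz.2.1 hz.2.2

lemma differentiableAt_contract_momentum (h : D.RegularAt y) {f : Coord 3 → ℝ}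
    (hf : ContDiffAt ℝ 2 f y) (i : Fin 3) :
    DifferentiableAt ℝ (fun z => contract D.g z (D.momentum z) (grad D.g f z) i) y :=
  differentiableAt_contract h.metric (differentiableAt_momentum h)
    (differentiableAt_grad h.metric hf) i

lemma differentiableAt_neutralZ (h : D.RegularAt y) (hu : D.lenU y ≠ 0) (hv : D.lenV y ≠ 0)
    (i : Fin 3) : DifferentiableAt ℝ (fun z => D.neutralZ z i) y :=
  (((differentiableAt_levelField h.metric h.u_contDiffAt hu i).fun_add
    (differentiableAt_levelField h.metric h.v_contDiffAt hv i)).fun_add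
    (differentiableAt_contract_momentum h h.u2 i)).fun_sub
    (differentiableAt_contract_momentum h h.v2 i)

lemma div_neutralZ (h : D.RegularAt y) (hu : D.lenU y ≠ 0) (hv : D.lenV y ≠ 0) :
    div D.g D.neutralZ y =
      (1 / (2 * D.lenU y) * (normSq D.g y (hess D.g D.u y)
        + D.lenU y ^ 2 * (scalarCurv D.g y - 2 * levelSetCurv D.g D.u y)
        - laplacian D.g D.u y ^ 2)
      + (D.pairJ y (D.gradU y) + tensorInner D.g y (hess D.g D.u y) (D.k y)
        - D.trk y * laplacian D.g D.u y))
      + (1 / (2 * D.lenV y) * (normSq D.g y (hess D.g D.v y)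
        + D.lenV y ^ 2 * (scalarCurv D.g y - 2 * levelSetCurv D.g D.v y)
        - laplacian D.g D.v y ^ 2)
      - (D.pairJ y (D.gradV y) + tensorInner D.g y (hess D.g D.v y) (D.k y)
        - D.trk y * laplacian D.g D.v y)) := by
  have d1 := differentiableAt_levelField h.metric h.u_contDiffAt hu
  have d2 := differentiableAt_levelField h.metric h.v_contDiffAt hv
  have d3 := differentiableAt_contract_momentum h h.u2
  have d4 := differentiableAt_contract_momentum h h.v2
  have e1 := div_grad_len_sub h.metric h.u_contDiffAt hu
  have e2 := div_grad_len_sub h.metric h.v_contDiffAt hv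
  have e3 := div_contract_momentum h h.u2
  have e4 := div_contract_momentum h h.v2
  have e : div D.g D.neutralZ y = div D.g (levelField D.g D.u) y + div D.g (levelField D.g D.v) y
      + div D.g (fun z => contract D.g z (D.momentum z) (grad D.g D.u z)) y
      - div D.g (fun z => contract D.g z (D.momentum z) (grad D.g D.v z)) y := by
    rw [← div_add d1 d2, ← div_add (X := fun z => levelField D.g D.u z + levelField D.g D.v z)
      (fun i => (d1 i).fun_add (d2 i)) d3, ← div_sub (X := fun z => levelField D.g D.u z
        + levelField D.g D.v z + contract D.g z (D.momentum z) (grad D.g D.u z))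
      (fun i => ((d1 i).fun_add (d2 i)).fun_add (d3 i)) d4]
    rfl
  rw [e, e3, e4]
  change div D.g (levelField D.g D.u) y = _ at e1
  change div D.g (levelField D.g D.v) y = _ at e2
  rw [e1, e2]
  simp only [lenU, lenV, gradU, gradV]
  ring

end Calculus

end CoordData

/-! ### The charge part of Z and the divergence identities in coordinates. -/

namespace CoordData

open CoordGeom

variable {D : CoordData} {y : Coord 3}

lemma differentiableAt_E (h : D.RegularAt y) (i : Fin 3) :
    DifferentiableAt ℝ (fun z => D.E z i) y :=
  (h.E_contDiffAt i).differentiableAt (by norm_num)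

/-- The function `|∇u| |∇v| + ⟨∇u, ∇v⟩`. -/
noncomputable def pairUV (D : CoordData) (y : Coord 3) : ℝ :=
  D.lenU y * D.lenV y + ip D.g y (D.gradU y) (D.gradV y)

lemma differentiableAt_pairUV (h : D.RegularAt y) (hu : D.lenU y ≠ 0) (hv : D.lenV y ≠ 0) :
    DifferentiableAt ℝ D.pairUV y :=
  ((differentiableAt_lenU h hu).fun_mul (differentiableAt_lenV h hv)).fun_add
    (differentiableAt_ip h.metric (differentiableAt_grad h.metric h.u2)
      (differentiableAt_grad h.metric h.v2))

/-- In the product rule ∇²u is applied to |∇v|ν_u + ∇v = |∇v|(ν_u + ν_v), and symmetrically for v;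
this is where η appears. The formula remains valid at antipodal normals. -/
lemma pd_pairUV (h : D.RegularAt y) (hu : D.lenU y ≠ 0) (hv : D.lenV y ≠ 0) (i : Fin 3) :
    pd i D.pairUV y = D.lenNu y *
      (D.lenV y * ∑ j, hess D.g D.u y i j * D.eta y j
        + D.lenU y * ∑ j, hess D.g D.v y i j * D.eta y j) := by
  have d1 := differentiableAt_grad h.metric h.u2
  have d2 := differentiableAt_grad h.metric h.v2
  have e1 : pd i D.lenU y = (D.lenU y)⁻¹ * ∑ j, hess D.g D.u y i j * D.gradU y j :=
    pd_len_grad h.metric h.u2 hu i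
  have e2 : pd i D.lenV y = (D.lenV y)⁻¹ * ∑ j, hess D.g D.v y i j * D.gradV y j :=
    pd_len_grad h.metric h.v2 hv i
  have e3 : pd i (fun z => ip D.g z (D.gradU z) (D.gradV z)) y =
      ∑ j, hess D.g D.u y i j * D.gradV y j + ∑ j, hess D.g D.v y i j * D.gradU y j := by
    have e := pd_ip h.metric d1 d2 i
    rw [ip_covDeriv_grad h.metric h.u2, ip_symm h.metric (grad D.g D.u y),
      ip_covDeriv_grad h.metric h.v2] at e
    exact e
  have e4 : ∀ j, D.lenNu y * D.eta y j = D.nuU y j + D.nuV y j :=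
    fun j => congrFun (lenNu_smul_eta h.metric) j
  have e5 : ∀ A : Fin 3 → ℝ, D.lenNu y * ∑ j, A j * D.eta y j =
      ∑ j, A j * D.nuU y j + ∑ j, A j * D.nuV y j := by
    intro A
    rw [Finset.mul_sum, ← Finset.sum_add_distrib]
    exact Finset.sum_congr rfl fun j _ => by rw [← mul_add, ← e4]; ring
  have e6 : ∀ A : Fin 3 → ℝ, ∑ j, A j * D.gradU y j = D.lenU y * ∑ j, A j * D.nuU y j := by
    intro A
    rw [gradU_eq hu, Finset.mul_sum]
    exact Finset.sum_congr rfl fun j _ => by rw [Pi.smul_apply, smul_eq_mul]; ring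
  have e7 : ∀ A : Fin 3 → ℝ, ∑ j, A j * D.gradV y j = D.lenV y * ∑ j, A j * D.nuV y j := by
    intro A
    rw [gradV_eq hv, Finset.mul_sum]
    exact Finset.sum_congr rfl fun j _ => by rw [Pi.smul_apply, smul_eq_mul]; ring
  unfold pairUV
  rw [pd_add i ((differentiableAt_lenU h hu).fun_mul (differentiableAt_lenV h hv))
    (differentiableAt_ip h.metric (X := D.gradU) (Y := D.gradV) d1 d2), pd_mul i (differentiableAt_lenU h hu)
    (differentiableAt_lenV h hv), e1, e2, e3, mul_add,
    mul_left_comm (D.lenNu y) (D.lenV y), e5, mul_left_comm (D.lenNu y) (D.lenU y), e5, e6, e7, e6, e7]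
  field_simp
  ring

lemma xi_mul_lenNu_eventuallyEq (h : D.RegularAt y) (hu : D.lenU y ≠ 0) (hv : D.lenV y ≠ 0) :
    (fun z => (D.xi z * D.lenNu z) ^ 2) =ᶠ[𝓝 y] fun z => 2 * D.pairUV z := by
  filter_upwards [eventually_nonzero h hu hv] with z hz using
    xi_mul_lenNu_sq hz.1.metric hz.2.1 hz.2.2

lemma xi_mul_lenNu_nonneg (D : CoordData) (y : Coord 3) : 0 ≤ D.xi y * D.lenNu y :=
  mul_nonneg (Real.sqrt_nonneg _) (len_nonneg _)

lemma xi_mul_lenNu_eventuallyEq_sqrt (h : D.RegularAt y) (hu : D.lenU y ≠ 0)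
    (hv : D.lenV y ≠ 0) : (fun z => D.xi z * D.lenNu z) =ᶠ[𝓝 y] fun z => √(2 * D.pairUV z) := by
  filter_upwards [xi_mul_lenNu_eventuallyEq h hu hv] with z hz
  rw [← hz, Real.sqrt_sq (xi_mul_lenNu_nonneg D z)]

lemma differentiableAt_xi_mul_lenNu (h : D.RegularAt y) (hu : D.lenU y ≠ 0) (hv : D.lenV y ≠ 0)
    (hn : D.nuU y ≠ -D.nuV y) : DifferentiableAt ℝ (fun z => D.xi z * D.lenNu z) y := by
  refine (xi_mul_lenNu_eventuallyEq_sqrt h hu hv).differentiableAt_iff.2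
    (((differentiableAt_pairUV h hu hv).const_mul 2).sqrt ?_)
  have e : (D.xi y * D.lenNu y) ^ 2 = 2 * D.pairUV y := xi_mul_lenNu_sq h.metric hu hv
  rw [← e]
  exact pow_ne_zero 2 (mul_ne_zero (xi_pos hu hv).ne' ((lenNu_ne_zero_iff h.metric).2 hn))

/-- Differentiating φ² = 2 `pairUV` for φ = ξ|ν_u + ν_v| gives a factor |ν_u + ν_v| on each side,
which cancels because it is nonzero. -/
lemma pd_xi_mul_lenNu (h : D.RegularAt y) (hu : D.lenU y ≠ 0) (hv : D.lenV y ≠ 0)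
    (hn : D.nuU y ≠ -D.nuV y) (i : Fin 3) :
    pd i (fun z => D.xi z * D.lenNu z) y = (D.xi y)⁻¹ *
      (D.lenV y * ∑ j, hess D.g D.u y i j * D.eta y j
        + D.lenU y * ∑ j, hess D.g D.v y i j * D.eta y j) := by
  have h1 := pd_congr i (xi_mul_lenNu_eventuallyEq h hu hv)
  have hx := (xi_pos hu hv).ne'
  have hl := (lenNu_ne_zero_iff h.metric).2 hn
  rw [pd_sq i (differentiableAt_xi_mul_lenNu h hu hv hn),
    pd_const_mul i _ (differentiableAt_pairUV h hu hv), pd_pairUV h hu hv] at h1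
  rw [eq_inv_mul_iff_mul_eq₀ hx]
  apply mul_left_cancel₀ hl
  linear_combination h1 / 2

/-- The divergence of the charge part of `Z` where `ν_u ≠ -ν_v`. -/
lemma div_charge (h : D.RegularAt y) (hu : D.lenU y ≠ 0) (hv : D.lenV y ≠ 0)
    (hn : D.nuU y ≠ -D.nuV y) (hE : div D.g D.E y = 0) :
    div D.g (fun z => (2 * (D.xi z * D.lenNu z)) • D.E z) y = 2 * (D.xi y)⁻¹ *
      (D.lenV y * (∑ i, ∑ j, hess D.g D.u y i j * D.E y i * D.eta y j)
        + D.lenU y * ∑ i, ∑ j, hess D.g D.v y i j * D.E y i * D.eta y j) := by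
  have hd := differentiableAt_xi_mul_lenNu h hu hv hn
  rw [div_smul (φ := fun z => 2 * (D.xi z * D.lenNu z)) (hd.const_mul 2) (differentiableAt_E h),
    hE, mul_zero, add_zero]
  simp only [pd_const_mul _ 2 hd, pd_xi_mul_lenNu h hu hv hn, Fin.sum_univ_three]
  ring

/-- A differentiable vector field of the form `φ E`, with `φ ≥ 0` vanishing at `y`, has zero
derivative at `y`. -/
lemma pd_eq_zero_of_nonneg_mul {φ e : Coord 3 → ℝ} (h0 : ∀ z, 0 ≤ φ z) (hy : φ y = 0)
    (hφ : ContinuousAt φ y) (he : DifferentiableAt ℝ e y)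
    (i : Fin 3) : pd i (fun z => φ z * e z) y = 0 := by
  -- If `e y ≠ 0`, the product has a fixed sign near `y` and an extremum at `y`. Its `fderiv` is
  -- then 0 even without differentiability, by the default value. If `e y = 0`, the product is o(1)
  -- · O(z - y).
  rcases lt_trichotomy (e y) 0 with hneg | hzero | hpos
  · have hm : IsLocalMax (fun z => φ z * e z) y := by
      filter_upwards [he.continuousAt.eventually (gt_mem_nhds hneg)] with z hz
      rw [hy, zero_mul]
      exact mul_nonpos_of_nonneg_of_nonpos (h0 z) (le_of_lt hz)
    rw [pd, hm.fderiv_eq_zero]; rfl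
  · have h1 : HasFDerivAt (fun z => φ z * e z) (0 : Coord 3 →L[ℝ] ℝ) y := by
      rw [hasFDerivAt_iff_isLittleO]
      have h2 : (fun z => e z) =O[𝓝 y] fun z => z - y := by
        have := he.isBigO_sub
        simpa only [hzero, sub_zero] using this
      have h3 : φ =o[𝓝 y] fun _ => (1 : ℝ) := by
        rw [Asymptotics.isLittleO_one_iff]
        simpa only [ContinuousAt, hy] using hφ
      have h4 := h3.mul_isBigO h2.norm_right
      refine (Asymptotics.isLittleO_norm_right.1 ?_)
      simpa [hy] using h4
    rw [pd, h1.fderiv]; rfl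
  · have hm : IsLocalMin (fun z => φ z * e z) y := by
      filter_upwards [he.continuousAt.eventually (lt_mem_nhds hpos)] with z hz
      rw [hy, zero_mul]
      exact mul_nonneg (h0 z) (le_of_lt hz)
    rw [pd, hm.fderiv_eq_zero]; rfl

/-- The coefficient of `E` is nonnegative, continuous and zero at `y`, so neither the derivative
terms nor the Christoffel terms contribute. -/
lemma div_charge_of_eq (h : D.RegularAt y) (hu : D.lenU y ≠ 0) (hv : D.lenV y ≠ 0)
    (hn : D.nuU y = -D.nuV y) :
    div D.g (fun z => (2 * (D.xi z * D.lenNu z)) • D.E z) y = 0 := by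
  have hl : D.lenNu y = 0 := by
    by_contra hc
    exact (lenNu_ne_zero_iff h.metric).1 hc hn
  have hc : ContinuousAt (fun z => 2 * (D.xi z * D.lenNu z)) y :=
    continuousAt_const.mul ((continuousAt_congr (xi_mul_lenNu_eventuallyEq_sqrt h hu hv)).2
      ((differentiableAt_pairUV h hu hv).const_mul 2).continuousAt.sqrt)
  have e : ∀ i, pd i (fun z => ((2 * (D.xi z * D.lenNu z)) • D.E z) i) y = 0 := fun i =>
    pd_eq_zero_of_nonneg_mul (fun z => mul_nonneg zero_le_two (xi_mul_lenNu_nonneg D z))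
      (by rw [hl, mul_zero, mul_zero]) hc (differentiableAt_E h i) i
  simp only [div, e, hl, mul_zero, zero_smul, Pi.zero_apply, Finset.sum_const_zero, add_zero]

/-- In this expansion the ∇²u(E, η) term is matched by `div_charge`. The last bracket, divided by
2|∇u|, is opposite to the one in `normSq_hessMinus` divided by 2|∇v|. -/
lemma normSq_hessPlus (h : D.RegularAt y) (hn : D.nuU y ≠ -D.nuV y) :
    normSq D.g y (D.hessPlus y) = normSq D.g y (hess D.g D.u y)
      + D.xi y ^ 2 * (2 * D.normSqE y + D.Eeta y ^ 2)
      + D.lenU y ^ 2 * normSq D.g y (D.k y)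
      + 2 * (2 * D.xi y * (∑ i, ∑ j, hess D.g D.u y i j * D.E y i * D.eta y j)
        - D.xi y * D.Eeta y * laplacian D.g D.u y)
      + 2 * D.lenU y * tensorInner D.g y (hess D.g D.u y) (D.k y)
      + 2 * D.lenU y * (2 * D.xi y * (∑ i, ∑ j, D.k y i j * D.E y i * D.eta y j)
        - D.xi y * D.Eeta y * D.trk y) := by
  have hm := h.metric
  rw [← normSq_chargeTensor hm (ip_eta_eta hm hn), laplacian, trk,
    ← tensorInner_chargeTensor hm (hess_symm hm h.u2),
    ← tensorInner_chargeTensor hm h.k_symm.self_of_nhds]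
  simp only [normSq_eq_tensorInner, hessPlus, tensorInner_add_left, tensorInner_add_right hm,
    tensorInner_smul_left, tensorInner_smul_right hm]
  rw [tensorInner_symm hm (D.chargeTensor y) (hess D.g D.u y),
    tensorInner_symm hm (D.chargeTensor y) (D.k y),
    tensorInner_symm hm (D.k y) (hess D.g D.u y)]
  ring

lemma normSq_hessMinus (h : D.RegularAt y) (hn : D.nuU y ≠ -D.nuV y) :
    normSq D.g y (D.hessMinus y) = normSq D.g y (hess D.g D.v y)
      + D.xi y ^ 2 * (2 * D.normSqE y + D.Eeta y ^ 2)
      + D.lenV y ^ 2 * normSq D.g y (D.k y)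
      + 2 * (2 * D.xi y * (∑ i, ∑ j, hess D.g D.v y i j * D.E y i * D.eta y j)
        - D.xi y * D.Eeta y * laplacian D.g D.v y)
      - 2 * D.lenV y * tensorInner D.g y (hess D.g D.v y) (D.k y)
      - 2 * D.lenV y * (2 * D.xi y * (∑ i, ∑ j, D.k y i j * D.E y i * D.eta y j)
        - D.xi y * D.Eeta y * D.trk y) := by
  have hm := h.metric
  rw [← normSq_chargeTensor hm (ip_eta_eta hm hn), laplacian, trk,
    ← tensorInner_chargeTensor hm (hess_symm hm h.v2),
    ← tensorInner_chargeTensor hm h.k_symm.self_of_nhds]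
  have e : D.hessMinus y = hess D.g D.v y + D.chargeTensor y + (-D.lenV y) • D.k y := by
    rw [hessMinus, neg_smul, sub_eq_add_neg]
  rw [e]
  simp only [normSq_eq_tensorInner, tensorInner_add_left, tensorInner_add_right hm,
    tensorInner_smul_left, tensorInner_smul_right hm]
  rw [tensorInner_symm hm (D.chargeTensor y) (hess D.g D.v y),
    tensorInner_symm hm (D.chargeTensor y) (D.k y),
    tensorInner_symm hm (D.k y) (hess D.g D.v y)]
  ring

/-- The divergence identity in coordinates, where `ν_u ≠ -ν_v`. -/
theorem div_Z_of_ne (h : D.RegularAt y) (hs : D.SolvesAt y) (hn : D.nuU y ≠ -D.nuV y) :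
    DifferentiableAt ℝ D.Z y ∧
      div D.g D.Z y =
        1 / (2 * D.lenU y) * (normSq D.g y (D.hessPlus y)
          + D.lenU y ^ 2 * (2 * D.mu y - 2 * levelSetCurv D.g D.u y - 2 * D.normSqE y)
          + 2 * D.lenU y * D.pairJ y (D.gradU y))
        + 1 / (2 * D.lenV y) * (normSq D.g y (D.hessMinus y)
          + D.lenV y ^ 2 * (2 * D.mu y - 2 * levelSetCurv D.g D.v y - 2 * D.normSqE y)
          - 2 * D.lenV y * D.pairJ y (D.gradV y)) := by
  obtain ⟨hE, hu, hv, equ, eqv⟩ := hs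
  have hZ := Z_eventuallyEq h hu hv
  have d1 := differentiableAt_neutralZ h hu hv
  have d2 : ∀ i, DifferentiableAt ℝ (fun z => ((2 * (D.xi z * D.lenNu z)) • D.E z) i) y := fun i =>
    ((differentiableAt_xi_mul_lenNu h hu hv hn).const_mul 2).fun_mul (differentiableAt_E h i)
  refine ⟨hZ.differentiableAt_iff.2 (differentiableAt_pi.2 fun i => (d1 i).fun_add (d2 i)), ?_⟩
  rw [div_congr hZ, div_add d1 d2, div_neutralZ h hu hv, div_charge h hu hv hn hE,
    normSq_hessPlus h hn, normSq_hessMinus h hn, mu, xi_sq, equ, eqv]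
  have hx := (xi_pos hu hv).ne'
  have e1 : (D.xi y)⁻¹ = D.xi y / (D.lenU y * D.lenV y) := by
    rw [← xi_sq]; field_simp
  rw [e1]
  field_simp
  -- The ξ² still present comes from inserting the equations for Δu and Δv, each of which contains
  -- ξE_η.
  have e2 := xi_sq D y
  generalize D.xi y = ξ at *
  generalize D.lenU y = a at *
  generalize D.lenV y = b at *
  linear_combination (a + b) * D.Eeta y ^ 2 * e2

/-- The divergence identity in coordinates, where `ν_u = -ν_v`. -/
theorem div_Z_of_eq (h : D.RegularAt y) (hs : D.SolvesAt y) (hn : D.nuU y = -D.nuV y) :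
    ((∀ᶠ z in 𝓝 y, D.nuU z = -D.nuV z) → DifferentiableAt ℝ D.Z y) ∧
      (DifferentiableAt ℝ D.Z y →
        div D.g D.Z y =
          1 / (2 * D.lenU y) * (normSq D.g y (D.hessPlus y)
            + D.lenU y ^ 2 * (2 * D.mu y - 2 * levelSetCurv D.g D.u y)
            + 2 * D.lenU y * D.pairJ y (D.gradU y))
          + 1 / (2 * D.lenV y) * (normSq D.g y (D.hessMinus y)
            + D.lenV y ^ 2 * (2 * D.mu y - 2 * levelSetCurv D.g D.v y)
            - 2 * D.lenV y * D.pairJ y (D.gradV y))) := by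
  obtain ⟨-, hu, hv, equ, eqv⟩ := hs
  have hZ := Z_eventuallyEq h hu hv
  have d1 := differentiableAt_neutralZ h hu hv
  refine ⟨fun hev => ?_, fun hd => ?_⟩
  · have hZ' : D.Z =ᶠ[𝓝 y] D.neutralZ := by
      filter_upwards [hZ, hev, h.eventually] with z h1 h2 h3
      have hl : D.lenNu z = 0 := by
        by_contra hc
        exact (lenNu_ne_zero_iff h3.metric).1 hc h2
      rw [h1, hl, mul_zero, mul_zero, zero_smul, add_zero]
    exact hZ'.differentiableAt_iff.2 (differentiableAt_pi.2 d1)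
  -- The coefficient is a square root at a zero and need not be differentiable. Its product with `E`
  -- is, being the difference of Z and the uncharged part.
  · have d2 : ∀ i, DifferentiableAt ℝ (fun z => ((2 * (D.xi z * D.lenNu z)) • D.E z) i) y := by
      intro i
      have := (differentiableAt_pi.1 (hZ.differentiableAt_iff.1 hd) i).fun_sub (d1 i)
      simpa only [Pi.add_apply, add_sub_cancel_left] using this
    have hη : D.eta y = 0 := by rw [eta, if_neg (not_not.2 hn)]
    have hEη : D.Eeta y = 0 := by simp [Eeta, hη, ip]
    have hC : D.chargeTensor y = 0 := by
      ext i j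
      simp [chargeTensor, hη, hEη, lower]
    have hm := h.metric
    have e1 : normSq D.g y (D.hessPlus y) = normSq D.g y (hess D.g D.u y)
        + 2 * D.lenU y * tensorInner D.g y (hess D.g D.u y) (D.k y)
        + D.lenU y ^ 2 * normSq D.g y (D.k y) := by
      simp only [normSq_eq_tensorInner, hessPlus, hC, add_zero, tensorInner_add_left,
        tensorInner_add_right hm, tensorInner_smul_left, tensorInner_smul_right hm]
      rw [tensorInner_symm hm (D.k y) (hess D.g D.u y)]
      ring
    have e2 : normSq D.g y (D.hessMinus y) = normSq D.g y (hess D.g D.v y)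
        - 2 * D.lenV y * tensorInner D.g y (hess D.g D.v y) (D.k y)
        + D.lenV y ^ 2 * normSq D.g y (D.k y) := by
      simp only [normSq_eq_tensorInner, hessMinus, hC, add_zero, sub_eq_add_neg, ← neg_smul,
        tensorInner_add_left, tensorInner_add_right hm, tensorInner_smul_left,
        tensorInner_smul_right hm]
      rw [tensorInner_symm hm (D.k y) (hess D.g D.v y)]
      ring
    rw [div_congr hZ, div_add d1 d2, div_neutralZ h hu hv, div_charge_of_eq h hu hv hn, e1, e2,
      mu, equ, eqv, hEη]
    field_simp
    ring

end CoordData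

/-! ### From the manifold to coordinates: regularity of chart expressions and the induced metric. -/

namespace InitialDataSet

open CoordGeom

variable {M : Type*} [TopologicalSpace M] [ChartedSpace (Coord 3) M]

section Chart

variable {φ : OpenPartialHomeomorph M (Coord 3)}

lemma mdifferentiable_chart (hφ : φ ∈ IsManifold.maximalAtlas (𝓡 3) ∞ M) :
    φ.MDifferentiable (𝓡 3) (𝓡 3) :=
  ⟨(contMDiffOn_of_mem_maximalAtlas hφ).mdifferentiableOn (by simp),
    (contMDiffOn_symm_of_mem_maximalAtlas hφ).mdifferentiableOn (by simp)⟩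

/-- A tangent vector is the combination of the coordinate vectors with its components. -/
lemma sum_components_coordVec (φ : OpenPartialHomeomorph M (Coord 3)) (y : Coord 3)
    (X : Coord 3) :
    (mfderiv (𝓡 3) (𝓡 3) φ.symm y X : TangentSpace (𝓡 3) (φ.symm y)) =
      ∑ i, X i • coordVec φ i y := by
  have : X = ∑ i, X i • EuclideanSpace.single i (1 : ℝ) := by
    ext j
    simp [Finset.sum_apply, Pi.single_apply]
  conv_lhs => rw [this]
  simp only [coordVec]
  erw [map_sum]
  exact Finset.sum_congr rfl fun i _ => map_smul _ _ _

lemma isManifold_one (M : Type*) [TopologicalSpace M] [ChartedSpace (Coord 3) M]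
    [IsManifold (𝓡 3) ∞ M] : IsManifold (𝓡 3) 1 M :=
  IsManifold.of_le (n := ∞) (by simp)

lemma sum_bilinear_coordVec (y : Coord 3)
    (b : TangentSpace (𝓡 3) (φ.symm y) →L[ℝ] TangentSpace (𝓡 3) (φ.symm y) →L[ℝ] ℝ)
    (X Y : Coord 3) :
    b (mfderiv (𝓡 3) (𝓡 3) φ.symm y X) (mfderiv (𝓡 3) (𝓡 3) φ.symm y Y) =
      ∑ i, ∑ j, b (coordVec φ i y) (coordVec φ j y) * X i * Y j := by
  rw [sum_components_coordVec φ y X, sum_components_coordVec φ y Y]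
  simp only [map_sum, map_smul, _root_.sum_apply, _root_.smul_apply, smul_eq_mul, Finset.mul_sum]
  rw [Finset.sum_comm]
  exact Finset.sum_congr rfl fun i _ => Finset.sum_congr rfl fun j _ => by ring

variable [IsManifold (𝓡 3) ∞ M]

/-- The coordinate vector fields are smooth. -/
lemma contMDiffAt_coordVec (hφ : φ ∈ IsManifold.maximalAtlas (𝓡 3) ∞ M) {y : Coord 3}
    (hy : y ∈ φ.target) (i : Fin 3) :
    ContMDiffAt (𝓡 3) (𝓡 3).tangent 2
      (fun z => (TotalSpace.mk' (Coord 3) (φ.symm z) (coordVec φ i z) : TangentBundle (𝓡 3) M))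
      y := by
  have := isManifold_one M
  -- The coordinate field is the tangent map of `φ.symm` applied to a constant section.
  have h1 := (contMDiffOn_symm_of_mem_maximalAtlas hφ).contMDiffOn_tangentMapWithin (m := 2)
    (WithTop.coe_le_coe.2 (le_top (a := (2 + 1 : ℕ∞)))) φ.open_target.uniqueMDiffOn
  have h2 : ContMDiff (𝓡 3) (𝓡 3).tangent 2 (fun z : Coord 3 =>
      (TotalSpace.mk' (Coord 3) z (EuclideanSpace.single i (1 : ℝ) : Coord 3) :
        TangentBundle (𝓡 3) (Coord 3))) :=
    contMDiff_vectorSpace_iff_contDiff.2 contDiff_const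
  have h3 := h1.comp (s := φ.target) h2.contMDiffOn (fun z hz => hz)
  refine (h3.congr fun z hz => ?_).contMDiffAt (φ.open_target.mem_nhds hy)
  simp only [Function.comp, tangentMapWithin, mfderivWithin_of_isOpen φ.open_target hz]
  rfl

lemma contDiffAt_bilinear (hφ : φ ∈ IsManifold.maximalAtlas (𝓡 3) ∞ M) {y : Coord 3}
    (hy : y ∈ φ.target)
    {b : ∀ x : M, TangentSpace (𝓡 3) x →L[ℝ] TangentSpace (𝓡 3) x →L[ℝ] ℝ}
    (hb : ContMDiff (𝓡 3) ((𝓡 3).prod 𝓘(ℝ, Coord 3 →L[ℝ] Coord 3 →L[ℝ] ℝ)) ∞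
      (fun x : M => TotalSpace.mk' (Coord 3 →L[ℝ] Coord 3 →L[ℝ] ℝ)
        (E := fun x : M => TangentSpace (𝓡 3) x →L[ℝ] TangentSpace (𝓡 3) x →L[ℝ] ℝ) x (b x)))
    (i j : Fin 3) :
    ContDiffAt ℝ 2 (fun z => b (φ.symm z) (coordVec φ i z) (coordVec φ j z)) y := by
  have := isManifold_one M
  have hs : ContMDiffAt (𝓡 3) (𝓡 3) 2 φ.symm y :=
    (contMDiffAt_symm_of_mem_maximalAtlas hφ hy).of_le (WithTop.coe_le_coe.2 le_top)
  have h1 : ContMDiffAt (𝓡 3) ((𝓡 3).prod 𝓘(ℝ)) 2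
      (fun z ↦ TotalSpace.mk' ℝ (E := Bundle.Trivial M ℝ) (φ.symm z)
        (b (φ.symm z) (coordVec φ i z) (coordVec φ j z))) y := by
    apply ContMDiffAt.clm_bundle_apply₂ (F₁ := Coord 3) (F₂ := Coord 3)
    · exact ((hb.of_le (WithTop.coe_le_coe.2 le_top)).contMDiffAt (x := φ.symm y)).comp y hs
    · exact contMDiffAt_coordVec hφ hy i
    · exact contMDiffAt_coordVec hφ hy j
  rw [contMDiffAt_totalSpace] at h1
  exact h1.2.contDiffAt

lemma contDiffAt_components (hφ : φ ∈ IsManifold.maximalAtlas (𝓡 3) ∞ M) {y : Coord 3}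
    (hy : y ∈ φ.target) {E : ∀ x : M, TangentSpace (𝓡 3) x}
    (hE : ContMDiff (𝓡 3) (𝓡 3).tangent 1
      (fun x => (TotalSpace.mk' (Coord 3) x (E x) : TangentBundle (𝓡 3) M))) :
    ContDiffAt ℝ 1 (fun z => components φ (φ.symm z) (E (φ.symm z))) y := by
  have := isManifold_one M
  have h1 := (contMDiffOn_of_mem_maximalAtlas hφ).contMDiffOn_tangentMapWithin (m := 1)
    (WithTop.coe_le_coe.2 (le_top (a := (1 + 1 : ℕ∞)))) φ.open_source.uniqueMDiffOn
  have hs : ContMDiffOn (𝓡 3) (𝓡 3) 1 φ.symm φ.target :=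
    (contMDiffOn_symm_of_mem_maximalAtlas hφ).of_le (WithTop.coe_le_coe.2 le_top)
  have h2 := h1.comp (s := φ.target) (hE.comp_contMDiffOn hs) (fun z hz => φ.map_target hz)
  have h3 := (contMDiff_snd_tangentBundle_modelSpace (n := 1) (Coord 3) (𝓡 3)).comp_contMDiffOn h2
  have h4 : ContMDiffOn (𝓡 3) 𝓘(ℝ, Coord 3) 1
      (fun z => components φ (φ.symm z) (E (φ.symm z))) φ.target := by
    refine h3.congr fun z hz => ?_
    simp only [Function.comp, tangentMapWithin,
      mfderivWithin_of_isOpen φ.open_source (φ.map_target hz)]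
    rfl
  exact (h4.contMDiffAt (φ.open_target.mem_nhds hy)).contDiffAt

section InChart

variable (S : InitialDataSet M) (E : ∀ x : M, TangentSpace (𝓡 3) x) (u v : M → ℝ)

lemma ip_inChart (y : Coord 3) (X Y : Coord 3) :
    ip (S.inChart E u v φ).g y X Y = S.g.inner (φ.symm y)
      (mfderiv (𝓡 3) (𝓡 3) φ.symm y X) (mfderiv (𝓡 3) (𝓡 3) φ.symm y Y) :=
  (sum_bilinear_coordVec y (S.g.inner (φ.symm y)) X Y).symm

/-- Positive definiteness is inherited from the metric on M, because the differential of `φ.symm` is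
injective on the target of the chart. -/
lemma metricAt_inChart (hφ : φ ∈ IsManifold.maximalAtlas (𝓡 3) ∞ M) {y : Coord 3}
    (hy : y ∈ φ.target) : MetricAt (S.inChart E u v φ).g y := by
  refine ⟨contDiffAt_bilinear hφ hy S.g.contMDiff, ?_⟩
  filter_upwards [φ.open_target.mem_nhds hy] with z hz
  refine Matrix.PosDef.of_dotProduct_mulVec_pos ?_ fun X hX => ?_
  · ext i j
    exact S.g.symm _ _ _
  · have h1 := ip_inChart (φ := φ) S E u v z (WithLp.toLp 2 X) (WithLp.toLp 2 X)
    rw [star_trivial, ← ip_eq_dotProduct]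
    refine lt_of_lt_of_eq (S.g.pos _ _ fun h0 => hX ?_) h1.symm
    have h2 := (mdifferentiable_chart hφ).symm.mfderiv_injective hz
      (h0.trans (map_zero (mfderiv (𝓡 3) (𝓡 3) φ.symm z)).symm)
    exact congrArg (fun w : Coord 3 => (w : Fin 3 → ℝ)) h2

lemma regularAt_inChart (hφ : φ ∈ IsManifold.maximalAtlas (𝓡 3) ∞ M) {y : Coord 3}
    (hy : y ∈ φ.target) (hE : ContMDiff (𝓡 3) (𝓡 3).tangent 1
      (fun x => (TotalSpace.mk' (Coord 3) x (E x) : TangentBundle (𝓡 3) M)))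
    (hu : ContMDiff (𝓡 3) 𝓘(ℝ) 3 u) (hv : ContMDiff (𝓡 3) 𝓘(ℝ) 3 v) :
    (S.inChart E u v φ).RegularAt y := by
  have hs : ContMDiffAt (𝓡 3) (𝓡 3) 3 φ.symm y :=
    (contMDiffAt_symm_of_mem_maximalAtlas hφ hy).of_le (WithTop.coe_le_coe.2 le_top)
  refine ⟨S.metricAt_inChart E u v hφ hy,
    fun i j => (contDiffAt_bilinear hφ hy S.k_smooth i j).of_le (by norm_num),
    Filter.Eventually.of_forall fun z i j => S.k_symm _ _ _, fun i => ?_,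
    ((hu.contMDiffAt (x := φ.symm y)).comp y hs).contDiffAt,
    ((hv.contMDiffAt (x := φ.symm y)).comp y hs).contDiffAt⟩
  exact ((EuclideanSpace.proj i : Coord 3 →L[ℝ] ℝ).contDiff.contDiffAt).comp y
    (contDiffAt_components hφ hy hE)

/-- The induced metric of a parametrized surface, computed in a chart. -/
lemma inducedMetric_eq_firstForm (hφ : φ ∈ IsManifold.maximalAtlas (𝓡 3) ∞ M)
    {F : Coord 2 → M} {s : Coord 2} (hs : F s ∈ φ.source)
    (hF : MDifferentiableAt (𝓡 2) (𝓡 3) F s) :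
    S.inducedMetric F s = firstForm (S.inChart E u v φ).g (φ ∘ F) s := by
  have hc := mdifferentiable_chart hφ
  have hcomp := mfderiv_comp s (hc.mdifferentiableAt hs) hF
  have hd : DifferentiableAt ℝ (φ ∘ F) s :=
    ((hc.mdifferentiableAt hs).comp s hF).differentiableAt
  let W : Fin 2 → Coord 3 := fun a => mfderiv (𝓡 3) (𝓡 3) φ (F s)
    (mfderiv (𝓡 2) (𝓡 3) F s (EuclideanSpace.single a (1 : ℝ) : Coord 2))
  have hT : ∀ a, tangentVec (φ ∘ F) a s = W a := by
    intro a
    ext i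
    rw [tangentVec_apply hd, ← mfderiv_eq_fderiv]
    exact congrArg (fun w : Coord 3 => w i)
      (congrArg (fun L : Coord 2 →L[ℝ] Coord 3 => L (EuclideanSpace.single a 1)) hcomp)
  have hinv : ∀ X : TangentSpace (𝓡 3) (F s), mfderiv (𝓡 3) (𝓡 3) φ.symm (φ (F s))
      (mfderiv (𝓡 3) (𝓡 3) φ (F s) X) = X := fun X =>
    congrArg (fun L : TangentSpace (𝓡 3) (F s) →L[ℝ] TangentSpace (𝓡 3) (F s) => L X)
      (hc.symm_comp_deriv hs)
  ext a b
  rw [firstForm, hT, hT, ip_inChart]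
  change _ = S.g.inner (φ.symm (φ (F s))) (mfderiv (𝓡 3) (𝓡 3) φ.symm (φ (F s)) (W a))
    (mfderiv (𝓡 3) (𝓡 3) φ.symm (φ (F s)) (W b))
  rw [hinv, hinv]
  -- The base points `φ.symm (φ (F s))` and `F s` agree only propositionally. All tangent spaces are
  -- `Coord 3`, so the metrics there can be compared after substitution.
  have hg : ∀ q : M, q = F s → ∀ X Y : Coord 3,
      (S.g.inner q : Coord 3 →L[ℝ] Coord 3 →L[ℝ] ℝ) X Y =
        (S.g.inner (F s) : Coord 3 →L[ℝ] Coord 3 →L[ℝ] ℝ) X Y := by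
    rintro q rfl X Y
    rfl
  exact (hg _ (φ.left_inv hs) _ _).symm

end InChart

end Chart

end InitialDataSet

/-! ### Locality of the curvature and existence of level set parametrizations. -/

namespace CoordGeom

lemma christoffel_congr {n : ℕ} {G H : Coord n → Matrix (Fin n) (Fin n) ℝ} {x : Coord n}
    (h : G =ᶠ[𝓝 x] H) (l i j : Fin n) : christoffel G l i j x = christoffel H l i j x := by
  have e : ∀ i a b, pd i (fun y => G y a b) x = pd i (fun y => H y a b) x := fun i a b =>
    pd_congr i (h.mono fun y hy => congrFun (congrFun hy a) b)
  simp only [christoffel, e, h.self_of_nhds]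

lemma riemann_congr {n : ℕ} {G H : Coord n → Matrix (Fin n) (Fin n) ℝ} {x : Coord n}
    (h : G =ᶠ[𝓝 x] H) (l k i j : Fin n) : riemann G l k i j x = riemann H l k i j x := by
  have e : ∀ m l i j, pd m (christoffel G l i j) x = pd m (christoffel H l i j) x :=
    fun m l i j => pd_congr m (h.eventuallyEq_nhds.mono fun y hy => christoffel_congr hy l i j)
  simp only [riemann, e, christoffel_congr h]

lemma gaussCurv_congr {G H : Coord 2 → Matrix (Fin 2) (Fin 2) ℝ} {x : Coord 2}
    (h : G =ᶠ[𝓝 x] H) : gaussCurv G x = gaussCurv H x := by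
  simp only [gaussCurv, riemann_congr h, h.self_of_nhds]

/-- A regular level set of a `C³` function has a `C³` parametrization. -/
lemma exists_levelSet_param {f : Coord 3 → ℝ} {y : Coord 3} (hf : ContDiffAt ℝ 3 f y)
    (hd : ∃ i, pd i f y ≠ 0) :
    ∃ F : Coord 2 → Coord 3, F 0 = y ∧ ContDiffAt ℝ 3 F 0 ∧
      (∀ᶠ s in 𝓝 (0 : Coord 2), f (F s) = f y) ∧ Function.Injective (fderiv ℝ F 0) := by
  obtain ⟨m, hm⟩ := hd
  have hfd : HasFDerivAt f (fderiv ℝ f y) y := (hf.differentiableAt (by norm_num)).hasFDerivAt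
  let q : Coord 3 →L[ℝ] ℝ := EuclideanSpace.proj m
  let e : Coord 3 := EuclideanSpace.single m 1
  have hqe : q e = 1 := by simp [q, e]
  -- replace the coordinate `m` by `f`
  let Φ : Coord 3 → Coord 3 := fun x => x + (f x - f y - q (x - y)) • e
  let L : Coord 3 →L[ℝ] Coord 3 :=
    ContinuousLinearMap.id ℝ (Coord 3) + (fderiv ℝ f y - q).smulRight e
  have hΦy : Φ y = y := by simp [Φ]
  have hΦc : ContDiffAt ℝ 3 Φ y :=
    contDiffAt_id.add (((hf.sub contDiffAt_const).sub
      (q.contDiff.contDiffAt.comp y (contDiffAt_id.sub contDiffAt_const))).smul contDiffAt_const)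
  have hΦd : HasFDerivAt Φ L y := by
    have h1 : HasFDerivAt (fun x => q (x - y)) q y :=
      q.hasFDerivAt.comp y ((hasFDerivAt_id y).sub_const y)
    exact (hasFDerivAt_id y).add (((hfd.sub_const (f y)).sub h1).smul_const e)
  have hLinj : Function.Injective L := by
    rw [injective_iff_map_eq_zero]
    intro v hv
    have h1 : v = -((fderiv ℝ f y v - q v) • e) := eq_neg_of_add_eq_zero_left hv
    have h2 : fderiv ℝ f y v = 0 := by
      have h3 := congrArg q hv
      simp only [L, _root_.add_apply, ContinuousLinearMap.id_apply, ContinuousLinearMap.smulRight_apply,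
        _root_.sub_apply, map_add, map_smul, hqe, smul_eq_mul, mul_one, map_zero] at h3
      linarith
    rw [h2, zero_sub, neg_smul, neg_neg] at h1
    rw [h1, map_smul, smul_eq_mul] at h2
    rcases mul_eq_zero.1 h2 with h3 | h3
    · rw [h1, h3, zero_smul]
    · exact absurd h3 hm
  let A : Coord 3 ≃L[ℝ] Coord 3 :=
    (LinearEquiv.ofInjectiveEndo L.toLinearMap hLinj).toContinuousLinearEquiv
  have hA : (A : Coord 3 →L[ℝ] Coord 3) = L := by ext v; rfl
  have hΦd' : HasFDerivAt Φ (A : Coord 3 →L[ℝ] Coord 3) y := hA ▸ hΦd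
  let Ψ := hΦc.localInverse hΦd' (by norm_num)
  have hΨc : ContDiffAt ℝ 3 Ψ y := by
    have := hΦc.to_localInverse hΦd' (by norm_num)
    rwa [hΦy] at this
  have hΨy : Ψ y = y := by
    have := hΦc.localInverse_apply_image hΦd' (by norm_num)
    rwa [hΦy] at this
  have hright : ∀ᶠ z in 𝓝 y, Φ (Ψ z) = z := by
    have := (hΦc.hasStrictFDerivAt' hΦd' (by norm_num)).eventually_right_inverse
    rwa [hΦy] at this
  -- Embeds the plane as the coordinates other than `m`. The parametrization is the inverse of `Φ`
  -- restricted to this plane through `y`.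
  let ι : Coord 2 →L[ℝ] Coord 3 :=
    ∑ a, (EuclideanSpace.proj a : Coord 2 →L[ℝ] ℝ).smulRight
      (EuclideanSpace.single (m.succAbove a) (1 : ℝ))
  have hι : ∀ s i, ι s i = ∑ a, s a * (if i = m.succAbove a then 1 else 0) := by
    intro s i
    simp [ι]
  have hιm : ∀ s, q (ι s) = 0 := fun s =>
    (hι s m).trans (Finset.sum_eq_zero fun a _ => by rw [if_neg (Fin.succAbove_ne m a).symm, mul_zero])
  have hιinj : Function.Injective ι := by
    rw [injective_iff_map_eq_zero]
    intro s hs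
    ext a
    have h1 := hι s (m.succAbove a)
    rw [hs] at h1
    simpa [Fin.succAbove_right_inj] using h1.symm
  let F : Coord 2 → Coord 3 := fun s => Ψ (y + ι s)
  have hc0 : ContDiffAt ℝ 3 (fun s => y + ι s) (0 : Coord 2) :=
    contDiffAt_const.add ι.contDiff.contDiffAt
  have hF0 : F 0 = y := by simp [F, hΨy]
  have hFc : ContDiffAt ℝ 3 F 0 := by
    refine ContDiffAt.comp (0 : Coord 2) ?_ hc0
    rw [map_zero, add_zero]
    exact hΨc
  have hΦF : ∀ᶠ s in 𝓝 (0 : Coord 2), Φ (F s) = y + ι s := by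
    have : Filter.Tendsto (fun s => y + ι s) (𝓝 (0 : Coord 2)) (𝓝 y) := by
      simpa using hc0.continuousAt.tendsto
    exact this.eventually hright
  refine ⟨F, hF0, hFc, ?_, ?_⟩
  · filter_upwards [hΦF] with s hs
    have h1 := congrArg q hs
    -- The `m`-th coordinate of `Φ x` is `y m + f x - f y`, while that of `y + ι s` is `y m`.
    simp only [Φ, map_add, map_smul, map_sub, hqe, hιm, smul_eq_mul] at h1
    linarith
  · have h1 : HasFDerivAt (Φ ∘ F) (L.comp (fderiv ℝ F 0)) 0 := by
      refine HasFDerivAt.comp (g := Φ) (0 : Coord 2) ?_ (hFc.differentiableAt (by norm_num)).hasFDerivAt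
      rwa [hF0]
    have h2 : HasFDerivAt (Φ ∘ F) ι 0 := by
      refine HasFDerivAt.congr_of_eventuallyEq ?_ hΦF
      exact ι.hasFDerivAt.const_add y
    -- The chain rule gives `L ∘ DF = ι` at 0, so `DF` inherits the injectivity of `ι`.
    have h3 := h1.unique h2
    have h4 : Function.Injective (L ∘ fderiv ℝ F 0) := by
      rw [← ContinuousLinearMap.coe_comp, h3]
      exact hιinj
    exact Function.Injective.of_comp h4

end CoordGeom

/-! ### The Gaussian curvature of level sets on the manifold. -/

namespace InitialDataSet

open CoordGeom

variable {M : Type*} [TopologicalSpace M] [ChartedSpace (Coord 3) M] [IsManifold (𝓡 3) ∞ M]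
  (S : InitialDataSet M) (E : ∀ x : M, TangentSpace (𝓡 3) x) (u v : M → ℝ)
  {φ : OpenPartialHomeomorph M (Coord 3)} {p : M} {f : M → ℝ}

/-- The curvature of a parametrized level set, computed in a chart. -/
lemma gaussCurv_inducedMetric (hφ : φ ∈ IsManifold.maximalAtlas (𝓡 3) ∞ M) (hp : p ∈ φ.source)
    (hf : ContDiffAt ℝ 3 (f ∘ φ.symm) (φ p))
    (h0 : len (S.inChart E u v φ).g (φ p) (grad (S.inChart E u v φ).g (f ∘ φ.symm) (φ p)) ≠ 0)
    {F : Coord 2 → M} (hF : IsLevelSetParam f p F) :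
    gaussCurv (S.inducedMetric F) 0 = levelSetCurv (S.inChart E u v φ).g (f ∘ φ.symm) (φ p) := by
  have hc := mdifferentiable_chart hφ
  have hF0 : (φ ∘ F) 0 = φ p := congrArg φ hF.map_zero
  have hs0 : F 0 ∈ φ.source := by rwa [hF.map_zero]
  have hev : ∀ᶠ s in 𝓝 (0 : Coord 2), F s ∈ φ.source :=
    hF.contMDiffAt.continuousAt.eventually (φ.open_source.mem_nhds hs0)
  have hev2 : ∀ᶠ s in 𝓝 (0 : Coord 2), MDifferentiableAt (𝓡 2) (𝓡 3) F s := by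
    have := isManifold_one M
    have h1 : ContMDiffAt (𝓡 2) (𝓡 3) 1 F 0 := hF.contMDiffAt.of_le (by norm_num)
    filter_upwards [(contMDiffAt_iff_contMDiffAt_nhds (by simp)).1 h1] with s hs
    exact hs.mdifferentiableAt (by norm_num)
  have hcongr : S.inducedMetric F =ᶠ[𝓝 0] firstForm (S.inChart E u v φ).g (φ ∘ F) := by
    filter_upwards [hev, hev2] with s h1 h2
    exact S.inducedMetric_eq_firstForm E u v hφ h1 h2
  have hFc : ContDiffAt ℝ 3 (φ ∘ F) 0 := by
    have h1 : ContMDiffAt (𝓡 3) (𝓡 3) 3 φ (F 0) :=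
      (contMDiffAt_of_mem_maximalAtlas hφ hs0).of_le (WithTop.coe_le_coe.2 le_top)
    exact (h1.comp (0 : Coord 2) hF.contMDiffAt).contDiffAt
  have hinj : Function.Injective (fderiv ℝ (φ ∘ F) 0) := by
    have h1 := mfderiv_comp (0 : Coord 2) (hc.mdifferentiableAt hs0) hev2.self_of_nhds
    rw [mfderiv_eq_fderiv] at h1
    have h2 : Function.Injective ((mfderiv (𝓡 3) (𝓡 3) φ (F 0)).comp
        (mfderiv (𝓡 2) (𝓡 3) F 0)) := (hc.mfderiv_injective hs0).comp hF.immersion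
    exact h1 ▸ h2
  have hlev : ∀ᶠ s in 𝓝 (0 : Coord 2), (f ∘ φ.symm) ((φ ∘ F) s) = (f ∘ φ.symm) ((φ ∘ F) 0) := by
    filter_upwards [hev, hF.level] with s h1 h2
    simp only [Function.comp, φ.left_inv h1, h2, hF.map_zero, φ.left_inv hp]
  rw [gaussCurv_congr hcongr]
  have hm : MetricAt (S.inChart E u v φ).g (φ p) :=
    S.metricAt_inChart E u v hφ (φ.map_source hp)
  rw [← hF0] at hm hf h0 ⊢
  exact gaussCurv_eq_levelSetCurv hm hFc hinj hf hlev h0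

lemma exists_isLevelSetParam (hφ : φ ∈ IsManifold.maximalAtlas (𝓡 3) ∞ M) (hp : p ∈ φ.source)
    (hf : ContDiffAt ℝ 3 (f ∘ φ.symm) (φ p))
    (h0 : len (S.inChart E u v φ).g (φ p) (grad (S.inChart E u v φ).g (f ∘ φ.symm) (φ p)) ≠ 0) :
    ∃ F : Coord 2 → M, IsLevelSetParam f p F := by
  have hy := φ.map_source hp
  have hc := mdifferentiable_chart hφ
  obtain ⟨F, hF0, hFc, hlev, hinj⟩ := exists_levelSet_param hf
    ((grad_ne_zero_iff (S.metricAt_inChart E u v hφ hy)).1 h0)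
  have hy0 : F 0 ∈ φ.target := by rwa [hF0]
  have hs : ContMDiffAt (𝓡 3) (𝓡 3) 3 φ.symm (F 0) :=
    (contMDiffAt_symm_of_mem_maximalAtlas hφ hy0).of_le (WithTop.coe_le_coe.2 le_top)
  have hFm : ContMDiffAt (𝓡 2) (𝓡 3) 3 F 0 := hFc.contMDiffAt
  refine ⟨φ.symm ∘ F, ?_, hs.comp (0 : Coord 2) hFm, ?_, ?_⟩
  · simp only [Function.comp, hF0, φ.left_inv hp]
  · filter_upwards [hlev] with s h1
    simpa only [Function.comp, φ.left_inv hp] using h1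
  · rw [mfderiv_comp (0 : Coord 2) (hc.mdifferentiableAt_symm hy0)
      (hFm.mdifferentiableAt (by norm_num)), mfderiv_eq_fderiv]
    exact (hc.symm.mfderiv_injective hy0).comp hinj

/-- The level sets of a `C³` function without critical points have a well-defined curvature, given
in every chart by the Gauss equation. -/
lemma exists_isLevelSetGaussCurv
    (hf : ∀ φ ∈ IsManifold.maximalAtlas (𝓡 3) ∞ M, ∀ p ∈ φ.source,
      ContDiffAt ℝ 3 (f ∘ φ.symm) (φ p) ∧
      len (S.inChart E u v φ).g (φ p) (grad (S.inChart E u v φ).g (f ∘ φ.symm) (φ p)) ≠ 0) :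
    ∃ K : M → ℝ, S.IsLevelSetGaussCurv f K ∧
      ∀ φ ∈ IsManifold.maximalAtlas (𝓡 3) ∞ M, ∀ p ∈ φ.source,
        K p = levelSetCurv (S.inChart E u v φ).g (f ∘ φ.symm) (φ p) := by
  have hchart : ∀ p : M, chartAt (Coord 3) p ∈ IsManifold.maximalAtlas (𝓡 3) ∞ M :=
    fun p => IsManifold.chart_mem_maximalAtlas p
  have hmem : ∀ p : M, p ∈ (chartAt (Coord 3) p).source := fun p => mem_chart_source _ p
  have hex : ∀ p, ∃ F : Coord 2 → M, IsLevelSetParam f p F := fun p =>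
    S.exists_isLevelSetParam E u v (hchart p) (hmem p) (hf _ (hchart p) p (hmem p)).1
      (hf _ (hchart p) p (hmem p)).2
  have hK : ∀ φ ∈ IsManifold.maximalAtlas (𝓡 3) ∞ M, ∀ p ∈ φ.source, ∀ F,
      IsLevelSetParam f p F → gaussCurv (S.inducedMetric F) 0 =
        levelSetCurv (S.inChart E u v φ).g (f ∘ φ.symm) (φ p) := fun φ hφ p hp F hF =>
    S.gaussCurv_inducedMetric E u v hφ hp (hf φ hφ p hp).1 (hf φ hφ p hp).2 hF
  -- The value for a chosen parametrization involves no chart, and `hK` equates it with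
  -- `levelSetCurv` in every chart. This gives independence of both the parametrization and the
  -- chart.
  refine ⟨fun p => gaussCurv (S.inducedMetric (hex p).choose) 0, fun p => ⟨hex p, fun F hF => ?_⟩,
    fun φ hφ p hp => hK φ hφ p hp _ (hex p).choose_spec⟩
  exact (hK _ (hchart p) p (hmem p) F hF).trans
    (hK _ (hchart p) p (hmem p) _ (hex p).choose_spec).symm

end InitialDataSet

/-! ### The divergence identity on the manifold. -/

theorem theorem3p3 {M : Type*} [TopologicalSpace M] [ChartedSpace (Coord 3) M]
    [IsManifold (𝓡 3) ∞ M] (S : InitialDataSet M)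
    (E : ∀ x : M, TangentSpace (𝓡 3) x)
    (hE : ContMDiff (𝓡 3) (𝓡 3).tangent 1
      (fun x => (TotalSpace.mk' (Coord 3) x (E x) : TangentBundle (𝓡 3) M)))
    (u v : M → ℝ) (hu : ContMDiff (𝓡 3) 𝓘(ℝ) 3 u) (hv : ContMDiff (𝓡 3) 𝓘(ℝ) 3 v)
    (hsol : ∀ φ ∈ IsManifold.maximalAtlas (𝓡 3) ∞ M, ∀ p ∈ φ.source,
      (S.inChart E u v φ).SolvesAt (φ p)) :
    ∃ Ku Kv : M → ℝ, S.IsLevelSetGaussCurv u Ku ∧ S.IsLevelSetGaussCurv v Kv ∧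
      ∀ φ ∈ IsManifold.maximalAtlas (𝓡 3) ∞ M, ∀ p ∈ φ.source,
        let D : CoordData := S.inChart E u v φ
        let y : Coord 3 := φ p
        (D.nuU y ≠ -D.nuV y →
          DifferentiableAt ℝ D.Z y ∧
          CoordGeom.div D.g D.Z y =
            1 / (2 * D.lenU y) * (CoordGeom.normSq D.g y (D.hessPlus y)
              + D.lenU y ^ 2 * (2 * D.mu y - 2 * Ku p - 2 * D.normSqE y)
              + 2 * D.lenU y * D.pairJ y (D.gradU y))
            + 1 / (2 * D.lenV y) * (CoordGeom.normSq D.g y (D.hessMinus y)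
              + D.lenV y ^ 2 * (2 * D.mu y - 2 * Kv p - 2 * D.normSqE y)
              - 2 * D.lenV y * D.pairJ y (D.gradV y))) ∧
        (D.nuU y = -D.nuV y →
          ((∀ᶠ z in 𝓝 y, D.nuU z = -D.nuV z) → DifferentiableAt ℝ D.Z y) ∧
          (DifferentiableAt ℝ D.Z y →
            CoordGeom.div D.g D.Z y =
              1 / (2 * D.lenU y) * (CoordGeom.normSq D.g y (D.hessPlus y)
                + D.lenU y ^ 2 * (2 * D.mu y - 2 * Ku p)
                + 2 * D.lenU y * D.pairJ y (D.gradU y))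
              + 1 / (2 * D.lenV y) * (CoordGeom.normSq D.g y (D.hessMinus y)
                + D.lenV y ^ 2 * (2 * D.mu y - 2 * Kv p)
                - 2 * D.lenV y * D.pairJ y (D.gradV y)))) := by
  have hreg : ∀ φ ∈ IsManifold.maximalAtlas (𝓡 3) ∞ M, ∀ p ∈ φ.source,
      (S.inChart E u v φ).RegularAt (φ p) := fun φ hφ p hp =>
    S.regularAt_inChart E u v hφ (φ.map_source hp) hE hu hv
  obtain ⟨Ku, hKu, hKu'⟩ := S.exists_isLevelSetGaussCurv E u v (f := u) fun φ hφ p hp =>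
    ⟨(hreg φ hφ p hp).u_contDiffAt, (hsol φ hφ p hp).lenU_ne_zero⟩
  obtain ⟨Kv, hKv, hKv'⟩ := S.exists_isLevelSetGaussCurv E u v (f := v) fun φ hφ p hp =>
    ⟨(hreg φ hφ p hp).v_contDiffAt, (hsol φ hφ p hp).lenV_ne_zero⟩
  refine ⟨Ku, Kv, hKu, hKv, fun φ hφ p hp => ?_⟩
  rw [hKu' φ hφ p hp, hKv' φ hφ p hp]
  exact ⟨CoordData.div_Z_of_ne (hreg φ hφ p hp) (hsol φ hφ p hp),
    CoordData.div_Z_of_eq (hreg φ hφ p hp) (hsol φ hφ p hp)⟩
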